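/- Let $k$ be a field, let $S$ be a smooth $k$-scheme of finite type, and let $\mathcal H$ be a vector bundle of rank $n$ on $S$. Let $\mathrm{Fl}(\mathcal H)\to S$ be the bundle of complete flags of subbundles of $\mathcal H$, let $\mathrm{Fr}(\mathcal H)\to S$ be the frame bundle, whose points are pairs $(s,f)$ of a point $s$ of $S$ and an isomorphism $f:k^n\to\mathcal H_s$, and let $\mathrm{Fl}=\mathrm{Fl}(k^n)$. For a flag $F_\bullet$, the member $F_i$ has rank $i$ $(0\le i\le n)$. Let $p,q:S\to\mathrm{Fl}(\mathcal H)$ be versal sections, i.e. the morphism $$\Phi_{p,q}:\mathrm{Fr}(\mathcal H)\to\mathrm{Fl}\times_k\mathrm{Fl},\qquad (s,f)\mapsto\bigl(f^{-1}(p_s),\,f^{-1}(q_s)\bigr)$$ is smooth. Let $\sigma,\tau\in S_n$, and let $\rho_\sigma$ and $\rho_\tau$ be reduced words of $\sigma$ and $\tau$ in the simple transpositions $s_r=(r\ \,r+1)$, $1\le r\le n-1$. The relative Schubert variety is $$X_\sigma(p)=\{(x,F_\bullet):\dim\bigl((p_x)_i\cap F_j\bigr)\ge\#\{b\le j:\sigma(b)\le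 i\}\text{ for all }0\le i,j\le n\}\subseteq\mathrm{Fl}(\mathcal H),$$ with its determinantal scheme structure: it is the closed subscheme of $\mathrm{Fl}(\mathcal H)$ on which, for all $i,j$, the minors of size $\#\{b\le j:\sigma(b)>i\}+1$ of the map from $F_j$ to the quotient of $\mathcal H$ by the $i$-th member of $p$ vanish. For a word $\rho=(s_{r_1},\dots,s_{r_\ell})$, the relative Bott-Samelson variety $Z_\rho(p)$ parametrizes a point $x$ of $S$ with complete flags $F^0_\bullet,\dots,F^\ell_\bullet$ of $\mathcal H_x$ such that $F^0_\bullet=p_x$ and $F^{m-1}_i=F^m_i$ for all $1\le m\le\ell$ and $i\ne r_m$. It maps to $\mathrm{Fl}(\mathcal H)$ by $(x,F^0_\bullet,\dots,F^\ell_\bullet)\mapsto(x,F^\ell_\bullet)$. The varieties $X_\tau(q)$ and $Z_\rho(q)$ are defined in the same way. All these spaces are understood through their functors of points on $S$-schemes. Then the functors of points of $Z_{\rho_\sigma}(p)\times_{\mathrm{Fl}(\mathcal H)}Z_{\rho_\tau}(q)$ and of the relative Richardson variety $X_\sigma(p)\cap X_\tau(q)$ (scheme-theoretic intersection) are representable by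 $S$-schemes, the map from the first to $\mathrm{Fl}(\mathcal H)$ factors through the second, and: 1. the fiber product $Z_{\rho_\sigma}(p)\times_{\mathrm{Fl}(\mathcal H)}Z_{\rho_\tau}(q)$ is smooth over $k$; 2. the resulting projection $$Z_{\rho_\sigma}(p)\times_{\mathrm{Fl}(\mathcal H)}Z_{\rho_\tau}(q)\longrightarrow X_\sigma(p)\cap X_\tau(q)$$ is proper and birational, i.e. it is an isomorphism over a dense open subscheme of the target whose preimage is dense in the source. Therefore $Z_{\rho_\sigma}(p)\times_{\mathrm{Fl}(\mathcal H)}Z_{\rho_\tau}(q)$ is a resolution of singularities of $X_\sigma(p)\cap X_\tau(q)$, i.e. the projection is a proper birational morphism from a scheme that is smooth over $k$. -/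

import Mathlib

open CategoryTheory Opposite AlgebraicGeometry

universe u

namespace RelFlag

/-- A rank-`n` vector bundle on a scheme `S`: an `S`-scheme `total` (the total space) whose sets of
`T`-points carry `Γ(T, 𝒪_T)`-module structures natural in the `S`-scheme `T`, and which is locally
on `S` isomorphic, compatibly with these structures, to affine `n`-space. -/
structure VectorBundle (S : Scheme.{u}) (n : ℕ) where
  total : Over S
  [addCommGroup : ∀ T : Over S, AddCommGroup (T ⟶ total)]
  [module : ∀ T : Over S, Module Γ(T.left, ⊤) (T ⟶ total)]
  comp_add : ∀ {T' T : Over S} (g : T' ⟶ T) (x y : T ⟶ total), g ≫ (x + y) = g ≫ x + g ≫ y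
  comp_smul : ∀ {T' T : Over S} (g : T' ⟶ T) (r : Γ(T.left, ⊤)) (x : T ⟶ total),
    g ≫ (r • x) = g.left.appTop.hom r • (g ≫ x)
  locally_trivial : ∀ s : S, ∃ U : S.Opens, s ∈ U ∧ ∃ e : Fin n → (Over.mk U.ι ⟶ total),
    ∀ {T : Over S} (g : T ⟶ Over.mk U.ι) (x : T ⟶ total),
      ∃! c : Fin n → Γ(T.left, ⊤), ∑ i, c i • (g ≫ e i) = x

namespace VectorBundle

variable {S : Scheme.{u}} {n : ℕ} (V : VectorBundle S n)

/-- The sections over `T` of the pullback of `V` along `T ⟶ S`. -/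
def Sec (T : Over S) : Type u := T ⟶ V.total

instance (T : Over S) : AddCommGroup (V.Sec T) := V.addCommGroup T

instance (T : Over S) : Module Γ(T.left, ⊤) (V.Sec T) := V.module T

/-- Pullback of sections. -/
def res {T' T : Over S} (g : T' ⟶ T) : V.Sec T →ₛₗ[g.left.appTop.hom] V.Sec T' where
  toFun x := g ≫ (show T ⟶ V.total from x)
  map_add' := V.comp_add g
  map_smul' := V.comp_smul g

theorem res_comp {T'' T' T : Over S} (h : T'' ⟶ T') (g : T' ⟶ T) (x : V.Sec T) :
    V.res (h ≫ g) x = V.res h (V.res g x) :=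
  Category.assoc (obj := Over S) h g x

theorem res_id {T : Over S} (x : V.Sec T) : V.res (𝟙 T) x = x :=
  Category.id_comp (obj := Over S) x

end VectorBundle

/-- An open subscheme of an `S`-scheme, as an `S`-scheme. -/
abbrev openOver {S : Scheme.{u}} (T : Over S) (U : T.left.Opens) : Over S :=
  Over.mk (U.ι ≫ T.hom)

abbrev openIncl {S : Scheme.{u}} (T : Over S) (U : T.left.Opens) : openOver T U ⟶ T :=
  Over.homMk U.ι

/-- A frame over `T` of a vector bundle `V` of rank `n`, that is, an isomorphism from the trivial
bundle of rank `n` to the pullback of `V` to `T`: a family of `n` sections which is a basis of the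
module of sections over every `T`-scheme. -/
@[ext]
structure Frame {S : Scheme.{u}} {n : ℕ} (V : VectorBundle S n) (T : Over S) where
  vec : Fin n → V.Sec T
  existsUnique : ∀ {T' : Over S} (g : T' ⟶ T) (x : V.Sec T'),
    ∃! c : Fin n → Γ(T'.left, ⊤), ∑ i, c i • V.res g (vec i) = x

/-- Pullback of a frame. -/
def Frame.res {S : Scheme.{u}} {n : ℕ} {V : VectorBundle S n} {T' T : Over S}
    (g : T' ⟶ T) (e : Frame V T) : Frame V T' where
  vec i := V.res g (e.vec i)
  existsUnique h x := by
    simpa only [VectorBundle.res_comp] using e.existsUnique (h ≫ g) x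

/-- A family `sub` of subfunctors of (the functor of points of) the pullback of `V` to `T` is
*adapted* to a frame `e` over the `T`-scheme `T'` if, over `T'`, the `i`-th subfunctor is the
subbundle spanned by the first `i` members of `e`. -/
def AdaptedTo {S : Scheme.{u}} {n : ℕ} {V : VectorBundle S n} {T : Over S}
    (sub : Fin (n + 1) → ∀ {T' : Over S}, (T' ⟶ T) → Submodule Γ(T'.left, ⊤) (V.Sec T'))
    {T' : Over S} (g : T' ⟶ T) (e : Frame V T') : Prop :=
  ∀ (i : Fin (n + 1)) {T'' : Over S} (h : T'' ⟶ T'),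
    sub i (h ≫ g) = Submodule.span Γ(T''.left, ⊤) 
      ((fun j ↦ V.res h (e.vec j)) '' {j | (j : ℕ) < i})

/-- A complete flag `0 = F₀ ⊂ F₁ ⊂ ⋯ ⊂ Fₙ` of subbundles of the pullback of `V` to `T`.  A
subbundle is given by its sections over all `T`-schemes `T'`; these are closed under pullback and
form a Zariski sheaf, and Zariski-locally on `T` there is a frame of `V` such that each `Fᵢ` is
spanned by its first `i` members. -/
@[ext]
structure Flag {S : Scheme.{u}} {n : ℕ} (V : VectorBundle S n) (T : Over S) where
  sub : Fin (n + 1) → ∀ {T' : Over S}, (T' ⟶ T) → Submodule Γ(T'.left, ⊤) (V.Sec T')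
  res_mem : ∀ {i : Fin (n + 1)} {T'' T' : Over S} (h : T'' ⟶ T') (g : T' ⟶ T) {x : V.Sec T'},
    x ∈ sub i g → V.res h x ∈ sub i (h ≫ g)
  mem_of_locally : ∀ {i : Fin (n + 1)} {T' : Over S} (g : T' ⟶ T) {x : V.Sec T'},
    (∀ t : T'.left, ∃ U : T'.left.Opens, t ∈ U ∧
      V.res (openIncl T' U) x ∈ sub i (openIncl T' U ≫ g)) → x ∈ sub i g
  exists_frame : ∀ t : T.left, ∃ U : T.left.Opens, t ∈ U ∧
    ∃ e : Frame V (openOver T U), AdaptedTo sub (openIncl T U) e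

section

variable {S : Scheme.{u}} {n : ℕ} {V : VectorBundle S n}

/-- Pullback of a flag. -/
def Flag.res {T' T : Over S} (g : T' ⟶ T) (F : Flag V T) : Flag V T' where
  sub i _ h := F.sub i (h ≫ g)
  res_mem h h' x hx := by simpa only [Category.assoc] using F.res_mem h (h' ≫ g) hx
  mem_of_locally h x hx := F.mem_of_locally (h ≫ g) (by simpa only [Category.assoc] using hx)
  exists_frame t := by
    obtain ⟨U, hU, e, he⟩ := F.exists_frame (g.left t)
    let k : openOver T' (g.left ⁻¹ᵁ U) ⟶ openOver T U :=
      Over.homMk (g.left ∣_ U) (by simp)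
    have hk : k ≫ openIncl T U = openIncl T' (g.left ⁻¹ᵁ U) ≫ g := by
      ext1; simp [k]
    refine ⟨g.left ⁻¹ᵁ U, hU, e.res k, fun i T'' h ↦ ?_⟩
    have := he i (h ≫ k)
    simpa only [Category.assoc, hk, VectorBundle.res_comp] using! this

theorem Flag.res_id {T : Over S} (F : Flag V T) : F.res (𝟙 T) = F := by
  refine Flag.ext ?_
  funext i _ h
  exact congrArg (F.sub i) (Category.comp_id h)

theorem Flag.res_comp {T'' T' T : Over S} (h : T'' ⟶ T') (g : T' ⟶ T) (F : Flag V T) :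
    F.res (h ≫ g) = (F.res g).res h := by
  refine Flag.ext ?_
  funext i _ k
  exact congrArg (F.sub i) (Category.assoc k h g).symm

/-- The flag bundle `Fl(V)` of `V`, as a functor of points on `S`-schemes. In particular a section
`S ⟶ Fl(V)` is an element of `Flag V (Over.mk (𝟙 S))`. -/
def flagBundle (V : VectorBundle S n) : (Over S)ᵒᵖ ⥤ Type (u + 1) where
  obj T := Flag V T.unop
  map g := ↾(Flag.res g.unop)
  map_id _ := ConcreteCategory.hom_ext _ _ fun F ↦ F.res_id
  map_comp g h := ConcreteCategory.hom_ext _ _ fun F ↦ F.res_comp h.unop g.unop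

end

/-- The total space of the trivial vector bundle of rank `n`: affine `n`-space. -/
noncomputable def trivialTotal (S : Scheme.{u}) (n : ℕ) : Over S :=
  Over.mk (𝔸(ULift.{u} (Fin n); S) ↘ S)

/-- A section of the trivial bundle is given by its `n` coordinate functions. -/
noncomputable def trivialCoord {S : Scheme.{u}} {n : ℕ} (T : Over S) :
    (T ⟶ trivialTotal S n) ≃ (Fin n → Γ(T.left, ⊤)) where
  toFun x i := x.left.appTop.hom (AffineSpace.coord S ⟨i⟩)
  invFun v := Over.homMk (AffineSpace.homOfVector T.hom (fun i ↦ v i.down))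
    (AffineSpace.homOfVector_over _ _)
  left_inv x := by
    ext1
    refine AffineSpace.hom_ext ?_ ?_
    · exact (AffineSpace.homOfVector_over _ _).trans (Over.w x).symm
    · intro i
      exact AffineSpace.homOfVector_appTop_coord _ _ i
  right_inv v := by
    funext i
    exact AffineSpace.homOfVector_appTop_coord _ _ _

theorem trivialCoord_comp {S : Scheme.{u}} {n : ℕ} {T' T : Over S} (g : T' ⟶ T)
    (x : T ⟶ trivialTotal S n) (i : Fin n) :
    trivialCoord T' (g ≫ x) i = g.left.appTop.hom (trivialCoord T x i) := by
  simp only [trivialCoord, Equiv.coe_fn_mk, Over.comp_left, Scheme.Hom.comp_appTop]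
  rfl

/-- The trivial vector bundle of rank `n`: its module structure is the one of `n`-tuples of
functions. -/
noncomputable def trivialBundle (S : Scheme.{u}) (n : ℕ) : VectorBundle S n where
  total := trivialTotal S n
  addCommGroup T := (trivialCoord T).addCommGroup
  module T :=
    letI := (trivialCoord (n := n) T).addCommGroup
    (trivialCoord T).module Γ(T.left, ⊤)
  comp_add {T' T} g x y := by
    let := fun T ↦ (trivialCoord (S := S) (n := n) T).addCommGroup
    apply (trivialCoord T').injective
    funext i
    rw [trivialCoord_comp, Equiv.add_def, Equiv.add_def, Equiv.apply_symm_apply,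
      Equiv.apply_symm_apply, Pi.add_apply, Pi.add_apply, trivialCoord_comp, trivialCoord_comp,
      map_add]
  comp_smul {T' T} g r x := by
    let := fun T ↦ (trivialCoord (S := S) (n := n) T).addCommGroup
    let := fun T ↦ (trivialCoord (S := S) (n := n) T).module Γ(T.left, ⊤)
    apply (trivialCoord T').injective
    funext i
    rw [trivialCoord_comp, Equiv.smul_def, Equiv.smul_def, Equiv.apply_symm_apply,
      Equiv.apply_symm_apply, Pi.smul_apply, Pi.smul_apply, trivialCoord_comp, smul_eq_mul,
      smul_eq_mul, map_mul]
  locally_trivial s := by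
    let := fun T ↦ (trivialCoord (S := S) (n := n) T).addCommGroup
    let := fun T ↦ (trivialCoord (S := S) (n := n) T).module Γ(T.left, ⊤)
    refine ⟨⊤, trivial, fun i ↦ (trivialCoord _).symm (Pi.single i 1), fun {T} g x ↦ ?_⟩
    have key : ∀ c : Fin n → Γ(T.left, ⊤),
        ∑ i, c i • (g ≫ (trivialCoord _).symm (Pi.single i 1)) = (trivialCoord T).symm c := by
      intro c
      apply (trivialCoord T).injective
      rw [Equiv.apply_symm_apply]
      have : ∀ y, trivialCoord (n := n) T y = (trivialCoord T).linearEquiv Γ(T.left, ⊤) y :=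
        fun _ ↦ rfl
      rw [this, map_sum]
      funext j
      rw [Finset.sum_apply, Finset.sum_eq_single j]
      · rw [map_smul, ← this, Pi.smul_apply, trivialCoord_comp, Equiv.apply_symm_apply,
          Pi.single_eq_same, map_one, smul_eq_mul, mul_one]
      · intro i _ hi
        rw [map_smul, ← this, Pi.smul_apply, trivialCoord_comp, Equiv.apply_symm_apply,
          Pi.single_eq_of_ne hi.symm, map_zero, smul_zero]
      · simp
    refine ⟨trivialCoord T x, (key _).trans (Equiv.symm_apply_apply _ _), fun c hc ↦ ?_⟩
    rw [← hc, key, Equiv.apply_symm_apply]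

/-- The coordinates of a section of the trivial bundle. -/
noncomputable def trivialBundle.coord {S : Scheme.{u}} {n : ℕ} (T : Over S) :
    (trivialBundle S n).Sec T ≃ₗ[Γ(T.left, ⊤)] (Fin n → Γ(T.left, ⊤)) :=
  letI := (trivialCoord (S := S) (n := n) T).addCommGroup
  letI := (trivialCoord (S := S) (n := n) T).module Γ(T.left, ⊤)
  (trivialCoord T).linearEquiv Γ(T.left, ⊤)

theorem trivialBundle.coord_res {S : Scheme.{u}} {n : ℕ} {T' T : Over S} (g : T' ⟶ T)
    (x : (trivialBundle S n).Sec T) (i : Fin n) :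
    coord T' ((trivialBundle S n).res g x) i = g.left.appTop.hom (coord T x i) :=
  trivialCoord_comp g x i

section

variable {S : Scheme.{u}} {n : ℕ} {V : VectorBundle S n}

/-- The isomorphism `𝒪ⁿ → V` given by a frame. -/
noncomputable def Frame.equiv {T : Over S} (e : Frame V T) :
    (Fin n → Γ(T.left, ⊤)) ≃ₗ[Γ(T.left, ⊤)] V.Sec T :=
  LinearEquiv.ofBijective (Fintype.linearCombination Γ(T.left, ⊤) e.vec) <| by
    rw [Function.bijective_iff_existsUnique]
    intro x
    have h := e.existsUnique (𝟙 T) x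
    simp only [VectorBundle.res_id] at h
    exact h

theorem Frame.equiv_apply {T : Over S} (e : Frame V T) (c : Fin n → Γ(T.left, ⊤)) :
    e.equiv c = ∑ i, c i • e.vec i := rfl

theorem Frame.equiv_res {T' T : Over S} (g : T' ⟶ T) (e : Frame V T)
    (c : Fin n → Γ(T.left, ⊤)) :
    (e.res g).equiv (fun i ↦ g.left.appTop.hom (c i)) = V.res g (e.equiv c) := by
  rw [equiv_apply, equiv_apply, map_sum]
  exact Finset.sum_congr rfl fun i _ ↦ ((V.res g).map_smulₛₗ (c i) (e.vec i)).symm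

variable {B : Scheme.{u}}

/-- For an `S`-scheme given as a morphism `f : T ⟶ S`, where `T` is a `B`-scheme, and a `B`-scheme
`T'` over `T`, the `S`-scheme `T'`. -/
abbrev overPull {T : Over B} (f : T.left ⟶ S) {T' : Over B} (g : T' ⟶ T) : Over S :=
  Over.mk (g.left ≫ f)

abbrev overPullHom {T : Over B} (f : T.left ⟶ S) {T' : Over B} (g : T' ⟶ T) :
    overPull f g ⟶ Over.mk f :=
  Over.homMk g.left

instance {T : Over B} (f : T.left ⟶ S) {T' : Over B} (g : T' ⟶ T) :
    Module Γ(T'.left, ⊤) (V.Sec (overPull f g)) :=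
  inferInstanceAs (Module Γ((overPull f g).left, ⊤) (V.Sec (overPull f g)))

/-- The isomorphism from the trivial bundle to `V` over `T'`, given by a frame of `V` over `T`. -/
noncomputable def Frame.trivialize {T : Over B} {f : T.left ⟶ S} (e : Frame V (Over.mk f))
    {T' : Over B} (g : T' ⟶ T) :
    (trivialBundle B n).Sec T' ≃ₗ[Γ(T'.left, ⊤)] V.Sec (overPull f g) :=
  (trivialBundle.coord T').trans (e.res (overPullHom f g)).equiv

theorem Frame.trivialize_res {T : Over B} {f : T.left ⟶ S} (e : Frame V (Over.mk f))
    {T' T'' : Over B} (g : T' ⟶ T) (g' : T'' ⟶ T) (h : T'' ⟶ T')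
    (k : overPull f g' ⟶ overPull f g) (hk : k.left = h.left) (hg : h ≫ g = g')
    (x : (trivialBundle B n).Sec T') :
    e.trivialize g' ((trivialBundle B n).res h x) = V.res k (e.trivialize g x) := by
  have hw : k ≫ overPullHom f g = overPullHom f g' := by
    ext1
    simp [hk, ← hg]
  have h1 : (e.res (overPullHom f g)).res k = e.res (overPullHom f g') := by
    refine Frame.ext (funext fun i ↦ ?_)
    change V.res k (V.res _ _) = V.res _ _
    rw [← VectorBundle.res_comp, hw]
  change (e.res (overPullHom f g')).equiv _ = V.res k ((e.res (overPullHom f g)).equiv _)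
  rw [← Frame.equiv_res, h1]
  refine congrArg _ (funext fun i ↦ ?_)
  exact (trivialBundle.coord_res h x i).trans (by rw [hk]; rfl)

/-- The flag in the trivial bundle which corresponds to the flag `F` of `V` under the isomorphism
`𝒪ⁿ ≅ V` given by a frame. -/
noncomputable def Frame.pullFlag {T : Over B} {f : T.left ⟶ S} (e : Frame V (Over.mk f))
    (F : Flag V (Over.mk f)) : Flag (trivialBundle B n) T where
  sub i T' g := Submodule.comap (e.trivialize g).toLinearMap
    (show Submodule Γ(T'.left, ⊤) (V.Sec (overPull f g)) from F.sub i (overPullHom f g))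
  res_mem {i T'' T'} h g x hx := by
    let k : overPull f (h ≫ g) ⟶ overPull f g := Over.homMk h.left
    have hk : k ≫ overPullHom f g = overPullHom f (h ≫ g) := by ext1; simp [k]
    have := F.res_mem k (overPullHom f g) hx
    rw [hk] at this
    change e.trivialize (h ≫ g) _ ∈ F.sub i (overPullHom f (h ≫ g))
    rw [e.trivialize_res g (h ≫ g) h k rfl rfl]
    exact this
  mem_of_locally {i T'} g x hx := by
    refine F.mem_of_locally (overPullHom f g) fun t ↦ ?_
    obtain ⟨U, hU, hxU⟩ := hx t
    refine ⟨U, hU, ?_⟩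
    let k : openOver (overPull f g) U ⟶ overPull f (openIncl T' U ≫ g) := Over.homMk (𝟙 _)
    have hk : k ≫ overPullHom f (openIncl T' U ≫ g) =
        openIncl (overPull f g) U ≫ overPullHom f g := by ext1; simp [k]
    let l : overPull f (openIncl T' U ≫ g) ⟶ overPull f g := Over.homMk U.ι
    have hl : k ≫ l = openIncl (overPull f g) U := by ext1; simp [k, l]
    have := F.res_mem k _ hxU
    rw [hk] at this
    change V.res k (e.trivialize (openIncl T' U ≫ g) _) ∈ _ at this
    rw [e.trivialize_res g _ (openIncl T' U) l rfl rfl, ← VectorBundle.res_comp, hl] at this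
    exact this
  exists_frame t := by
    obtain ⟨U, hU, d, hd⟩ := F.exists_frame t
    let k {T' : Over B} (h : T' ⟶ openOver T U) :
        overPull f (h ≫ openIncl T U) ⟶ openOver (Over.mk f) U := Over.homMk h.left
    have hk {T' : Over B} (h : T' ⟶ openOver T U) (j : Fin n) :
        e.trivialize (h ≫ openIncl T U) ((trivialBundle B n).res h
          ((e.trivialize (openIncl T U)).symm (d.vec j))) = V.res (k h) (d.vec j) := by
      exact (e.trivialize_res (openIncl T U) _ h (k h) rfl rfl _).trans
        (congrArg (V.res (k h)) ((e.trivialize (openIncl T U)).apply_symm_apply _))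
    refine ⟨U, hU, ⟨fun j ↦ (e.trivialize (openIncl T U)).symm (d.vec j), ?_⟩, ?_⟩
    · intro T' h x
      have := d.existsUnique (k h) (e.trivialize (h ≫ openIncl T U) x)
      refine (existsUnique_congr fun c ↦ ?_).mp this
      rw [← (e.trivialize (h ≫ openIncl T U)).injective.eq_iff, map_sum]
      simp only [map_smul, hk]
    · intro i T' h
      have h1 : k h ≫ openIncl (Over.mk f) U = overPullHom f (h ≫ openIncl T U) := by
        ext1; simp [k]
      have h2 := hd i (k h)
      rw [h1] at h2
      change Submodule.comap (e.trivialize (h ≫ openIncl T U)).toLinearMap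
        (F.sub i (overPullHom f (h ≫ openIncl T U))) = _
      rw [h2]
      simp only [← hk]
      have h3 := Submodule.map_span (e.trivialize (h ≫ openIncl T U)).toLinearMap
        ((fun j ↦ (trivialBundle B n).res h
          ((e.trivialize (openIncl T U)).symm (d.vec j))) '' {j | (j : ℕ) < i})
      rw [Set.image_image] at h3
      refine (congrArg (Submodule.comap (e.trivialize (h ≫ openIncl T U)).toLinearMap)
        h3.symm).trans ?_
      exact Submodule.comap_map_eq_of_injective (e.trivialize _).injective _

end

section

variable {S : Scheme.{u}} {n : ℕ}

/-- The complete flag in the pullback to `T` of `V` given by a section of `Fl(V)`. -/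
def Flag.at {V : VectorBundle S n} (p : Flag V (Over.mk (𝟙 S))) (T : Over S) : Flag V T :=
  p.res (Over.homMk T.hom)

variable {B : Scheme.{u}}

/-- A `T`-point of the frame bundle `Fr(V)`, where `S` is a `B`-scheme via `s` and `T` is a
`B`-scheme: a `B`-morphism `T ⟶ S` together with an isomorphism from the trivial bundle to the
pullback of `V` along this morphism. -/
structure FramePoint (s : S ⟶ B) (V : VectorBundle S n) (T : Over B) where
  toBase : T ⟶ Over.mk s
  frame : Frame V (Over.mk toBase.left)

theorem FramePoint.ext' {s : S ⟶ B} {V : VectorBundle S n} {T : Over B} {x y : FramePoint s V T}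
    (h : x.toBase = y.toBase) (k : Over.mk x.toBase.left ⟶ Over.mk y.toBase.left)
    (hk : k.left = 𝟙 T.left) (w : ∀ i, x.frame.vec i = V.res k (y.frame.vec i)) : x = y := by
  obtain ⟨f, e⟩ := x
  obtain ⟨g, d⟩ := y
  dsimp only at h
  subst h
  have : k = 𝟙 _ := by ext1; exact hk
  subst this
  congr 1
  exact Frame.ext (funext fun i ↦ (w i).trans (VectorBundle.res_id V _))

def FramePoint.res {s : S ⟶ B} {V : VectorBundle S n} {T' T : Over B} (g : T' ⟶ T)
    (x : FramePoint s V T) : FramePoint s V T' where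
  toBase := g ≫ x.toBase
  frame := Frame.res (T' := overPull x.toBase.left g) (overPullHom x.toBase.left g) x.frame

theorem FramePoint.res_id {s : S ⟶ B} {V : VectorBundle S n} {T : Over B}
    (x : FramePoint s V T) : x.res (𝟙 T) = x :=
  FramePoint.ext' (Category.id_comp _)
    (Over.homMk (𝟙 T.left) (congrArg (fun f ↦ 𝟙 _ ≫ CommaMorphism.left f)
      (Category.id_comp x.toBase).symm)) rfl fun _ ↦ rfl

theorem FramePoint.res_comp {s : S ⟶ B} {V : VectorBundle S n} {T'' T' T : Over B}
    (h : T'' ⟶ T') (g : T' ⟶ T) (x : FramePoint s V T) :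
    x.res (h ≫ g) = (x.res g).res h := by
  refine FramePoint.ext' (Category.assoc h g x.toBase)
    (Over.homMk (𝟙 T''.left) (by simp [FramePoint.res])) rfl fun i ↦ ?_
  refine Eq.trans ?_ ((V.res_comp _ _ _).trans (congrArg _ (V.res_comp _ _ _)))
  refine congrArg (fun z ↦ V.res z (x.frame.vec i)) ?_
  ext1
  exact (Category.id_comp _).symm

/-- The frame bundle `Fr(V)`, as a functor of points on `B`-schemes. -/
def frameBundle (s : S ⟶ B) (V : VectorBundle S n) : (Over B)ᵒᵖ ⥤ Type (u + 1) where
  obj T := ULift.{u + 1} (FramePoint s V T.unop)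
  map g := ↾fun x ↦ ⟨x.down.res g.unop⟩
  map_id _ := by
    refine ConcreteCategory.hom_ext _ _ fun x ↦ ?_
    exact ULift.ext _ _ (FramePoint.res_id x.down)
  map_comp g h := by
    refine ConcreteCategory.hom_ext _ _ fun x ↦ ?_
    exact ULift.ext _ _ (FramePoint.res_comp h.unop g.unop x.down)

/-- The product `Fl_n ×_B Fl_n` of two copies of the variety of complete flags in the trivial
bundle of rank `n` over `B`, as a functor of points on `B`-schemes. -/
noncomputable def flagPairs (B : Scheme.{u}) (n : ℕ) : (Over B)ᵒᵖ ⥤ Type (u + 1) where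
  obj T := Flag (trivialBundle B n) T.unop × Flag (trivialBundle B n) T.unop
  map g := ↾fun x ↦ (x.1.res g.unop, x.2.res g.unop)
  map_id _ := by
    refine ConcreteCategory.hom_ext _ _ fun x ↦ ?_
    exact Prod.ext (Flag.res_id x.1) (Flag.res_id x.2)
  map_comp g h := by
    refine ConcreteCategory.hom_ext _ _ fun x ↦ ?_
    exact Prod.ext (Flag.res_comp h.unop g.unop x.1) (Flag.res_comp h.unop g.unop x.2)

/-- The flag `f⁻¹(p_s)` in the trivial bundle over `T`, for a `T`-point `(s, f : 𝒪ⁿ ≅ V_s)` of the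
frame bundle and a section `p` of the flag bundle. -/
noncomputable def FramePoint.flag {s : S ⟶ B} {V : VectorBundle S n} {T : Over B}
    (x : FramePoint s V T) (p : Flag V (Over.mk (𝟙 S))) : Flag (trivialBundle B n) T :=
  x.frame.pullFlag (p.at _)

theorem FramePoint.flag_res {s : S ⟶ B} {V : VectorBundle S n} {T' T : Over B} (g : T' ⟶ T)
    (x : FramePoint s V T) (p : Flag V (Over.mk (𝟙 S))) :
    (x.res g).flag p = (x.flag p).res g := by
  refine Flag.ext ?_
  funext i T'' h
  ext c
  let k : overPull (x.res g).toBase.left h ⟶ overPull x.toBase.left (h ≫ g) :=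
    Over.homMk (𝟙 T''.left) (by simp [FramePoint.res])
  let l : overPull x.toBase.left (h ≫ g) ⟶ overPull (x.res g).toBase.left h :=
    Over.homMk (𝟙 T''.left) (by simp [FramePoint.res])
  have hlk : l ≫ k = 𝟙 _ := by
    ext1
    exact Category.comp_id (𝟙 T''.left)
  have hk : V.res k (x.frame.trivialize (h ≫ g) c) = (x.res g).frame.trivialize h c := by
    have h1 : (x.frame.res (overPullHom x.toBase.left (h ≫ g))).res k =
        (x.res g).frame.res (overPullHom (x.res g).toBase.left h) := by
      refine Frame.ext (funext fun j ↦ ?_)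
      refine (V.res_comp _ _ _).symm.trans (Eq.trans ?_ (V.res_comp _ _ _))
      refine congrArg (fun z ↦ V.res z (x.frame.vec j)) ?_
      ext1
      exact Category.id_comp _
    refine (Frame.equiv_res k _ _).symm.trans ?_
    rw [h1]
    refine congrArg _ (funext fun j ↦ ?_)
    change (Scheme.Hom.appTop (𝟙 T''.left)).hom _ = _
    rw [Scheme.Hom.id_appTop]
    rfl
  constructor
  · intro hc
    have := p.res_mem l _ (show (x.res g).frame.trivialize h c ∈ p.sub i _ from hc)
    rw [← hk, ← V.res_comp, hlk, V.res_id] at this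
    change x.frame.trivialize (h ≫ g) c ∈ p.sub i _
    convert this using 2
    exact Over.mkIdTerminal.hom_ext _ _
  · intro hc
    have := p.res_mem k _ (show x.frame.trivialize (h ≫ g) c ∈ p.sub i _ from hc)
    rw [hk] at this
    change (x.res g).frame.trivialize h c ∈ p.sub i _
    convert this using 2
    exact Over.mkIdTerminal.hom_ext _ _

/-- The morphism `Φ : Fr(V) ⟶ Fl_n ×_B Fl_n` which maps a point `(s, f : kⁿ ≅ V_s)` to the pair
`(f⁻¹(p_s), f⁻¹(q_s))`. -/
noncomputable def framesToFlagPairs (s : S ⟶ B) {V : VectorBundle S n}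
    (p q : Flag V (Over.mk (𝟙 S))) : frameBundle s V ⟶ flagPairs B n where
  app T := ↾fun x ↦ (x.down.flag p, x.down.flag q)
  naturality _ _ g := by
    refine ConcreteCategory.hom_ext _ _ fun x ↦ ?_
    exact Prod.ext (FramePoint.flag_res g.unop x.down p) (FramePoint.flag_res g.unop x.down q)

/-- Two sections `p`, `q` of the flag bundle of `V` over the `B`-scheme `S` are *versal* if the
morphism `Φ : Fr(V) ⟶ Fl_n ×_B Fl_n` which they induce is smooth. -/
def Versal (s : S ⟶ B) {V : VectorBundle S n} (p q : Flag V (Over.mk (𝟙 S))) : Prop :=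
  MorphismProperty.relative (uliftYoneda.{u + 1} : Over B ⥤ (Over B)ᵒᵖ ⥤ Type (u + 1))
    (MorphismProperty.over (@Smooth : MorphismProperty Scheme.{u}) (X := B))
    (framesToFlagPairs s p q)

end

/-- The simple transposition which interchanges the (zero-based) positions `r` and `r + 1`. -/
def simpleTransposition {n : ℕ} (r : Fin (n - 1)) : Equiv.Perm (Fin n) :=
  Equiv.swap ⟨r, by omega⟩ ⟨r + 1, by omega⟩

/-- `ρ` is a reduced word of `σ`: the product of the simple transpositions in `ρ` is `σ`, and no
shorter word has this property. -/
def IsReducedWord {n : ℕ} (ρ : List (Fin (n - 1))) (σ : Equiv.Perm (Fin n)) : Prop :=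
  (ρ.map simpleTransposition).prod = σ ∧
    ∀ ρ' : List (Fin (n - 1)), (ρ'.map simpleTransposition).prod = σ → ρ.length ≤ ρ'.length

section

variable {S : Scheme.{u}} {n : ℕ} {V : VectorBundle S n}

/-- The maximal rank of `F_j → V / P_i` for flags `F` in relative position at most `σ` to `P`. -/
def positionRank (σ : Equiv.Perm (Fin n)) (i j : ℕ) : ℕ :=
  Finset.card {b : Fin n | (b : ℕ) < j ∧ i ≤ (σ b : ℕ)}

/-- The flag `F` is in relative position at most `σ` to the flag `P`: for all `i`, `j`, the map
`F_j → V / P_i` has rank at most `r = #{b < j : σ b ≥ i}` (so that at field-valued points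
`dim (P_i ∩ F_j) ≥ #{b < j : σ b < i}`, where `σ` permutes `0, …, n - 1`), in the sense that all
its minors of size `r + 1` vanish. The minors are computed, over all `T`-schemes `T'`, in frames
`d` and `e` adapted to `P` and `F`: if `e_b = ∑ c_{ab} d_a`, then the matrix of `F_j → V / P_i`
consists of the entries `c_{ab}` with `a ≥ i` and `b < j`. -/
def RelativePositionLE (σ : Equiv.Perm (Fin n)) {T : Over S} (P F : Flag V T) : Prop :=
  ∀ (T' : Over S) (g : T' ⟶ T) (d e : Frame V T'), AdaptedTo P.sub g d → AdaptedTo F.sub g e →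
    ∀ c : Matrix (Fin n) (Fin n) Γ(T'.left, ⊤), (∀ b, e.vec b = ∑ a, c a b • d.vec a) →
      ∀ (i j : Fin (n + 1)) (α β : Fin (positionRank σ i j + 1) → Fin n),
        (∀ x, (i : ℕ) ≤ α x) → (∀ x, (β x : ℕ) < j) → (c.submatrix α β).det = 0

theorem AdaptedTo.of_res {T' T : Over S} (g : T' ⟶ T) (F : Flag V T) {T'' : Over S}
    {h : T'' ⟶ T'} {e : Frame V T''} (H : AdaptedTo (F.res g).sub h e) :
    AdaptedTo F.sub (h ≫ g) e := fun i _ k ↦ by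
  rw [← H i k, ← Category.assoc]
  rfl

theorem RelativePositionLE.res {σ : Equiv.Perm (Fin n)} {T' T : Over S} (g : T' ⟶ T)
    {P F : Flag V T} (H : RelativePositionLE σ P F) :
    RelativePositionLE σ (P.res g) (F.res g) :=
  fun T'' h d e hd he ↦ H T'' (h ≫ g) d e (hd.of_res g P) (he.of_res g F)

theorem Flag.res_at (p : Flag V (Over.mk (𝟙 S))) {T' T : Over S} (g : T' ⟶ T) :
    (p.at T).res g = p.at T' := by
  rw [Flag.at, Flag.at, ← Flag.res_comp]
  exact congrArg (fun h ↦ p.res h) (Over.mkIdTerminal.hom_ext _ _)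

/-- The relative Schubert variety `X_σ(p)`, as a subfunctor of the flag bundle. -/
def schubert (p : Flag V (Over.mk (𝟙 S))) (σ : Equiv.Perm (Fin n)) :
    Subfunctor (flagBundle V) where
  obj T := {F | RelativePositionLE σ (p.at T.unop) F}
  map g F hF := by
    have h := RelativePositionLE.res g.unop hF
    rw [Flag.res_at] at h
    exact h

/-- The relative Richardson variety `X_σ(p) ∩ X_τ(q)`. -/
def richardson (p q : Flag V (Over.mk (𝟙 S))) (σ τ : Equiv.Perm (Fin n)) :
    Subfunctor (flagBundle V) :=
  schubert p σ ⊓ schubert q τ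

/-- A `T`-point of the relative Bott–Samelson variety `Z_ρ(p)`: a sequence of flags
`F⁰ = p, F¹, …, F^ℓ`, where `ℓ` is the length of `ρ`, such that `F^{m-1}` and `F^m` agree except
possibly in the member of rank `r`, if the `m`-th letter of `ρ` interchanges (in one-based
numbering) `r` and `r + 1`. -/
@[ext]
structure BottSamelsonPoint (p : Flag V (Over.mk (𝟙 S))) (ρ : List (Fin (n - 1))) (T : Over S) where
  flag : Fin (ρ.length + 1) → Flag V T
  flag_zero : flag 0 = p.at T
  step : ∀ (m : Fin ρ.length) (i : Fin (n + 1)), (i : ℕ) ≠ (ρ.get m : ℕ) + 1 →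
    ∀ {T' : Over S} (g : T' ⟶ T), (flag m.castSucc).sub i g = (flag m.succ).sub i g

def BottSamelsonPoint.res {p : Flag V (Over.mk (𝟙 S))} {ρ : List (Fin (n - 1))} {T' T : Over S}
    (g : T' ⟶ T) (x : BottSamelsonPoint p ρ T) : BottSamelsonPoint p ρ T' where
  flag m := (x.flag m).res g
  flag_zero := by rw [x.flag_zero, Flag.res_at]
  step m i hi _ h := x.step m i hi (h ≫ g)

/-- The last flag of a point of the Bott–Samelson variety. -/
def BottSamelsonPoint.last {p : Flag V (Over.mk (𝟙 S))} {ρ : List (Fin (n - 1))} {T : Over S}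
    (x : BottSamelsonPoint p ρ T) : Flag V T :=
  x.flag (Fin.last _)

/-- The relative Bott–Samelson variety `Z_ρ(p)`, as a functor of points on `S`-schemes. -/
def bottSamelson (p : Flag V (Over.mk (𝟙 S))) (ρ : List (Fin (n - 1))) :
    (Over S)ᵒᵖ ⥤ Type (u + 1) where
  obj T := BottSamelsonPoint p ρ T.unop
  map g := ↾(BottSamelsonPoint.res g.unop)
  map_id _ := by
    refine ConcreteCategory.hom_ext _ _ fun x ↦ ?_
    exact BottSamelsonPoint.ext (funext fun m ↦ Flag.res_id (x.flag m))
  map_comp g h := by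
    refine ConcreteCategory.hom_ext _ _ fun x ↦ ?_
    exact BottSamelsonPoint.ext (funext fun m ↦ Flag.res_comp h.unop g.unop (x.flag m))

/-- The projection `Z_ρ(p) ⟶ Fl(V)` to the last flag. -/
def bottSamelsonToFlag (p : Flag V (Over.mk (𝟙 S))) (ρ : List (Fin (n - 1))) :
    bottSamelson p ρ ⟶ flagBundle V where
  app _ := ↾BottSamelsonPoint.last

/-- The fiber product `Z_ρ(p) ×_{Fl(V)} Z_ρ'(q)`, as a functor of points on `S`-schemes. -/
noncomputable def bottSamelsonProduct (p q : Flag V (Over.mk (𝟙 S))) (ρ ρ' : List (Fin (n - 1))) :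
    (Over S)ᵒᵖ ⥤ Type (u + 1) :=
  Limits.pullback (bottSamelsonToFlag p ρ) (bottSamelsonToFlag q ρ')

/-- The projection `Z_ρ(p) ×_{Fl(V)} Z_ρ'(q) ⟶ Fl(V)`. -/
noncomputable def bottSamelsonProductToFlag (p q : Flag V (Over.mk (𝟙 S)))
    (ρ ρ' : List (Fin (n - 1))) : bottSamelsonProduct p q ρ ρ' ⟶ flagBundle V :=
  Limits.pullback.fst _ _ ≫ bottSamelsonToFlag p ρ

end

/-- The morphism between representing objects which corresponds to a morphism of functors. -/
def representedHom {C : Type*} [Category C] {F G : Cᵒᵖ ⥤ Type (u + 1)} (π : F ⟶ G) {Z X : C}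
    (hZ : F.RepresentableBy Z) (hX : G.RepresentableBy X) : Z ⟶ X :=
  hX.homEquiv.symm (π.app (op Z) (hZ.homEquiv (𝟙 Z)))

/-- A morphism of schemes is birational if it restricts to an isomorphism over a dense open
subscheme of the target whose preimage is dense in the source. -/
def IsBirational {X Y : Scheme.{u}} (f : X ⟶ Y) : Prop :=
  ∃ U : Y.Opens, Dense (U : Set Y) ∧ Dense ((f ⁻¹ᵁ U : X.Opens) : Set X) ∧ IsIso (f ∣_ U)

/-- `f : X ⟶ Y` is a resolution of singularities of the `B`-scheme `Y`. -/
structure IsResolutionOfSingularities {B X Y : Scheme.{u}} (t : Y ⟶ B) (f : X ⟶ Y) : Prop where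
  smooth : Smooth (f ≫ t)
  proper : IsProper f
  birational : IsBirational f

end RelFlag

/-! Locally a flag is spanned by a frame, two frames differ by an invertible matrix, and two
matrices applied to the same frame give the same flag exactly when they differ by an upper
triangular factor on the right (`Flag.ofFrame_mul_eq_iff`). Questions about pairs of flags thus
become questions about double cosets of the upper triangular group B in GL_n, treated over arbitrary
commutative rings so that they apply to all points of the functors.

Representability and properness. The flag bundle is glued from big cells, which are affine spaces of
lower unipotent matrices, and it is proper by the valuative criterion, where the Iwasawa
decomposition over a valuation ring extends flags. Both functors of the theorem are closed
conditions on finite products of flag bundles over a Noetherian base, hence are represented by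
proper S-schemes, and any morphism between them over S is proper. The fiber product maps to the
Richardson variety because each letter of a reduced word multiplies by a parabolic matrix, which
carries the determinantal conditions for w to those for w * s_r (`RankConditions.mul_isParabolic`).

Smoothness. A point of the fiber product is locally described by one frame e and a family h of
parabolic matrices, one for each letter of the two words. The partial products of h give the chain
of flags from p to the common last flag, and further products lead back from it to q, so that p is
the flag of e and q is the flag of e times a matrix D 0 that depends on h alone. The families h form
a smooth irreducible k-scheme Y, open in an affine space. Pulling Φ back along the map from Y to Fl
× Fl given by the standard flag and that of D 0 yields a scheme P of pairs (h, e). It is smooth over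
Y by versality, hence smooth over k, and it maps to the fiber product with local sections
(`Versal.exists_smooth_chart`). The local rings of the fiber product are therefore retracts of local
rings of P, and smoothness descends to retracts (`smooth_of_retracts`).

Birationality. Take the locus of the Richardson variety where the flag is in position exactly σ to p
and τ to q. It is open, because in the chart around the Bruhat cell of σ the determinantal equations
cut out precisely the cell (`RankConditions.eq_zero_of_isLowerUnipotent`), and this holds over every
ring. Over the locus the two chains exist and are unique since the words are reduced, so the
projection is an isomorphism there (`isIso_restrict_cellLocus`). Its preimage is dense: it contains
the image of the part of P over the nonempty open subset of Y where every h lies in the big cell of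
its parabolic group, and P is open over the irreducible Y (`dense_preimage_cellLocus`). Finally the
projection is surjective, by Bruhat decomposition over fields and the subword property
(`surjective_of_isUniversal`), so the locus is dense in the target as well. -/

namespace RelFlag

open Matrix

/-! ### Triangular matrices, permutation matrices and LU factorization over rings -/

section LinearAlgebra

variable {R : Type*} [CommRing R] {n : ℕ}

/-- The determinant of a product of rectangular matrices vanishes if the contributing minors do. -/
theorem det_mul_eq_zero {k : ℕ} {ι : Type*} [Fintype ι] (A : Matrix (Fin k) ι R)
    (B : Matrix ι (Fin k) R)
    (h : ∀ f : Fin k → ι, (∀ x, B (f x) x ≠ 0) → (A.submatrix id f).det = 0) :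
    (A * B).det = 0 := by
  classical
  rw [← det_transpose]
  -- Cauchy–Binet in its crude form: each column of `A * B` is a combination of columns of `A`, and
  -- multilinearity gives a sum over all functions, not only increasing ones. No signs have to be
  -- tracked, since only vanishing is needed.
  have h1 : (A * B)ᵀ = fun x ↦ ∑ a, B a x • (fun y ↦ A y a) := by
    ext x y
    simp [Matrix.mul_apply, mul_comm]
  have h2 : (A * B)ᵀ.det = ∑ f : Fin k → ι, (∏ x, B (f x) x) * (A.submatrix id f).det := by
    rw [h1]
    refine (MultilinearMap.map_sum (Matrix.detRowAlternating (n := Fin k) (R := R)).toMultilinearMap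
      (fun x a ↦ B a x • (fun y ↦ A y a))).trans (Finset.sum_congr rfl fun f _ ↦ ?_)
    rw [MultilinearMap.map_smul_univ, smul_eq_mul]
    congr 1
    exact det_transpose (A.submatrix id f)
  rw [h2]
  refine Finset.sum_eq_zero fun f _ ↦ ?_
  by_cases hf : ∀ x, B (f x) x ≠ 0
  · rw [h f hf, mul_zero]
  · push Not at hf
    obtain ⟨x, hx⟩ := hf
    exact mul_eq_zero_of_left 
      (Finset.prod_eq_zero (f := fun x ↦ B (f x) x) (Finset.mem_univ x) hx) _

/-- The matrix `m` maps the span of the first `i` standard vectors to itself. -/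
def Preserves (i : ℕ) (m : Matrix (Fin n) (Fin n) R) : Prop :=
  m.BlockTriangular (fun a : Fin n ↦ decide (i ≤ (a : ℕ)))

theorem preserves_iff {i : ℕ} {m : Matrix (Fin n) (Fin n) R} :
    Preserves i m ↔ ∀ a b : Fin n, i ≤ (a : ℕ) → (b : ℕ) < i → m a b = 0 := by
  refine ⟨fun h a b ha hb ↦ h (by simp [ha, hb, Bool.lt_iff]), fun h a b hab ↦ ?_⟩
  simp only [Bool.lt_iff, decide_eq_false_iff_not, not_le, decide_eq_true_eq] at hab
  exact h a b hab.2 hab.1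

theorem Preserves.mul {i : ℕ} {m m' : Matrix (Fin n) (Fin n) R} (h : Preserves i m)
    (h' : Preserves i m') : Preserves i (m * m') :=
  BlockTriangular.mul h h'

theorem Preserves.inv {i : ℕ} {g : GL (Fin n) R} (h : Preserves i g.val) :
    Preserves i (g⁻¹).val := by
  rw [coe_units_inv]
  let := g.invertible
  exact blockTriangular_inv_of_blockTriangular h

/-- Upper triangular matrices. -/
def IsUpper (m : Matrix (Fin n) (Fin n) R) : Prop := ∀ i, Preserves i m

theorem isUpper_iff {m : Matrix (Fin n) (Fin n) R} :
    IsUpper m ↔ ∀ a b : Fin n, b < a → m a b = 0 :=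
  ⟨fun h a b hab ↦ preserves_iff.mp (h a) a b le_rfl hab,
    fun h _ ↦ preserves_iff.mpr fun a b ha hb ↦ h a b (Fin.lt_def.mpr (by omega))⟩

theorem IsUpper.mul {m m' : Matrix (Fin n) (Fin n) R} (h : IsUpper m) (h' : IsUpper m') :
    IsUpper (m * m') := fun i ↦ (h i).mul (h' i)

theorem IsUpper.inv {g : GL (Fin n) R} (h : IsUpper g.val) : IsUpper (g⁻¹).val :=
  fun i ↦ (h i).inv

theorem isUpper_one : IsUpper (1 : Matrix (Fin n) (Fin n) R) :=
  isUpper_iff.mpr fun _ _ h ↦ Matrix.one_apply_ne h.ne'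

theorem IsUpper.det {m : Matrix (Fin n) (Fin n) R} (h : IsUpper m) : m.det = ∏ a, m a a :=
  det_of_isUpperTriangular fun _ _ hab ↦ isUpper_iff.mp h _ _ hab

theorem isUnit_det (g : GL (Fin n) R) : IsUnit g.val.det :=
  (isUnit_iff_isUnit_det _).mp g.isUnit

theorem IsUpper.isUnit_diag {g : GL (Fin n) R} (h : IsUpper g.val) (a : Fin n) :
    IsUnit (g.val a a) := by
  have := isUnit_det g
  rw [h.det] at this
  exact isUnit_of_dvd_unit (Finset.dvd_prod_of_mem (fun a ↦ g.val a a) (Finset.mem_univ a)) this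

theorem IsUpper.map {S : Type*} [CommRing S] {m : Matrix (Fin n) (Fin n) R} (h : IsUpper m)
    (f : R →+* S) : IsUpper (m.map f) :=
  isUpper_iff.mpr fun a b hab ↦ by simp [isUpper_iff.mp h a b hab]

/-- The matrix with unit determinant `m`, as an element of `GL`. -/
noncomputable def toGL (m : Matrix (Fin n) (Fin n) R) (h : IsUnit m.det) : GL (Fin n) R :=
  nonsingInvUnit m h

@[simp] theorem toGL_val (m : Matrix (Fin n) (Fin n) R) (h : IsUnit m.det) :
    (toGL m h).val = m := rfl

/-- The matrix which maps the standard vector `b` to the standard vector `σ b`. -/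
def permGL (R : Type*) [CommRing R] (σ : Equiv.Perm (Fin n)) : GL (Fin n) R where
  val := Matrix.of fun a b ↦ if a = σ b then 1 else 0
  inv := Matrix.of fun a b ↦ if a = σ⁻¹ b then 1 else 0
  val_inv := by
    ext a b
    simp [Matrix.mul_apply, Matrix.one_apply]
  inv_val := by
    ext a b
    simp [Matrix.mul_apply, Matrix.one_apply]

theorem permGL_apply (σ : Equiv.Perm (Fin n)) (a b : Fin n) :
    (permGL R σ).val a b = if a = σ b then 1 else 0 := rfl

theorem mul_permGL_apply (m : Matrix (Fin n) (Fin n) R) (σ : Equiv.Perm (Fin n)) (a b : Fin n) :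
    (m * (permGL R σ).val) a b = m a (σ b) := by
  simp [Matrix.mul_apply, permGL_apply]

theorem permGL_mul_apply (m : Matrix (Fin n) (Fin n) R) (σ : Equiv.Perm (Fin n)) (a b : Fin n) :
    ((permGL R σ).val * m) (σ a) b = m a b := by
  simp [Matrix.mul_apply, permGL_apply]

theorem permGL_inv (σ : Equiv.Perm (Fin n)) : (permGL R σ)⁻¹ = permGL R σ⁻¹ := by
  ext a b
  rfl

theorem permGL_inv_mul_apply (m : Matrix (Fin n) (Fin n) R) (σ : Equiv.Perm (Fin n))
    (a b : Fin n) : ((permGL R σ)⁻¹.val * m) a b = m (σ a) b := by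
  rw [permGL_inv, ← permGL_mul_apply m σ⁻¹ (σ a) b, Equiv.Perm.inv_def, Equiv.symm_apply_apply]

theorem permGL_mul (σ τ : Equiv.Perm (Fin n)) : permGL R (σ * τ) = permGL R σ * permGL R τ := by
  ext a b
  rw [Units.val_mul, mul_permGL_apply]
  rfl

theorem permGL_one : permGL R (1 : Equiv.Perm (Fin n)) = 1 := by
  ext a b
  rw [permGL_apply, Units.val_one, Matrix.one_apply]
  rfl

theorem permGL_map {S : Type*} [CommRing S] (f : R →+* S) (σ : Equiv.Perm (Fin n)) :
    GeneralLinearGroup.map f (permGL R σ) = permGL S σ := by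
  ext a b
  simp [permGL_apply, apply_ite f]

/-- Lower triangular matrices with unit diagonal. -/
def IsLowerUnipotent (m : Matrix (Fin n) (Fin n) R) : Prop :=
  (∀ a, m a a = 1) ∧ ∀ a b : Fin n, a < b → m a b = 0

theorem IsLowerUnipotent.det {m : Matrix (Fin n) (Fin n) R} (h : IsLowerUnipotent m) :
    m.det = 1 := by
  rw [det_of_isLowerTriangular m fun a b hab ↦ h.2 a b hab, Finset.prod_eq_one fun a _ ↦ h.1 a]

/-- The leading principal submatrix of size `j`. -/
def leading (m : Matrix (Fin n) (Fin n) R) {j : ℕ} (hj : j ≤ n) : Matrix (Fin j) (Fin j) R :=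
  m.submatrix (Fin.castLE hj) (Fin.castLE hj)

/-- The first `j` columns of an upper triangular matrix are supported in the first `j` rows, so the
inner summation can be truncated at `j`. -/
theorem leading_mul_of_isUpper (m : Matrix (Fin n) (Fin n) R) {u : Matrix (Fin n) (Fin n) R}
    (hu : IsUpper u) {j : ℕ} (hj : j ≤ n) : leading (m * u) hj = leading m hj * leading u hj := by
  ext a b
  simp only [leading, submatrix_apply, Matrix.mul_apply]
  rw [← Finset.sum_subset (Finset.subset_univ (Finset.univ.map (Fin.castLEEmb hj))),
    Finset.sum_map]
  · rfl
  · intro x _ hx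
    have : j ≤ (x : ℕ) := by
      by_contra! h
      exact hx (Finset.mem_map.mpr ⟨⟨x, h⟩, Finset.mem_univ _, rfl⟩)
    rw [isUpper_iff.mp hu x (Fin.castLE hj b) (Fin.lt_def.mpr (by simp; omega)), mul_zero]

theorem IsUpper.isUnit_det_leading {g : GL (Fin n) R} (h : IsUpper g.val) {j : ℕ} (hj : j ≤ n) :
    IsUnit (leading g.val hj).det := by
  have : (leading g.val hj).BlockTriangular id := fun a b hab ↦
    isUpper_iff.mp h _ _ (Fin.lt_def.mpr hab)
  rw [det_of_isUpperTriangular this]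
  exact (Finset.univ : Finset (Fin j)).prod_induction _ IsUnit (fun _ _ ↦ IsUnit.mul)
    isUnit_one fun a _ ↦ h.isUnit_diag _

/-- If all leading principal minors of `m` are invertible, then `m` is the product of a lower
unipotent and an upper triangular matrix. -/
theorem exists_isLowerUnipotent_mul (m : Matrix (Fin n) (Fin n) R)
    (hm : ∀ {j : ℕ} (hj : j ≤ n), IsUnit (leading m hj).det) :
    ∃ u : GL (Fin n) R, IsUpper u.val ∧ IsLowerUnipotent (m * u.val) := by
  -- Column `b` of `u` is supported in rows `0, …, b` and solves the leading system of size `b + 1`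
  -- whose right-hand side is the last unit vector. This forces entries 0 above the diagonal and 1
  -- on it in column `b` of `m * u`.
  let y (b : Fin n) : Fin (b + 1) → R := (leading m b.2)⁻¹ *ᵥ Pi.single (Fin.last b) 1
  let u : Matrix (Fin n) (Fin n) R := Matrix.of fun k b ↦
    ∑ x : Fin (b + 1), if Fin.castLE b.2 x = k then y b x else 0
  have hu : IsUpper u := isUpper_iff.mpr fun k b hbk ↦ by
    change ∑ x : Fin (b + 1), (if Fin.castLE b.2 x = k then y b x else 0) = 0
    refine Finset.sum_eq_zero fun x _ ↦ ?_
    rw [if_neg]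
    rintro rfl
    have := x.2
    simp only [Fin.lt_def, Fin.val_castLE] at hbk
    omega
  have hmu (a b : Fin n) : (m * u) a b = ∑ x : Fin (b + 1), m a (Fin.castLE b.2 x) * y b x := by
    simp only [Matrix.mul_apply, u, Matrix.of_apply, Finset.mul_sum]
    rw [Finset.sum_comm]
    simp
  have key (a b : Fin n) (hab : a ≤ b) : (m * u) a b = if a = b then 1 else 0 := by
    rw [hmu]
    have : (leading m b.2 *ᵥ y b) ⟨a, Nat.lt_succ_of_le hab⟩ = if a = b then 1 else 0 := by
      rw [mulVec_mulVec, mul_nonsing_inv _ (hm _), one_mulVec, Pi.single_apply]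
      simp [Fin.ext_iff]
    rw [← this]
    rfl
  have hL : IsLowerUnipotent (m * u) :=
    ⟨fun a ↦ by rw [key a a le_rfl, if_pos rfl], fun a b hab ↦ by
      rw [key a b hab.le, if_neg hab.ne]⟩
  have hdet : IsUnit u.det := by
    have := hL.det
    rw [det_mul] at this
    exact IsUnit.of_mul_eq_one_right _ this
  exact ⟨toGL u hdet, hu, hL⟩

theorem isUpper_transvection {a b : Fin n} (h : a < b) (y : R) : IsUpper (transvection a b y) :=
  isUpper_iff.mpr fun i j hij ↦ by
    rw [transvection, Matrix.add_apply, Matrix.one_apply_ne hij.ne', zero_add, single_apply,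
      if_neg]
    rintro ⟨rfl, rfl⟩
    exact absurd h hij.not_gt

/-- An elementary matrix, as an element of `GL`. -/
noncomputable def transvectionGL (a b : Fin n) (h : a ≠ b) (y : R) : GL (Fin n) R :=
  toGL (transvection a b y) (by rw [det_transvection_of_ne _ _ h]; exact isUnit_one)

/-! ### Column reduction and Bruhat decomposition over a field -/

section Field

variable {K : Type*} [Field K]

/-- Column reduction over a field, where the pivot in each column is chosen according to a given
rule `Q`. -/
theorem exists_normalForm (m : GL (Fin n) K) (Q : (Fin n → K) → Fin n → Prop)
    (hQ : ∀ v ≠ 0, ∃ i, v i ≠ 0 ∧ Q v i)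
    (hQs : ∀ (v : Fin n → K) i (c : K), c ≠ 0 → Q v i → Q (c • v) i) :
    ∃ (w : Equiv.Perm (Fin n)) (u : GL (Fin n) K), IsUpper u.val ∧
      IsLowerUnipotent ((permGL K w)⁻¹.val * (m.val * u.val)) ∧
      ∀ b, Q (fun i ↦ (m.val * u.val) i b) (w b) := by
  -- Clears the entries of column `j` in the pivot rows of the first `k` columns by adding multiples
  -- of those columns. Clearing in increasing order is safe, because column `b` already vanishes in
  -- the pivot rows of all columns before it.
  have clear (w : Fin n → Fin n) (j : Fin n) (u : GL (Fin n) K) (hu : IsUpper u.val)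
      (h1 : ∀ b < j, (m.val * u.val) (w b) b = 1)
      (h2 : ∀ b < j, ∀ a < b, (m.val * u.val) (w a) b = 0) (k : ℕ) (hk : k ≤ j) :
      ∃ u' : GL (Fin n) K, IsUpper u'.val ∧
        (∀ a b, b ≠ j → (m.val * u'.val) a b = (m.val * u.val) a b) ∧
        ∀ a : Fin n, (a : ℕ) < k → (m.val * u'.val) (w a) j = 0 := by
    induction k with
    | zero => exact ⟨u, hu, fun _ _ _ ↦ rfl, fun _ h ↦ absurd h (Nat.not_lt_zero _)⟩
    | succ k ih =>
      obtain ⟨u', hu', h3, h4⟩ := ih (Nat.le_of_succ_le hk)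
      let l : Fin n := ⟨k, by omega⟩
      have hl : l < j := Fin.lt_def.mpr (by simp only [l]; omega)
      refine ⟨u' * transvectionGL l j hl.ne (-(m.val * u'.val) (w l) j),
        hu'.mul (isUpper_transvection hl _), fun a b hb ↦ ?_, fun a ha ↦ ?_⟩
      · rw [Units.val_mul, ← mul_assoc, ← h3 a b hb]
        exact mul_transvection_apply_of_ne _ _ _ _ hb _ _
      · rw [Units.val_mul, ← mul_assoc]
        refine (mul_transvection_apply_same _ _ _ _ _).trans ?_
        rw [h3 _ l hl.ne]
        rcases Nat.lt_succ_iff_lt_or_eq.mp ha with ha | ha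
        · rw [h4 a ha, h2 l hl a (Fin.lt_def.mpr ha), mul_zero, add_zero]
        · obtain rfl : a = l := Fin.ext ha
          rw [h1 l hl, mul_one, add_neg_cancel]
  have step (j : ℕ) (hj : j ≤ n) : ∃ (w : Fin n → Fin n) (u : GL (Fin n) K), IsUpper u.val ∧
      ∀ b : Fin n, (b : ℕ) < j → (m.val * u.val) (w b) b = 1 ∧
        (∀ a < b, (m.val * u.val) (w a) b = 0) ∧ Q (fun i ↦ (m.val * u.val) i b) (w b) := by
    induction j with
    | zero => exact ⟨id, 1, isUpper_one, fun b hb ↦ absurd hb (Nat.not_lt_zero _)⟩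
    | succ j ih =>
      obtain ⟨w, u, hu, h⟩ := ih (Nat.le_of_succ_le hj)
      let l : Fin n := ⟨j, hj⟩
      obtain ⟨u', hu', h3, h4⟩ := clear w l u hu (fun b hb ↦ (h b hb).1)
        (fun b hb ↦ (h b hb).2.1) j le_rfl
      have hv : (fun i ↦ (m.val * u'.val) i l) ≠ 0 := by
        intro h0
        refine (isUnit_det (m * u')).ne_zero ?_
        exact det_eq_zero_of_column_eq_zero l fun i ↦ congrFun h0 i
      obtain ⟨i, hi, hQi⟩ := hQ _ hv
      let D : Fin n → K := Function.update 1 l ((m.val * u'.val) i l)⁻¹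
      have hD : (diagonal D).det ≠ 0 := by
        rw [det_diagonal, Finset.prod_ne_zero_iff]
        intro a _
        by_cases ha : a = l
        · subst ha
          simpa [D] using hi
        · simp [D, ha]
      have hx (a b : Fin n) : (m.val * (u' * toGL (diagonal D) hD.isUnit).val) a b =
          (m.val * u'.val) a b * D b := by
        rw [Units.val_mul, ← mul_assoc, toGL_val, mul_diagonal]
      refine ⟨Function.update w l i, u' * toGL (diagonal D) hD.isUnit, hu'.mul
        (isUpper_iff.mpr fun a b hab ↦ diagonal_apply_ne _ hab.ne'), fun b hb ↦ ?_⟩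
      simp only [hx]
      rcases Nat.lt_succ_iff_lt_or_eq.mp hb with hb | hb
      · have hbl : b ≠ l := fun h ↦ by simp [h, l] at hb
        have hDb : D b = 1 := by simp [D, hbl]
        simp only [hDb, mul_one, h3 _ b hbl, Function.update_of_ne hbl]
        refine ⟨(h b hb).1, fun a ha ↦ ?_, (h b hb).2.2⟩
        rw [Function.update_of_ne, (h b hb).2.1 a ha]
        rintro rfl
        exact absurd hb (Fin.lt_def.mp ha).not_gt
      · obtain rfl : b = l := Fin.ext hb
        have hDb : D l = ((m.val * u'.val) i l)⁻¹ := by simp [D]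
        rw [Function.update_self, hDb]
        refine ⟨mul_inv_cancel₀ hi, fun a ha ↦ ?_, ?_⟩
        · rw [Function.update_of_ne ha.ne, h4 a ha, zero_mul]
        · have := hQs _ i _ (inv_ne_zero hi) hQi
          convert this using 1
          ext a
          simp [mul_comm]
  obtain ⟨w, u, hu, h⟩ := step n le_rfl
  -- A pivot row has entry 1 in its own column and entry 0 in all later columns, so no row can be
  -- the pivot of two columns.
  have hw : Function.Injective w := by
    intro a b hab
    by_contra hne
    rcases lt_or_gt_of_ne hne with hlt | hlt
    · have := (h b b.2).2.1 a hlt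
      rw [hab, (h b b.2).1] at this
      exact one_ne_zero this
    · have := (h a a.2).2.1 b hlt
      rw [← hab, (h a a.2).1] at this
      exact one_ne_zero this
  let w' : Equiv.Perm (Fin n) := Equiv.ofBijective w (Finite.injective_iff_bijective.mp hw)
  have hL (a b : Fin n) : ((permGL K w')⁻¹.val * (m.val * u.val)) a b =
      (m.val * u.val) (w a) b := by
    rw [permGL_inv_mul_apply]
    rfl
  exact ⟨w', u, hu, ⟨fun a ↦ (hL a a).trans (h a a.2).1,
    fun a b hab ↦ (hL a b).trans ((h b b.2).2.1 a hab)⟩, fun b ↦ (h b b.2).2.2⟩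

end Field

/-- A lower unipotent matrix whose entries at non-inversions of `σ` vanish becomes upper
triangular after conjugation with `σ`. -/
theorem isUpper_conj {σ : Equiv.Perm (Fin n)} {L : Matrix (Fin n) (Fin n) R}
    (hL : IsLowerUnipotent L) (h : ∀ a b : Fin n, b < a → σ b < σ a → L a b = 0) :
    IsUpper ((permGL R σ).val * L * (permGL R σ)⁻¹.val) := by
  refine isUpper_iff.mpr fun a b hab ↦ ?_
  obtain ⟨a, rfl⟩ := σ.surjective a
  obtain ⟨b, rfl⟩ := σ.surjective b
  rw [permGL_inv, mul_permGL_apply, permGL_mul_apply, Equiv.Perm.inv_def, Equiv.symm_apply_apply]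
  rcases lt_trichotomy a b with hlt | rfl | hlt
  · exact hL.2 a b hlt
  · exact absurd hab (lt_irrefl _)
  · exact h a b hlt hab

/-- With L the lower unipotent matrix `σ⁻¹ m u`, one has `m u = (σ L σ⁻¹) σ`, and the bracket is
upper triangular by `isUpper_conj`. -/
theorem exists_isUpper_mul_permGL_of_isLowerUnipotent {σ : Equiv.Perm (Fin n)} {m u : GL (Fin n) R}
    (hL : IsLowerUnipotent ((permGL R σ)⁻¹.val * (m.val * u.val)))
    (h : ∀ a b : Fin n, b < a → σ b < σ a → ((permGL R σ)⁻¹.val * (m.val * u.val)) a b = 0) :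
    ∃ v : GL (Fin n) R, IsUpper v.val ∧ m * u = v * permGL R σ := by
  refine ⟨permGL R σ * ((permGL R σ)⁻¹ * (m * u)) * (permGL R σ)⁻¹, isUpper_conj hL h, ?_⟩
  group

/-- The Bruhat decomposition. -/
theorem exists_bruhat {K : Type*} [Field K] (m : GL (Fin n) K) :
    ∃ (w : Equiv.Perm (Fin n)) (u v : GL (Fin n) K), IsUpper u.val ∧ IsUpper v.val ∧
      m * u = v * permGL K w := by
  -- The pivot is the nonzero entry with the largest row index. Everything below a pivot then
  -- vanishes, which is the vanishing at non-inversions needed to conjugate L into an upper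
  -- triangular matrix.
  obtain ⟨w, u, hu, hL, hQ⟩ := exists_normalForm m (fun v i ↦ ∀ a, i < a → v a = 0)
    (fun v hv ↦ by
      classical
      have hne : (Finset.univ.filter fun i ↦ v i ≠ 0).Nonempty := by
        obtain ⟨i, hi⟩ := Function.ne_iff.mp hv
        exact ⟨i, by simpa using hi⟩
      refine ⟨Finset.max' _ hne, by simpa using Finset.max'_mem _ hne, fun a ha ↦ ?_⟩
      by_contra h0
      exact absurd (Finset.le_max' _ a (by simpa using h0)) ha.not_ge)
    (fun v i c _ h a ha ↦ by simp [h a ha])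
  obtain ⟨v, hv, h⟩ := exists_isUpper_mul_permGL_of_isLowerUnipotent hL fun a b _ hab ↦ by
    rw [permGL_inv_mul_apply]
    exact hQ b (w a) hab
  exact ⟨w, u, v, hu, hv, h⟩

end LinearAlgebra

end RelFlag

/-! ### Minors, rank conditions, and parabolic steps between Bruhat cells -/

namespace RelFlag

open Matrix

section Minors

variable {R : Type*} [CommRing R] {n : ℕ}

/-- All minors of size `k` with rows `≥ i` and columns `< j` vanish. -/
def MinorsVanish (c : Matrix (Fin n) (Fin n) R) (i j k : ℕ) : Prop :=
  ∀ α β : Fin k → Fin n, (∀ x, i ≤ (α x : ℕ)) → (∀ x, (β x : ℕ) < j) → (c.submatrix α β).det = 0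

theorem MinorsVanish.mono {c : Matrix (Fin n) (Fin n) R} {i j j' k : ℕ} (h : MinorsVanish c i j k)
    (hj : j' ≤ j) : MinorsVanish c i j' k :=
  fun α β hα hβ ↦ h α β hα fun x ↦ (hβ x).trans_le hj

theorem MinorsVanish.succ {c : Matrix (Fin n) (Fin n) R} {i j k : ℕ} (h : MinorsVanish c i j k) :
    MinorsVanish c i j (k + 1) := fun α β hα hβ ↦ by
  rw [det_succ_column_zero]
  refine Finset.sum_eq_zero fun x _ ↦ ?_
  exact mul_eq_zero_of_right _
    (h (α ∘ x.succAbove) (β ∘ Fin.succ) (fun _ ↦ hα _) (fun _ ↦ hβ _))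

/-- One more column costs at most one in rank. A minor of size `k + 1` which uses column `j` twice
is zero; if it uses it once, expansion along it gives minors of size `k` in the old range; otherwise
it lies in the old range already. -/
theorem MinorsVanish.succ_column {c : Matrix (Fin n) (Fin n) R} {i j k : ℕ}
    (h : MinorsVanish c i j k) : MinorsVanish c i (j + 1) (k + 1) := fun α β hα hβ ↦ by
  by_cases hx : ∃ x, (β x : ℕ) = j
  · obtain ⟨x, hx⟩ := hx
    by_cases hy : ∃ y, y ≠ x ∧ (β y : ℕ) = j
    · obtain ⟨y, hyx, hy⟩ := hy
      refine det_zero_of_column_eq hyx fun a ↦ ?_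
      rw [submatrix_apply, submatrix_apply, Fin.ext (hy.trans hx.symm)]
    · push Not at hy
      rw [det_succ_column _ x]
      refine Finset.sum_eq_zero fun y _ ↦ ?_
      refine mul_eq_zero_of_right _
        (h (α ∘ y.succAbove) (β ∘ x.succAbove) (fun _ ↦ hα _) fun z ↦ ?_)
      have h1 := hβ (x.succAbove z)
      have h2 := hy (x.succAbove z) (Fin.succAbove_ne x z)
      simp only [Function.comp_apply]
      omega
  · push Not at hx
    exact h.succ α β hα fun x ↦ by have := hβ x; have := hx x; omega

/-- A minor of `c * g` is a combination of minors of `c`. Since `g` preserves the span of the first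
`j` vectors, only those with all columns below `j` have a nonzero coefficient. -/
theorem MinorsVanish.mul_right {c g : Matrix (Fin n) (Fin n) R} {i j k : ℕ}
    (h : MinorsVanish c i j k) (hg : Preserves j g) : MinorsVanish (c * g) i j k :=
  fun α β hα hβ ↦ by
  rw [submatrix_mul c g α id β Function.bijective_id]
  refine det_mul_eq_zero _ _ fun f hf ↦ ?_
  rw [submatrix_submatrix]
  refine h _ _ hα fun x ↦ ?_
  by_contra! hx
  exact hf x (preserves_iff.mp hg _ _ hx (hβ x))

theorem MinorsVanish.mul_left {c g : Matrix (Fin n) (Fin n) R} {i j k : ℕ}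
    (h : MinorsVanish c i j k) (hg : Preserves i g) : MinorsVanish (g * c) i j k :=
  fun α β hα hβ ↦ by
  rw [submatrix_mul g c α id β Function.bijective_id, ← det_transpose, transpose_mul]
  refine det_mul_eq_zero _ _ fun f hf ↦ ?_
  rw [← det_transpose]
  refine h f β (fun x ↦ ?_) hβ
  by_contra! hx
  exact hf x (preserves_iff.mp hg _ _ (hα x) hx)

theorem MinorsVanish.map {S : Type*} [CommRing S] {c : Matrix (Fin n) (Fin n) R} {i j k : ℕ}
    (h : MinorsVanish c i j k) (f : R →+* S) : MinorsVanish (c.map f) i j k :=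
  fun α β hα hβ ↦ by
  have := congrArg f (h α β hα hβ)
  rw [map_zero, RingHom.map_det] at this
  exact this

/-- The position of the letter `r`. -/
def lo (r : Fin (n - 1)) : Fin n := ⟨r, by omega⟩

/-- The position after that of the letter `r`. -/
def hi (r : Fin (n - 1)) : Fin n := ⟨r + 1, by omega⟩

theorem lo_lt_hi (r : Fin (n - 1)) : lo r < hi r := Fin.lt_def.mpr (Nat.lt_succ_self _)

@[simp] theorem simpleTransposition_lo (r : Fin (n - 1)) : simpleTransposition r (lo r) = hi r :=
  Equiv.swap_apply_left _ _

@[simp] theorem simpleTransposition_hi (r : Fin (n - 1)) : simpleTransposition r (hi r) = lo r :=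
  Equiv.swap_apply_right _ _

theorem simpleTransposition_of_ne {r : Fin (n - 1)} {a : Fin n} (h : a ≠ lo r) (h' : a ≠ hi r) :
    simpleTransposition r a = a :=
  Equiv.swap_apply_of_ne_of_ne h h'

@[simp] theorem simpleTransposition_mul_self (r : Fin (n - 1)) :
    simpleTransposition r * simpleTransposition r = 1 :=
  Equiv.swap_mul_self _ _

@[simp] theorem simpleTransposition_inv (r : Fin (n - 1)) :
    (simpleTransposition r)⁻¹ = simpleTransposition r := Equiv.swap_inv _ _

theorem val_lo (r : Fin (n - 1)) : (lo r : ℕ) = r := rfl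
theorem val_hi (r : Fin (n - 1)) : (hi r : ℕ) = r + 1 := rfl

section positionRank

variable (σ : Equiv.Perm (Fin n)) (i : ℕ)

theorem positionRank_succ (b : Fin n) :
    positionRank σ i (b + 1) = positionRank σ i b + if i ≤ (σ b : ℕ) then 1 else 0 := by
  have h : (Finset.univ.filter fun a : Fin n ↦ (a : ℕ) < b + 1 ∧ i ≤ (σ a : ℕ)) =
      (Finset.univ.filter fun a : Fin n ↦ (a : ℕ) < b ∧ i ≤ (σ a : ℕ)) ∪
        (Finset.univ.filter fun a : Fin n ↦ a = b ∧ i ≤ (σ a : ℕ)) := by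
    ext a
    simp only [Finset.mem_filter, Finset.mem_univ, true_and, Finset.mem_union, Fin.ext_iff]
    omega
  rw [positionRank, h, Finset.card_union_of_disjoint, positionRank]
  · congr 1
    split_ifs with hb
    · rw [Finset.card_eq_one]
      exact ⟨b, by ext a; simp only [Finset.mem_filter, Finset.mem_univ, true_and,
        Finset.mem_singleton]; exact ⟨fun h ↦ h.1, fun h ↦ ⟨h, h ▸ hb⟩⟩⟩
    · rw [Finset.card_eq_zero, Finset.filter_eq_empty_iff]
      rintro a _ ⟨rfl, ha⟩
      exact hb ha
  · rw [Finset.disjoint_left]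
    intro a ha hb
    simp only [Finset.mem_filter, Finset.mem_univ, true_and] at ha hb
    have := congrArg Fin.val hb.1
    omega

theorem positionRank_hi (r : Fin (n - 1)) :
    positionRank σ i (r + 1) = positionRank σ i r + if i ≤ (σ (lo r) : ℕ) then 1 else 0 :=
  positionRank_succ σ i (lo r)

theorem positionRank_hi_succ (r : Fin (n - 1)) :
    positionRank σ i (r + 2) = positionRank σ i (r + 1) + if i ≤ (σ (hi r) : ℕ) then 1 else 0 :=
  positionRank_succ σ i (hi r)

theorem positionRank_mul_simpleTransposition (r : Fin (n - 1)) {j : ℕ} (hj : j ≠ r + 1) :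
    positionRank (σ * simpleTransposition r) i j = positionRank σ i j := by
  refine Finset.card_bij (fun a _ ↦ simpleTransposition r a) (fun a ha ↦ ?_)
    (fun a _ b _ h ↦ (simpleTransposition r).injective h)
    (fun b hb ↦ ⟨simpleTransposition r b, ?_, ?_⟩)
  · replace ha := (Finset.mem_filter.mp ha).2
    refine Finset.mem_filter.mpr ⟨Finset.mem_univ _, ?_, ha.2⟩
    by_cases h1 : a = lo r
    · subst h1
      rw [simpleTransposition_lo, val_hi]
      have := val_lo r
      omega
    by_cases h2 : a = hi r
    · subst h2
      rw [simpleTransposition_hi, val_lo]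
      have := val_hi r
      omega
    rw [simpleTransposition_of_ne h1 h2]
    exact ha.1
  · have hs : simpleTransposition r (simpleTransposition r b) = b := by
      rw [← Equiv.Perm.mul_apply, simpleTransposition_mul_self, Equiv.Perm.one_apply]
    replace hb := (Finset.mem_filter.mp hb).2
    refine Finset.mem_filter.mpr ⟨Finset.mem_univ _, ?_, by
      rw [Equiv.Perm.mul_apply, hs]; exact hb.2⟩
    by_cases h1 : b = lo r
    · subst h1
      rw [simpleTransposition_lo, val_hi]
      have := val_lo r
      omega
    by_cases h2 : b = hi r
    · subst h2
      rw [simpleTransposition_hi, val_lo]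
      have := val_hi r
      omega
    rw [simpleTransposition_of_ne h1 h2]
    exact hb.1
  · rw [← Equiv.Perm.mul_apply, simpleTransposition_mul_self, Equiv.Perm.one_apply]

end positionRank

/-- The determinantal conditions on the matrix of a flag in relative position at most `σ`. -/
def RankConditions (σ : Equiv.Perm (Fin n)) (c : Matrix (Fin n) (Fin n) R) : Prop :=
  ∀ i j : Fin (n + 1), MinorsVanish c i j (positionRank σ i j + 1)

theorem RankConditions.mul_right {σ : Equiv.Perm (Fin n)} {c g : Matrix (Fin n) (Fin n) R}
    (h : RankConditions σ c) (hg : IsUpper g) : RankConditions σ (c * g) :=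
  fun i j ↦ (h i j).mul_right (hg j)

theorem RankConditions.mul_left {σ : Equiv.Perm (Fin n)} {c g : Matrix (Fin n) (Fin n) R}
    (h : RankConditions σ c) (hg : IsUpper g) : RankConditions σ (g * c) :=
  fun i j ↦ (h i j).mul_left (hg i)

/-- As long as the columns stay left of `i`, the rank bound is 0 and the condition concerns entries
below the diagonal. From there on, each new column raises the bound by one, as
`MinorsVanish.succ_column` permits. -/
theorem rankConditions_one {c : Matrix (Fin n) (Fin n) R} (hc : IsUpper c) :
    RankConditions 1 c := by
  intro i j
  obtain ⟨j, hj⟩ := j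
  simp only
  induction j with
  | zero => exact fun α β _ hβ ↦ absurd (hβ 0) (Nat.not_lt_zero _)
  | succ j ih =>
    have := positionRank_succ (n := n) 1 i ⟨j, by omega⟩
    change _ = _ + ite ((i : ℕ) ≤ j) 1 0 at this
    by_cases hij : (i : ℕ) ≤ j
    · rw [this, if_pos hij]
      exact (ih (by omega)).succ_column
    · have h0 : ∀ k ≤ j, positionRank (1 : Equiv.Perm (Fin n)) i k = 0 := fun k hk ↦ by
        rw [positionRank, Finset.card_eq_zero, Finset.filter_eq_empty_iff]
        intro a _
        simp only [Equiv.Perm.one_apply]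
        omega
      rw [this, if_neg hij, h0 j le_rfl]
      intro α β hα hβ
      rw [det_fin_one, submatrix_apply]
      refine isUpper_iff.mp hc _ _ (Fin.lt_def.mpr ?_)
      have := hα 0
      have := hβ 0
      omega

/-- Invertible matrices which preserve all members of the standard flag except possibly
the one of rank `r + 1`. -/
def IsParabolic (r : Fin (n - 1)) (g : Matrix (Fin n) (Fin n) R) : Prop :=
  ∀ i : ℕ, i ≠ r + 1 → Preserves i g

theorem IsUpper.isParabolic {r : Fin (n - 1)} {g : Matrix (Fin n) (Fin n) R} (h : IsUpper g) :
    IsParabolic r g := fun i _ ↦ h i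

theorem IsParabolic.mul {r : Fin (n - 1)} {g g' : Matrix (Fin n) (Fin n) R} (h : IsParabolic r g)
    (h' : IsParabolic r g') : IsParabolic r (g * g') := fun i hi ↦ (h i hi).mul (h' i hi)

theorem IsParabolic.inv {r : Fin (n - 1)} {g : GL (Fin n) R} (h : IsParabolic r g.val) :
    IsParabolic r (g⁻¹).val := fun i hi ↦ (h i hi).inv

theorem isParabolic_iff {r : Fin (n - 1)} {g : Matrix (Fin n) (Fin n) R} :
    IsParabolic r g ↔ ∀ a b : Fin n, b < a → ¬(a = hi r ∧ b = lo r) → g a b = 0 := by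
  refine ⟨fun h a b hab hr ↦ ?_, fun h i hir ↦ preserves_iff.mpr fun a b ha hb ↦
    h a b (Fin.lt_def.mpr (by omega)) ?_⟩
  · by_cases ha : (a : ℕ) = r + 1
    · refine preserves_iff.mp (h r (by omega)) a b (by omega) ?_
      by_contra! hb
      refine hr ⟨Fin.ext ha, Fin.ext ?_⟩
      have := Fin.lt_def.mp hab
      rw [val_lo]
      omega
    · exact preserves_iff.mp (h a ha) a b le_rfl hab
  · rintro ⟨rfl, rfl⟩
    rw [val_hi] at ha
    rw [val_lo] at hb
    omega

theorem isParabolic_permGL (r : Fin (n - 1)) :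
    IsParabolic r (permGL R (simpleTransposition r)).val := isParabolic_iff.mpr fun a b hab h ↦ by
  rw [permGL_apply, if_neg]
  rintro rfl
  by_cases h1 : b = lo r
  · subst h1
    exact h ⟨simpleTransposition_lo r, rfl⟩
  by_cases h2 : b = hi r
  · subst h2
    rw [simpleTransposition_hi] at hab
    exact absurd hab (lo_lt_hi r).not_gt
  rw [simpleTransposition_of_ne h1 h2] at hab
  exact lt_irrefl _ hab

/-- Away from `j = r + 1`, the matrix `g` preserves the span of the first `j` vectors and the bound
does not change. For `j = r + 1`, if `i ≤ σ (hi r)` then the bound is one more than at `j = r`,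
which allows for one extra column. Otherwise neither position `r` nor `r + 1` contributes, and the
condition at `j = r + 2` restricts to the one wanted. -/
theorem RankConditions.mul_isParabolic {σ : Equiv.Perm (Fin n)} {c g : Matrix (Fin n) (Fin n) R}
    (h : RankConditions σ c) {r : Fin (n - 1)} (hr : σ (lo r) < σ (hi r))
    (hg : IsParabolic r g) : RankConditions (σ * simpleTransposition r) (c * g) := by
  intro i j
  by_cases hj : (j : ℕ) = r + 1
  · rw [hj, positionRank_hi, Equiv.Perm.mul_apply, simpleTransposition_lo,
      positionRank_mul_simpleTransposition _ _ _ (by omega)]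
    have h1 := (h i ⟨r, by omega⟩).mul_right (hg r (by omega))
    split_ifs with hi
    · exact h1.succ_column
    · have h2 := (h i ⟨r + 2, by omega⟩).mul_right (hg (r + 2) (by omega))
      simp only at h2
      rw [positionRank_hi_succ, positionRank_hi, if_neg hi, if_neg] at h2
      · exact h2.mono (by omega)
      · have := Fin.lt_def.mp hr
        omega
  · rw [positionRank_mul_simpleTransposition _ _ _ hj]
    exact (h i j).mul_right (hg j hj)

/-- The row swap moves the vanishing entry to the only place below the diagonal where a parabolic
matrix may be nonzero. -/
theorem IsParabolic.isUpper_permGL_mul {r : Fin (n - 1)} {g : Matrix (Fin n) (Fin n) R}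
    (hg : IsParabolic r g) (h : g (lo r) (lo r) = 0) :
    IsUpper ((permGL R (simpleTransposition r)).val * g) := by
  have h1 := isParabolic_iff.mp ((isParabolic_permGL r).mul hg)
  refine isUpper_iff.mpr fun a b hab ↦ ?_
  by_cases hr : a = hi r ∧ b = lo r
  · rw [hr.1, hr.2, ← simpleTransposition_lo, permGL_mul_apply, h]
  · exact h1 a b hab hr

theorem isUpper_of_isParabolic {r : Fin (n - 1)} {g : Matrix (Fin n) (Fin n) R}
    (hg : IsParabolic r g) (h : g (hi r) (lo r) = 0) : IsUpper g :=
  isUpper_iff.mpr fun a b hab ↦ by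
    by_cases hr : a = hi r ∧ b = lo r
    · rw [hr.1, hr.2, h]
    · exact isParabolic_iff.mp hg a b hab hr

/-- Before the 2 × 2 block both `g` and its inverse are upper triangular, so the diagonal entry of
`g * g⁻¹` is the product of the two diagonal entries. -/
theorem IsParabolic.isUnit_diag {r : Fin (n - 1)} {g : GL (Fin n) R} (hg : IsParabolic r g.val)
    {a : Fin n} (ha : a < lo r) : IsUnit (g.val a a) := by
  have h := isParabolic_iff.mp hg
  have h' := isParabolic_iff.mp hg.inv
  have h1 : (g.val * (g⁻¹).val) a a = 1 := by
    rw [← Units.val_mul, mul_inv_cancel, Units.val_one, one_apply_eq]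
  rw [Matrix.mul_apply, Finset.sum_eq_single a] at h1
  · exact IsUnit.of_mul_eq_one _ h1
  · intro b _ hb
    rcases lt_or_gt_of_ne hb with hlt | hlt
    · rw [h a b hlt (fun hr ↦ absurd (hr.1 ▸ ha) (lo_lt_hi r).not_gt), zero_mul]
    · rw [h' b a hlt (fun hr ↦ absurd (hr.2 ▸ ha) (lt_irrefl _)), mul_zero]
  · simp

/-- The step from the cell of `σ * s_r` down to the cell of `σ` is unique. -/
theorem RankConditions.isUpper_of_isParabolic {σ : Equiv.Perm (Fin n)} {r : Fin (n - 1)}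
    (hr : σ (lo r) < σ (hi r)) {g : GL (Fin n) R} (hg : IsParabolic r g.val)
    (h : RankConditions σ ((permGL R (σ * simpleTransposition r)).val * g.val)) :
    IsUpper ((permGL R (simpleTransposition r)).val * g.val) := by
  refine hg.isUpper_permGL_mul ?_
  set w := σ * simpleTransposition r with hw
  have hwlo : w (lo r) = σ (hi r) := by simp [hw]
  -- The columns `B` number exactly the rank bound of `σ` at `(w (lo r), r + 1)`, where `hr`
  -- excludes `lo r` from the count. Bordering by column `lo r` gives a minor which must vanish. It
  -- is upper triangular, with unit diagonal entries except for the last one, `g (lo r) (lo r)`,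
  -- which is therefore zero.
  let B : Finset (Fin n) := {b | (b : ℕ) < r ∧ (w (lo r) : ℕ) ≤ (w b : ℕ)}
  have hB : B.card = positionRank σ (w (lo r)) (r + 1) := by
    rw [positionRank_hi, if_neg, add_zero, ← positionRank_mul_simpleTransposition σ _ r (by omega)]
    · rfl
    · rw [hwlo, not_le]
      exact hr
  let f := B.orderEmbOfFin hB
  have hf (x) : (f x : ℕ) < r ∧ (w (lo r) : ℕ) ≤ (w (f x) : ℕ) := by
    have := B.orderEmbOfFin_mem hB x
    exact (Finset.mem_filter.mp this).2
  let β : Fin (positionRank σ (w (lo r)) (r + 1) + 1) → Fin n := Fin.snoc f (lo r)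
  have hβ (x) : (β x : ℕ) < r + 1 ∧ (w (lo r) : ℕ) ≤ (w (β x) : ℕ) := by
    induction x using Fin.lastCases with
    | last => simp [β, val_lo]
    | cast x => simpa [β] using ⟨(hf x).1.le, (hf x).2⟩
  have h0 := h ⟨w (lo r), by omega⟩ ⟨r + 1, by omega⟩ (w ∘ β) β (fun x ↦ (hβ x).2)
    (fun x ↦ (hβ x).1)
  have h1 : ((permGL R w).val * g.val).submatrix (w ∘ β) β = g.val.submatrix β β := by
    ext x y
    simp [permGL_mul_apply]
  have h2 : StrictMono β := by
    intro x y hxy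
    induction y using Fin.lastCases with
    | last =>
      induction x using Fin.lastCases with
      | last => exact absurd hxy (lt_irrefl _)
      | cast x => simpa [β] using Fin.lt_def.mpr (hf x).1
    | cast y =>
      induction x using Fin.lastCases with
      | last => exact absurd hxy (Fin.le_last _).not_gt
      | cast x => simpa [β] using hxy
  rw [h1, det_of_isUpperTriangular, Fin.prod_univ_castSucc] at h0
  · have h3 : IsUnit (∏ x : Fin (positionRank σ (w (lo r)) (r + 1)),
        g.val.submatrix β β x.castSucc x.castSucc) :=
      Finset.univ.prod_induction _ IsUnit (fun _ _ ↦ IsUnit.mul) isUnit_one fun x _ ↦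
        hg.isUnit_diag (by simpa [β] using Fin.lt_def.mpr (hf x).1)
    have h4 := (h3.mul_right_eq_zero).mp h0
    simpa [β] using h4
  · intro x y hxy
    refine isParabolic_iff.mp hg _ _ (h2 hxy) fun hxr ↦ ?_
    have := (hβ x).1
    rw [hxr.1, val_hi] at this
    omega

/-- In the chart around the cell of `σ`, the determinantal conditions define the cell. -/
theorem RankConditions.eq_zero_of_isLowerUnipotent {σ : Equiv.Perm (Fin n)}
    {L : Matrix (Fin n) (Fin n) R} (hL : IsLowerUnipotent L)
    (h : RankConditions σ ((permGL R σ).val * L)) {a b : Fin n}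
    (hσ : σ b < σ a) : L a b = 0 := by
  -- `B` has as many elements as the rank bound at `(σ b + 1, b + 1)`. The minor of `L` with rows
  -- `B, a` and columns `B, b` is one larger, hence vanishes. It is lower triangular with diagonal
  -- `1, …, 1, L a b`.
  let B : Finset (Fin n) := {x | (x : ℕ) < b ∧ (σ b + 1 : ℕ) ≤ (σ x : ℕ)}
  have hB : B.card = positionRank σ (σ b + 1) (b + 1) := by
    rw [positionRank_succ, if_neg (by omega), add_zero]
    rfl
  let f := B.orderEmbOfFin hB
  have hf (x) : (f x : ℕ) < b ∧ (σ b + 1 : ℕ) ≤ (σ (f x) : ℕ) := by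
    have := B.orderEmbOfFin_mem hB x
    exact (Finset.mem_filter.mp this).2
  let α : Fin (positionRank σ (σ b + 1) (b + 1) + 1) → Fin n := Fin.snoc f a
  let β : Fin (positionRank σ (σ b + 1) (b + 1) + 1) → Fin n := Fin.snoc f b
  have h0 := h ⟨σ b + 1, by omega⟩ ⟨b + 1, by omega⟩ (σ ∘ α) β (fun x ↦ by
    induction x using Fin.lastCases with
    | last => simpa [α] using hσ
    | cast x => simpa [α] using (hf x).2) (fun x ↦ by
    induction x using Fin.lastCases with
    | last => simp [β]
    | cast x => simpa [β] using (hf x).1.trans (Nat.lt_succ_self _))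
  have h1 : ((permGL R σ).val * L).submatrix (σ ∘ α) β = L.submatrix α β := by
    ext x y
    simp [permGL_mul_apply]
  rw [h1, det_of_isLowerTriangular, Fin.prod_univ_castSucc, Finset.prod_eq_one, one_mul] at h0
  · simpa [α, β] using h0
  · intro x _
    simpa [α, β] using hL.1 _
  · intro x y hxy
    replace hxy : x < y := hxy
    induction x using Fin.lastCases with
    | last => exact absurd hxy (Fin.le_last _).not_gt
    | cast x =>
      induction y using Fin.lastCases with
      | last => simpa [α, β] using hL.2 _ _ (Fin.lt_def.mpr (hf x).1)
      | cast y => simpa [α, β] using hL.2 (f x) (f y) (by simpa using hxy)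

/-- Invertible leading minors place `σ⁻¹ m` in the chart of lower unipotent matrices, and the rank
conditions kill its entries at non-inversions of σ. Hence this open part of the determinantal scheme
is the Bruhat cell itself, with the right scheme structure. -/
theorem RankConditions.exists_isUpper_mul_permGL {σ : Equiv.Perm (Fin n)} {m : GL (Fin n) R}
    (h : RankConditions σ m.val)
    (hm : ∀ {j : ℕ} (hj : j ≤ n), IsUnit (leading ((permGL R σ)⁻¹.val * m.val) hj).det) :
    ∃ u v : GL (Fin n) R, IsUpper u.val ∧ IsUpper v.val ∧ m * u = v * permGL R σ := by
  obtain ⟨u, hu, hL⟩ := exists_isLowerUnipotent_mul _ hm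
  rw [mul_assoc] at hL
  obtain ⟨v, hv, h'⟩ := exists_isUpper_mul_permGL_of_isLowerUnipotent (u := u) (m := m) hL
    fun a b _ hσ ↦ RankConditions.eq_zero_of_isLowerUnipotent hL (by
      rw [← mul_assoc, ← Units.val_mul, mul_inv_cancel, Units.val_one, one_mul]
      exact h.mul_right hu) hσ
  exact ⟨u, v, hu, hv, h'⟩

/-- Principal minors of an invertible upper triangular matrix are invertible. -/
theorem IsUpper.isUnit_det_submatrix {u : GL (Fin n) R} (hu : IsUpper u.val) {j : ℕ}
    {f : Fin j → Fin n} (hf : Function.Injective f) : IsUnit (u.val.submatrix f f).det := by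
  let B : Finset (Fin n) := Finset.univ.map ⟨f, hf⟩
  have hB : B.card = j := by simp [B]
  let e := B.orderIsoOfFin hB
  -- Sorting the indices by the same permutation in rows and columns keeps the determinant and makes
  -- the submatrix upper triangular.
  let π : Fin j → Fin j := fun x ↦ e.symm ⟨f x, by simp [B]⟩
  have hπ : Function.Injective π := fun x y h ↦ hf (by simpa [π] using h)
  let π' : Equiv.Perm (Fin j) := Equiv.ofBijective π (Finite.injective_iff_bijective.mp hπ)
  have hfe : f = B.orderEmbOfFin hB ∘ π' := by
    ext x
    simp [π', π, e, ← Finset.coe_orderIsoOfFin_apply]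
  have h1 : u.val.submatrix f f =
      (u.val.submatrix (B.orderEmbOfFin hB) (B.orderEmbOfFin hB)).submatrix π' π' := by
    rw [hfe]
    rfl
  rw [h1, det_submatrix_equiv_self, det_of_isUpperTriangular]
  · exact Finset.univ.prod_induction _ IsUnit (fun _ _ ↦ IsUnit.mul) isUnit_one fun x _ ↦
      hu.isUnit_diag _
  · intro x y hxy
    exact isUpper_iff.mp hu _ _ ((B.orderEmbOfFin hB).strictMono hxy)

/-- From `m u = v σ`, the leading block of `σ⁻¹ m` times that of `u` is the principal block of `v`
at the indices `σ 0, …, σ (j - 1)`. This is the converse of the previous criterion, and together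
they make the cell open. -/
theorem isUnit_det_leading_of_mul_permGL {σ : Equiv.Perm (Fin n)} {m u v : GL (Fin n) R}
    (hu : IsUpper u.val) (hv : IsUpper v.val) (h : m * u = v * permGL R σ) {j : ℕ} (hj : j ≤ n) :
    IsUnit (leading ((permGL R σ)⁻¹.val * m.val) hj).det := by
  have h1 : leading ((permGL R σ)⁻¹.val * m.val) hj * leading u.val hj =
      v.val.submatrix (σ ∘ Fin.castLE hj) (σ ∘ Fin.castLE hj) := by
    rw [← leading_mul_of_isUpper _ hu, mul_assoc, ← Units.val_mul m, h, Units.val_mul]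
    ext a b
    rw [leading, submatrix_apply, permGL_inv_mul_apply, mul_permGL_apply]
    rfl
  have h2 := hv.isUnit_det_submatrix (σ.injective.comp (Fin.castLE_injective hj))
  rw [← h1, det_mul] at h2
  exact isUnit_of_mul_isUnit_left h2

/-- Cells multiply when lengths add: σ B s ⊆ B σ s B. The upper triangular `u` can be traded for an
elementary matrix `t` at `(lo r, hi r)`, at the price of the right factor `s u⁻¹ t s`, and `t`
passes through σ because σ does not invert this pair. -/
theorem exists_isUpper_mul_permGL_mul {σ : Equiv.Perm (Fin n)} {r : Fin (n - 1)}
    (hr : σ (lo r) < σ (hi r)) {u : GL (Fin n) R} (hu : IsUpper u.val) :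
    ∃ v E : GL (Fin n) R, IsUpper v.val ∧ IsUpper E.val ∧
      permGL R σ * u * permGL R (simpleTransposition r) * v =
        E * permGL R (σ * simpleTransposition r) := by
  obtain ⟨z, hz⟩ := hu.inv.isUnit_diag (lo r)
  -- Chosen so that `u⁻¹ * t` vanishes at `(lo r, hi r)`; conjugation by the simple transposition
  -- then leaves it upper triangular.
  let y : R := -(↑z⁻¹ * (u⁻¹).val (lo r) (hi r))
  let t : GL (Fin n) R := transvectionGL (lo r) (hi r) (lo_lt_hi r).ne y
  have ht : IsUpper t.val := isUpper_transvection (lo_lt_hi r) _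
  let s := permGL R (simpleTransposition r)
  have hE : IsUpper (permGL R σ * t * (permGL R σ)⁻¹).val := by
    refine isUpper_iff.mpr fun a b hab ↦ ?_
    obtain ⟨a, rfl⟩ := σ.surjective a
    obtain ⟨b, rfl⟩ := σ.surjective b
    rw [Units.val_mul, Units.val_mul, permGL_inv, mul_permGL_apply, permGL_mul_apply,
      Equiv.Perm.inv_def, Equiv.symm_apply_apply]
    change (transvection (lo r) (hi r) y) a b = 0
    rw [transvection, Matrix.add_apply, Matrix.one_apply_ne (by rintro rfl; exact hab.false),
      zero_add, single_apply, if_neg]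
    rintro ⟨rfl, rfl⟩
    exact absurd hab hr.not_gt
  have hst : (u⁻¹ * t).val (lo r) (hi r) = 0 := by
    refine (mul_transvection_apply_same _ _ _ _ _).trans ?_
    rw [← hz]
    linear_combination (-(u⁻¹).val (lo r) (hi r)) * z.inv_mul
  refine ⟨s * (u⁻¹ * t) * s, _, ?_, hE, ?_⟩
  · refine isUpper_of_isParabolic (r := r) ?_ ?_
    · exact ((isParabolic_permGL r).mul (hu.inv.mul ht).isParabolic).mul (isParabolic_permGL r)
    · rw [Units.val_mul, mul_permGL_apply, simpleTransposition_lo, Units.val_mul,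
        ← simpleTransposition_lo, permGL_mul_apply, simpleTransposition_lo, hst]
  · have hs : s * s = 1 := by rw [← permGL_mul, simpleTransposition_mul_self, permGL_one]
    rw [permGL_mul]
    change permGL R σ * u * s * (s * (u⁻¹ * t) * s) = _ * (permGL R σ * s)
    calc _ = permGL R σ * u * (s * s) * u⁻¹ * t * s := by group
      _ = _ := by rw [hs]; group

/-- The big cell of the parabolic group: an invertible entry at `(hi r, lo r)` clears the entry at
`(lo r, lo r)` by a row operation `t`, and then `s t g` is upper triangular. -/
theorem IsParabolic.exists_isUpper_mul_permGL {r : Fin (n - 1)} {g : GL (Fin n) R}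
    (hg : IsParabolic r g.val) (h : IsUnit (g.val (hi r) (lo r))) :
    ∃ u v : GL (Fin n) R, IsUpper u.val ∧ IsUpper v.val ∧
      g * u = v * permGL R (simpleTransposition r) := by
  obtain ⟨z, hz⟩ := h
  let y : R := -(g.val (lo r) (lo r) * ↑z⁻¹)
  let t : GL (Fin n) R := transvectionGL (lo r) (hi r) (lo_lt_hi r).ne y
  have ht : IsUpper t.val := isUpper_transvection (lo_lt_hi r) _
  have h0 : (t * g).val (lo r) (lo r) = 0 := by
    refine (transvection_mul_apply_same _ _ _ _ _).trans ?_
    rw [← hz]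
    simp [y]
  have h1 := (ht.isParabolic.mul hg).isUpper_permGL_mul h0
  refine ⟨(permGL R (simpleTransposition r) * (t * g))⁻¹, t⁻¹, IsUpper.inv h1, ht.inv, ?_⟩
  have hs : (permGL R (simpleTransposition r))⁻¹ = permGL R (simpleTransposition r) := by
    rw [permGL_inv, simpleTransposition_inv]
  rw [_root_.mul_inv_rev, _root_.mul_inv_rev, hs]
  group

end Minors

end RelFlag

/-! ### Inversions, reduced words, and the Bruhat order through rank functions -/

namespace RelFlag

section Words

variable {n : ℕ}

/-- The number of inversions of a permutation. -/
def inversions (σ : Equiv.Perm (Fin n)) : ℕ :=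
  Finset.card {p : Fin n × Fin n | p.1 < p.2 ∧ σ p.2 < σ p.1}

theorem simpleTransposition_lt {r : Fin (n - 1)} {a b : Fin n} (hab : a < b)
    (h : ¬(a = lo r ∧ b = hi r)) : simpleTransposition r a < simpleTransposition r b := by
  have h1 (x : Fin n) : ((x : ℕ) = r ∧ (simpleTransposition r x : ℕ) = r + 1) ∨
      ((x : ℕ) = r + 1 ∧ (simpleTransposition r x : ℕ) = r) ∨
      ((x : ℕ) ≠ r ∧ (x : ℕ) ≠ r + 1 ∧ (simpleTransposition r x : ℕ) = x) := by
    by_cases h1 : x = lo r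
    · subst h1
      exact Or.inl ⟨rfl, by rw [simpleTransposition_lo]; rfl⟩
    by_cases h2 : x = hi r
    · subst h2
      exact Or.inr (Or.inl ⟨rfl, by rw [simpleTransposition_hi]; rfl⟩)
    exact Or.inr (Or.inr ⟨fun h ↦ h1 (Fin.ext h), fun h ↦ h2 (Fin.ext h), by
      rw [simpleTransposition_of_ne h1 h2]⟩)
  have ha := h1 a
  have hb := h1 b
  have hab' : ¬((a : ℕ) = r ∧ (b : ℕ) = r + 1) := fun ⟨h2, h3⟩ ↦ h ⟨Fin.ext h2, Fin.ext h3⟩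
  rw [Fin.lt_def] at hab ⊢
  omega

/-- The simple transposition permutes the ordered pairs other than `(lo r, hi r)` and matches the
inversions there; that one pair becomes a new inversion. -/
theorem inversions_mul_simpleTransposition {σ : Equiv.Perm (Fin n)} {r : Fin (n - 1)}
    (h : σ (lo r) < σ (hi r)) : inversions (σ * simpleTransposition r) = inversions σ + 1 := by
  have hss (x : Fin n) : simpleTransposition r (simpleTransposition r x) = x := by
    rw [← Equiv.Perm.mul_apply, simpleTransposition_mul_self, Equiv.Perm.one_apply]
  have hmem : (lo r, hi r) ∈ Finset.univ.filter fun p : Fin n × Fin n ↦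
      p.1 < p.2 ∧ (σ * simpleTransposition r) p.2 < (σ * simpleTransposition r) p.1 := by
    exact Finset.mem_filter.mpr ⟨Finset.mem_univ _, lo_lt_hi r, by simpa using h⟩
  have h2 : inversions σ = Finset.card ((Finset.univ.filter fun p : Fin n × Fin n ↦
      p.1 < p.2 ∧ (σ * simpleTransposition r) p.2 < (σ * simpleTransposition r) p.1).erase
        (lo r, hi r)) := by
    refine Finset.card_bij
      (fun p _ ↦ (simpleTransposition r p.1, simpleTransposition r p.2)) (fun p hp ↦ ?_)
      (fun p _ p' _ hpp ↦ ?_) (fun p hp ↦ ⟨(simpleTransposition r p.1, simpleTransposition r p.2),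
        ?_, by simp only [hss]⟩)
    · have hp := (Finset.mem_filter.mp hp).2
      have hne : ¬(p.1 = lo r ∧ p.2 = hi r) := fun hr ↦ by
        rw [hr.1, hr.2] at hp
        exact absurd hp.2 h.not_gt
      refine Finset.mem_erase.mpr ⟨fun h3 ↦ ?_, Finset.mem_filter.mpr ⟨Finset.mem_univ _,
        simpleTransposition_lt hp.1 hne, by simpa [hss] using hp.2⟩⟩
      have h4 := congrArg (fun q ↦ simpleTransposition r q.1) h3
      have h5 := congrArg (fun q ↦ simpleTransposition r q.2) h3
      simp only [hss, simpleTransposition_lo, simpleTransposition_hi] at h4 h5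
      rw [h4, h5] at hp
      exact absurd hp.1 (lo_lt_hi r).not_gt
    · simp only [Prod.mk.injEq, EmbeddingLike.apply_eq_iff_eq] at hpp
      exact Prod.ext hpp.1 hpp.2
    · obtain ⟨hp1, hp⟩ := Finset.mem_erase.mp hp
      have hp := (Finset.mem_filter.mp hp).2
      have hne : ¬(p.1 = lo r ∧ p.2 = hi r) := fun hr ↦ hp1 (Prod.ext hr.1 hr.2)
      exact Finset.mem_filter.mpr ⟨Finset.mem_univ _, simpleTransposition_lt hp.1 hne, hp.2⟩
  rw [h2, Finset.card_erase_add_one hmem]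
  rfl

theorem lo_ne_hi_apply (σ : Equiv.Perm (Fin n)) (r : Fin (n - 1)) : σ (lo r) ≠ σ (hi r) :=
  fun h ↦ (lo_lt_hi r).ne (σ.injective h)

theorem inversions_of_gt {σ : Equiv.Perm (Fin n)} {r : Fin (n - 1)}
    (h : σ (hi r) < σ (lo r)) : inversions (σ * simpleTransposition r) + 1 = inversions σ := by
  rw [← inversions_mul_simpleTransposition (r := r) (by simpa using h), mul_assoc,
    simpleTransposition_mul_self, mul_one]

theorem inversions_prod_le (ρ : List (Fin (n - 1))) :
    inversions (ρ.map simpleTransposition).prod ≤ ρ.length := by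
  induction ρ using List.reverseRecOn with
  | nil =>
    simp only [List.map_nil, List.prod_nil, List.length_nil, nonpos_iff_eq_zero]
    rw [inversions, Finset.card_eq_zero, Finset.filter_eq_empty_iff]
    exact fun p _ h ↦ h.1.not_gt h.2
  | append_singleton ρ r ih =>
    simp only [List.map_append, List.map_cons, List.map_nil, List.prod_append, List.prod_cons,
      List.prod_nil, mul_one, List.length_append, List.length_cons, List.length_nil]
    rcases lt_or_gt_of_ne (lo_ne_hi_apply (ρ.map simpleTransposition).prod r) with h | h
    · have := inversions_mul_simpleTransposition h
      omega
    · have := inversions_of_gt h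
      omega

theorem eq_one_of_forall_lt {σ : Equiv.Perm (Fin n)} (h : ∀ r, σ (lo r) < σ (hi r)) : σ = 1 := by
  have h1 : StrictMono σ := by
    cases n with
    | zero => exact fun a ↦ a.elim0
    | succ n => exact Fin.strictMono_iff_lt_succ.mpr fun i ↦ h i
  have h2 := Subsingleton.elim (StrictMono.orderIsoOfSurjective σ h1 σ.surjective)
    (OrderIso.refl (Fin n))
  ext a
  exact congrArg Fin.val (DFunLike.congr_fun h2 a)

/-- Bubble sort: a permutation with an inversion has an adjacent one, and multiplication by that
simple transposition lowers the number of inversions by one. -/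
theorem exists_word (σ : Equiv.Perm (Fin n)) :
    ∃ ρ : List (Fin (n - 1)), (ρ.map simpleTransposition).prod = σ ∧ ρ.length = inversions σ := by
  induction hk : inversions σ generalizing σ with
  | zero =>
    refine ⟨[], (eq_one_of_forall_lt fun r ↦ ?_).symm, rfl⟩
    by_contra h
    have := inversions_of_gt (lt_of_le_of_ne (not_lt.mp h) (lo_ne_hi_apply σ r).symm)
    omega
  | succ k ih =>
    have h : ∃ r, σ (hi r) < σ (lo r) := by
      by_contra! h
      have h1 := eq_one_of_forall_lt fun r ↦ lt_of_le_of_ne (h r) (lo_ne_hi_apply σ r)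
      have h2 := inversions_prod_le (n := n) []
      simp only [List.map_nil, List.prod_nil, List.length_nil, ← h1] at h2
      omega
    obtain ⟨r, hr⟩ := h
    have := inversions_of_gt hr
    obtain ⟨ρ, h1, h2⟩ := ih (σ * simpleTransposition r) (by omega)
    refine ⟨ρ ++ [r], ?_, by simp [h2]⟩
    simp [h1, mul_assoc]

/-- In a reduced word, every letter creates an inversion. -/
theorem IsReducedWord.lt {ρ : List (Fin (n - 1))} {σ : Equiv.Perm (Fin n)} (h : IsReducedWord ρ σ)
    (m : Fin ρ.length) : ((ρ.take m).map simpleTransposition).prod (lo (ρ.get m)) <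
      ((ρ.take m).map simpleTransposition).prod (hi (ρ.get m)) := by
  by_contra h0
  have h1 := inversions_of_gt (lt_of_le_of_ne (not_lt.mp h0) (lo_ne_hi_apply _ _).symm)
  have h2 := inversions_prod_le (ρ.take m)
  -- If the letter removed an inversion, then the prefix through it could be replaced by a word
  -- whose length is its number of inversions, which is shorter than the prefix, contradicting
  -- minimality.
  obtain ⟨ρ', h3, h4⟩ := exists_word (((ρ.take m).map simpleTransposition).prod *
    simpleTransposition (ρ.get m))
  have h5 := h.2 (ρ' ++ ρ.drop (m + 1)) (by
    rw [List.map_append, List.prod_append, h3, ← h.1]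
    conv_rhs => rw [← List.take_append_drop m ρ, List.map_append, List.prod_append,
      List.drop_eq_getElem_cons m.2, List.map_cons, List.prod_cons]
    rw [mul_assoc]
    rfl)
  simp only [List.length_append, List.length_drop, List.length_take] at h5 h2
  omega

/-- The product of the first `m` letters of a word. -/
def partialProd (ρ : List (Fin (n - 1))) (m : ℕ) : Equiv.Perm (Fin n) :=
  ((ρ.take m).map simpleTransposition).prod

@[simp] theorem partialProd_zero (ρ : List (Fin (n - 1))) : partialProd ρ 0 = 1 := rfl

theorem partialProd_succ (ρ : List (Fin (n - 1))) (m : Fin ρ.length) :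
    partialProd ρ (m + 1) = partialProd ρ m * simpleTransposition (ρ.get m) := by
  rw [partialProd, List.take_succ_eq_append_getElem m.2]
  simp [partialProd]

theorem IsReducedWord.partialProd_length {ρ : List (Fin (n - 1))} {σ : Equiv.Perm (Fin n)}
    (h : IsReducedWord ρ σ) : partialProd ρ ρ.length = σ := by
  rw [partialProd, List.take_length, h.1]

/-- At `i = j = b + 1` the identity has rank 0, which forces `w b ≤ b` for every `b`; a permutation
with this property is the identity. -/
theorem eq_one_of_positionRank_le {w : Equiv.Perm (Fin n)}
    (h : ∀ i j : ℕ, i ≤ n → j ≤ n → positionRank w i j ≤ positionRank (1 : Equiv.Perm (Fin n)) i j) : w = 1 := by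
  refine eq_one_of_forall_lt fun r ↦ ?_
  have h1 (b : Fin n) : (w b : ℕ) ≤ b := by
    by_contra! hb
    have h2 := h (b + 1) (b + 1) (by omega) (by omega)
    have h3 : positionRank (1 : Equiv.Perm (Fin n)) (b + 1) (b + 1) = 0 := by
      rw [positionRank, Finset.card_eq_zero, Finset.filter_eq_empty_iff]
      intro a _
      simp only [Equiv.Perm.one_apply]
      omega
    rw [positionRank_succ, if_pos (by omega)] at h2
    omega
  have h2 : w = 1 := by
    have key : ∀ k : ℕ, ∀ b : Fin n, (b : ℕ) = k → w b = b := by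
      intro k
      induction k using Nat.strong_induction_on with
      | _ k ih =>
        rintro b rfl
        by_contra hne
        have h3 : w b < b := lt_of_le_of_ne (Fin.le_def.mpr (h1 b)) hne
        exact hne (w.injective (ih (w b) h3 (w b) rfl))
    exact Equiv.ext fun b ↦ key b b rfl
  rw [h2]
  exact lo_lt_hi r

/-- The lifting property of the Bruhat order, in terms of rank functions. -/
theorem positionRank_le_of_step {σ w : Equiv.Perm (Fin n)} {r : Fin (n - 1)}
    (h : ∀ i j : ℕ, i ≤ n → j ≤ n →
      positionRank w i j ≤ positionRank (σ * simpleTransposition r) i j) :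
    ∃ w' : Equiv.Perm (Fin n), (w' = w ∨ w' * simpleTransposition r = w) ∧
      ∀ i j : ℕ, i ≤ n → j ≤ n → positionRank w' i j ≤ positionRank σ i j := by
  -- `w'` is the shorter of `w` and `w * s_r`. Its rank function agrees with that of `w` except at
  -- `j = r + 1`. There, if `w' (lo r)` is counted then so is `w' (hi r)`, so the bounds at `r` and
  -- `r + 2` imply the one in between.
  obtain ⟨w', hw', hlt⟩ : ∃ w' : Equiv.Perm (Fin n),
      (w' = w ∨ w' * simpleTransposition r = w) ∧ w' (lo r) < w' (hi r) := by
    rcases lt_or_gt_of_ne (lo_ne_hi_apply w r) with hlt | hlt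
    · exact ⟨w, Or.inl rfl, hlt⟩
    · exact ⟨w * simpleTransposition r, Or.inr (by
        rw [mul_assoc, simpleTransposition_mul_self, mul_one]), by simpa using hlt⟩
  have hw (i j : ℕ) (hj : j ≠ r + 1) : positionRank w' i j = positionRank w i j := by
    rcases hw' with rfl | rfl
    · rfl
    · rw [positionRank_mul_simpleTransposition _ _ _ hj]
  refine ⟨w', hw', fun i j hi hj ↦ ?_⟩
  have h1 := h i j hi hj
  by_cases hjr : j = r + 1
  · subst hjr
    have h2 := h i r hi (by omega)
    have h3 := h i (r + 2) hi (by omega)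
    rw [← hw i r (by omega), positionRank_mul_simpleTransposition _ _ _ (by omega)] at h2
    rw [← hw i (r + 2) (by omega), positionRank_mul_simpleTransposition _ _ _ (by omega),
      positionRank_hi_succ, positionRank_hi_succ, positionRank_hi, positionRank_hi] at h3
    rw [positionRank_hi, positionRank_hi]
    rw [Fin.lt_def] at hlt
    split_ifs at h3 ⊢ <;> omega
  · rw [positionRank_mul_simpleTransposition _ _ _ hjr] at h1
    rw [hw i j hjr]
    exact h1

/-- The subword property: a permutation below `σ` is reached by a subword of a reduced word. -/
theorem exists_subword {ρ : List (Fin (n - 1))}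
    {w : Equiv.Perm (Fin n)} (hw : ∀ i j : ℕ, i ≤ n → j ≤ n →
      positionRank w i j ≤ positionRank (partialProd ρ ρ.length) i j) :
    ∃ v : Fin (ρ.length + 1) → Equiv.Perm (Fin n), v 0 = 1 ∧ v (Fin.last _) = w ∧
      ∀ m : Fin ρ.length, v m.castSucc = v m.succ ∨
        v m.castSucc * simpleTransposition (ρ.get m) = v m.succ := by
  have key (k : ℕ) (hk : k ≤ ρ.length) (w : Equiv.Perm (Fin n))
      (hw : ∀ i j : ℕ, i ≤ n → j ≤ n → positionRank w i j ≤ positionRank (partialProd ρ k) i j) :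
      ∃ v : ℕ → Equiv.Perm (Fin n), v 0 = 1 ∧ v k = w ∧ ∀ m : Fin ρ.length, (m : ℕ) < k →
        (v m = v (m + 1) ∨ v m * simpleTransposition (ρ.get m) = v (m + 1)) := by
    induction k generalizing w with
    | zero => exact ⟨fun _ ↦ 1, rfl, (eq_one_of_positionRank_le hw).symm, fun m hm ↦
        absurd hm (Nat.not_lt_zero _)⟩
    | succ k ih =>
      obtain ⟨w', hw', h⟩ := positionRank_le_of_step (r := ρ.get ⟨k, hk⟩) (by
        rwa [← partialProd_succ ρ ⟨k, hk⟩])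
      obtain ⟨v, h1, h2, h3⟩ := ih (Nat.le_of_succ_le hk) w' h
      refine ⟨Function.update v (k + 1) w, ?_, Function.update_self _ _ _, fun m hm ↦ ?_⟩
      · rw [Function.update_of_ne (Nat.succ_ne_zero k).symm, h1]
      · rw [Function.update_of_ne (by omega)]
        rcases Nat.lt_succ_iff_lt_or_eq.mp hm with hm | hm
        · rw [Function.update_of_ne (by omega)]
          exact h3 m hm
        · obtain rfl : m = ⟨k, hk⟩ := Fin.ext hm
          simp only [Function.update_self, h2]
          exact hw'
  obtain ⟨v, h1, h2, h3⟩ := key _ le_rfl w hw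
  exact ⟨fun m ↦ v m, h1, h2, fun m ↦ h3 m m.2⟩

-- If `w` had larger rank at some `(i, j)`, then enough of the columns it counts, together with
-- their rows under `w`, would give an identity submatrix of forbidden size.
open Matrix in
theorem positionRank_le_of_rankConditions {R : Type*} [CommRing R] [Nontrivial R]
    {σ w : Equiv.Perm (Fin n)} (h : RankConditions σ (permGL R w).val) {i j : ℕ} (hi : i ≤ n)
    (hj : j ≤ n) : positionRank w i j ≤ positionRank σ i j := by
  by_contra! hlt
  let B : Finset (Fin n) := {b | (b : ℕ) < j ∧ i ≤ (w b : ℕ)}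
  obtain ⟨C, hCB, hC⟩ := Finset.exists_subset_card_eq (s := B) (n := positionRank σ i j + 1) hlt
  have hf (x) : ((C.orderEmbOfFin hC x : Fin n) : ℕ) < j ∧ i ≤ (w (C.orderEmbOfFin hC x) : ℕ) :=
    (Finset.mem_filter.mp (hCB (C.orderEmbOfFin_mem hC x))).2
  have h0 := h ⟨i, by omega⟩ ⟨j, by omega⟩ (w ∘ C.orderEmbOfFin hC) (C.orderEmbOfFin hC)
    (fun x ↦ (hf x).2) (fun x ↦ (hf x).1)
  have h1 : (permGL R w).val.submatrix (w ∘ C.orderEmbOfFin hC) (C.orderEmbOfFin hC) = 1 := by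
    ext x y
    simp [permGL_apply, Matrix.one_apply]
  rw [h1, det_one] at h0
  exact one_ne_zero h0

end Words

end RelFlag

/-! ### Frames and flags: the dictionary between flags and matrices modulo B -/

namespace RelFlag

open Matrix

section

variable {S : Scheme.{u}} {n : ℕ}

/-- Pullback of functions. -/
def resHom {T' T : Over S} (g : T' ⟶ T) : Γ(T.left, ⊤) →+* Γ(T'.left, ⊤) := g.left.appTop.hom

theorem resHom_comp {T'' T' T : Over S} (h : T'' ⟶ T') (g : T' ⟶ T) :
    resHom (h ≫ g) = (resHom h).comp (resHom g) := by
  rw [resHom, Over.comp_left, Scheme.Hom.comp_appTop]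
  rfl

/-- Pullback of invertible matrices of functions. -/
def resGL {T' T : Over S} (g : T' ⟶ T) :
    GL (Fin n) Γ(T.left, ⊤) →* GL (Fin n) Γ(T'.left, ⊤) :=
  GeneralLinearGroup.map (resHom g)

theorem resGL_val {T' T : Over S} (g : T' ⟶ T) (m : GL (Fin n) Γ(T.left, ⊤)) :
    (resGL g m).val = m.val.map (resHom g) := rfl

theorem resGL_permGL {T' T : Over S} (g : T' ⟶ T) (σ : Equiv.Perm (Fin n)) :
    resGL g (permGL Γ(T.left, ⊤) σ) = permGL Γ(T'.left, ⊤) σ :=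
  permGL_map _ _

variable {V : VectorBundle S n}

namespace Frame

variable {T T' T'' : Over S}

theorem res_comp (h : T'' ⟶ T') (g : T' ⟶ T) (e : Frame V T) : e.res (h ≫ g) = (e.res g).res h :=
  Frame.ext (funext fun _ ↦ V.res_comp _ _ _)

theorem res_id (e : Frame V T) : e.res (𝟙 T) = e :=
  Frame.ext (funext fun _ ↦ V.res_id _)

/-- The coordinates of a section in a frame. -/
noncomputable def coord (e : Frame V T) : V.Sec T ≃ₗ[Γ(T.left, ⊤)] (Fin n → Γ(T.left, ⊤)) :=
  e.equiv.symm

theorem coord_equiv (e : Frame V T) (c : Fin n → Γ(T.left, ⊤)) : e.coord (e.equiv c) = c :=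
  e.equiv.symm_apply_apply c

theorem equiv_coord (e : Frame V T) (x : V.Sec T) : e.equiv (e.coord x) = x :=
  e.equiv.apply_symm_apply x

theorem equiv_single (e : Frame V T) (b : Fin n) : e.equiv (Pi.single b 1) = e.vec b := by
  rw [equiv_apply, Finset.sum_eq_single b]
  · rw [Pi.single_eq_same, one_smul]
  · intro a _ ha
    rw [Pi.single_eq_of_ne ha, zero_smul]
  · simp

theorem coord_vec (e : Frame V T) (b : Fin n) : e.coord (e.vec b) = Pi.single b 1 := by
  rw [← equiv_single, coord_equiv]

theorem coord_res (g : T' ⟶ T) (e : Frame V T) (x : V.Sec T) (j : Fin n) :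
    (e.res g).coord (V.res g x) j = resHom g (e.coord x j) := by
  have h := e.equiv_res g (e.coord x)
  rw [equiv_coord] at h
  rw [← h, coord_equiv]
  rfl

/-- Change of frame by an invertible matrix. -/
noncomputable def mul (e : Frame V T) (m : GL (Fin n) Γ(T.left, ⊤)) : Frame V T where
  vec b := e.equiv fun a ↦ m.val a b
  existsUnique {T'} g x := by
    revert x
    rw [← Function.bijective_iff_existsUnique]
    have : (fun c : Fin n → Γ(T'.left, ⊤) ↦ ∑ i, c i • V.res g (e.equiv fun a ↦ m.val a i)) =
        fun c ↦ (e.res g).equiv ((resGL g m).val *ᵥ c) := by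
      funext c
      have h (i : Fin n) : V.res g (e.equiv fun a ↦ m.val a i) =
          (e.res g).equiv fun a ↦ (resGL g m).val a i := (e.equiv_res g _).symm
      simp only [h, ← map_smul, ← map_sum]
      congr 1
      ext a
      simp [mulVec, dotProduct, mul_comm]
    rw [this]
    refine (e.res g).equiv.bijective.comp ⟨fun c c' h ↦ ?_, fun c ↦ ⟨(resGL g m)⁻¹.val *ᵥ c, ?_⟩⟩
    · have := congrArg (fun c ↦ (resGL g m)⁻¹.val *ᵥ c) h
      simpa only [mulVec_mulVec, ← Units.val_mul, inv_mul_cancel, Units.val_one, one_mulVec]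
        using this
    · simp only [mulVec_mulVec, ← Units.val_mul, mul_inv_cancel, Units.val_one, one_mulVec]

theorem mul_vec (e : Frame V T) (m : GL (Fin n) Γ(T.left, ⊤)) (b : Fin n) :
    (e.mul m).vec b = e.equiv fun a ↦ m.val a b := rfl

theorem mul_equiv (e : Frame V T) (m : GL (Fin n) Γ(T.left, ⊤)) (c : Fin n → Γ(T.left, ⊤)) :
    (e.mul m).equiv c = e.equiv (m.val *ᵥ c) := by
  rw [equiv_apply]
  simp only [mul_vec, ← map_smul, ← map_sum]
  congr 1
  ext a
  simp [mulVec, dotProduct, mul_comm]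

theorem mul_coord (e : Frame V T) (m : GL (Fin n) Γ(T.left, ⊤)) (x : V.Sec T) :
    (e.mul m).coord x = m⁻¹.val *ᵥ e.coord x := by
  apply (e.mul m).equiv.injective
  rw [equiv_coord, mul_equiv, mulVec_mulVec, ← Units.val_mul, mul_inv_cancel, Units.val_one,
    one_mulVec, equiv_coord]

theorem mul_res (g : T' ⟶ T) (e : Frame V T) (m : GL (Fin n) Γ(T.left, ⊤)) :
    (e.mul m).res g = (e.res g).mul (resGL g m) :=
  Frame.ext (funext fun _ ↦ (e.equiv_res g _).symm)

theorem mul_mul (e : Frame V T) (m m' : GL (Fin n) Γ(T.left, ⊤)) :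
    (e.mul m).mul m' = e.mul (m * m') := by
  refine Frame.ext (funext fun b ↦ ?_)
  rw [mul_vec, mul_equiv, mul_vec]
  rfl

theorem mul_one (e : Frame V T) : e.mul 1 = e := by
  refine Frame.ext (funext fun b ↦ ?_)
  rw [mul_vec, ← equiv_single]
  congr 1
  ext a
  simp [Matrix.one_apply, Pi.single_apply]

/-- The coordinate matrices of each frame in the other are mutually inverse. -/
theorem exists_eq_mul (e f : Frame V T) : ∃ m : GL (Fin n) Γ(T.left, ⊤), f = e.mul m := by
  have h (e f : Frame V T) : (Matrix.of fun a b ↦ e.coord (f.vec b) a) *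
      (Matrix.of fun a b ↦ f.coord (e.vec b) a) = (1 : Matrix (Fin n) (Fin n) Γ(T.left, ⊤)) := by
    ext a b
    have h1 : e.coord (f.equiv (f.coord (e.vec b))) a = (Pi.single b 1 : Fin n → _) a := by
      rw [equiv_coord, coord_vec]
    rw [equiv_apply, map_sum] at h1
    simp only [map_smul, Finset.sum_apply, Pi.smul_apply, smul_eq_mul] at h1
    rw [Matrix.mul_apply, Matrix.one_apply, ← Pi.single_apply, ← h1]
    exact Finset.sum_congr rfl fun _ _ ↦ mul_comm _ _
  refine ⟨⟨_, _, h e f, h f e⟩, Frame.ext (funext fun b ↦ ?_)⟩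
  exact (e.equiv_coord _).symm

theorem vec_eq_sum_iff (d e : Frame V T) (c : Matrix (Fin n) (Fin n) Γ(T.left, ⊤))
    (m : GL (Fin n) Γ(T.left, ⊤)) (he : e = d.mul m) :
    (∀ b, e.vec b = ∑ a, c a b • d.vec a) ↔ c = m.val := by
  subst he
  refine ⟨fun h ↦ ?_, fun h b ↦ ?_⟩
  · ext a b
    have : d.equiv (fun a ↦ m.val a b) = d.equiv (fun a ↦ c a b) := h b
    exact (congrFun (d.equiv.injective this) a).symm
  · rw [h]
    rfl

theorem mem_span_iff (e : Frame V T) (i : ℕ) (x : V.Sec T) :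
    x ∈ Submodule.span Γ(T.left, ⊤) (e.vec '' {j | (j : ℕ) < i}) ↔
      ∀ j : Fin n, i ≤ (j : ℕ) → e.coord x j = 0 := by
  constructor
  · intro hx j hj
    induction hx using Submodule.span_induction with
    | mem x h =>
      obtain ⟨k, hk, rfl⟩ := h
      rw [coord_vec, Pi.single_eq_of_ne]
      rintro rfl
      exact absurd hk hj.not_gt
    | zero => simp
    | add x y _ _ hx hy => rw [map_add, Pi.add_apply, hx, hy, add_zero]
    | smul a x _ hx => rw [map_smul, Pi.smul_apply, hx, smul_zero]
  · intro h
    rw [← e.equiv_coord x, equiv_apply]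
    refine Submodule.sum_mem _ fun j _ ↦ ?_
    rcases lt_or_ge (j : ℕ) i with hj | hj
    · exact Submodule.smul_mem _ _ (Submodule.subset_span ⟨j, hj, rfl⟩)
    · rw [h j hj, zero_smul]
      exact zero_mem _

end Frame

theorem eq_zero_of_locally {X : Scheme.{u}} (f : Γ(X, ⊤))
    (h : ∀ x : X, ∃ U : X.Opens, x ∈ U ∧ U.ι.appTop.hom f = 0) : f = 0 := by
  choose U hU h using h
  refine X.sheaf.eq_of_locally_eq' (fun x ↦ (U x).ι ''ᵁ ⊤) ⊤ (fun x ↦ homOfLE le_top) (fun x _ ↦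
    TopologicalSpace.Opens.mem_iSup.mpr ⟨x, by simpa using hU x⟩) f 0 fun x ↦ ?_
  have h1 := h x
  rw [Scheme.Opens.ι_appTop] at h1
  rw [map_zero]
  exact h1

/-- The flag whose members are spanned by the first members of a frame. -/
noncomputable def Flag.ofFrame {T : Over S} (e : Frame V T) : Flag V T where
  sub i T' g :=
    -- The members are cut out by vanishing coordinates instead of being spanned. This makes them
    -- visibly stable under pullback and local; `Frame.mem_span_iff` identifies the two
    -- descriptions.
    { carrier := {x | ∀ j : Fin n, (i : ℕ) ≤ j → (e.res g).coord x j = 0}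
      add_mem' := fun hx hy j hj ↦ by
        rw [map_add, Pi.add_apply, hx j hj, hy j hj, add_zero]
      zero_mem' := fun j _ ↦ by rw [map_zero, Pi.zero_apply]
      smul_mem' := fun a x hx j hj ↦ by rw [map_smul, Pi.smul_apply, hx j hj, smul_zero] }
  res_mem h g x hx j hj := by
    rw [Frame.res_comp, Frame.coord_res, hx j hj, map_zero]
  mem_of_locally {i T'} g x hx j hj := by
    refine eq_zero_of_locally _ fun t ↦ ?_
    obtain ⟨U, hU, h⟩ := hx t
    refine ⟨U, hU, ?_⟩
    have h1 := h j hj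
    rw [Frame.res_comp, Frame.coord_res] at h1
    exact h1
  exists_frame t := by
    refine ⟨⊤, trivial, e.res (openIncl T ⊤), fun i T' h ↦ ?_⟩
    ext x
    refine Iff.trans ?_ (Frame.mem_span_iff ((e.res (openIncl T ⊤)).res h) i x).symm
    rw [← Frame.res_comp]
    rfl

theorem Flag.mem_ofFrame {T T' : Over S} (e : Frame V T) (g : T' ⟶ T) (i : Fin (n + 1))
    (x : V.Sec T') :
    x ∈ (Flag.ofFrame e).sub i g ↔ ∀ j : Fin n, (i : ℕ) ≤ j → (e.res g).coord x j = 0 := Iff.rfl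

/-- Turns adaptedness into an equation between flags, the form in which it is used from here on. -/
theorem adaptedTo_iff {T T' : Over S} {F : Flag V T} {g : T' ⟶ T} {e : Frame V T'} :
    AdaptedTo F.sub g e ↔ F.res g = Flag.ofFrame e := by
  have h (i : Fin (n + 1)) {T'' : Over S} (h : T'' ⟶ T') : (Flag.ofFrame e).sub i h =
      Submodule.span Γ(T''.left, ⊤) ((fun j ↦ V.res h (e.vec j)) '' {j | (j : ℕ) < i}) := by
    ext x
    exact (Frame.mem_span_iff (e.res h) i x).symm
  constructor
  · intro H
    refine Flag.ext ?_
    funext i T'' k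
    rw [h i k]
    exact H i k
  · intro H i T'' k
    rw [← h i k, ← H]
    rfl

theorem Flag.ofFrame_res {T T' : Over S} (g : T' ⟶ T) (e : Frame V T) :
    (Flag.ofFrame e).res g = Flag.ofFrame (e.res g) := by
  refine Flag.ext ?_
  funext i T'' h
  ext x
  refine Eq.to_iff ?_
  change (∀ j : Fin n, (i : ℕ) ≤ j → (e.res (h ≫ g)).coord x j = 0) = _
  rw [Frame.res_comp]
  rfl

/-- The members of rank `i` of two flags agree. -/
def SameMember (i : Fin (n + 1)) {T : Over S} (F F' : Flag V T) : Prop :=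
  ∀ (T' : Over S) (g : T' ⟶ T), F.sub i g = F'.sub i g

theorem SameMember.res {i : Fin (n + 1)} {T T' : Over S} {F F' : Flag V T}
    (h : SameMember i F F') (g : T' ⟶ T) : SameMember i (F.res g) (F'.res g) :=
  fun _ k ↦ h _ (k ≫ g)

theorem Flag.eq_iff_sameMember {T : Over S} {F F' : Flag V T} :
    F = F' ↔ ∀ i, SameMember i F F' := by
  refine ⟨fun h i T' g ↦ by rw [h], fun h ↦ Flag.ext ?_⟩
  funext i T' g
  exact h i _ g

/-- Testing on the vectors of the new frame gives the vanishing of the lower left block of `m`.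
Conversely coordinates change by `m⁻¹`, which is of the same block shape. -/
theorem sameMember_ofFrame_mul {T : Over S} {e : Frame V T} {m : GL (Fin n) Γ(T.left, ⊤)}
    {i : Fin (n + 1)} :
    SameMember i (Flag.ofFrame e) (Flag.ofFrame (e.mul m)) ↔ Preserves (i : ℕ) m.val := by
  constructor
  · intro h
    refine preserves_iff.mpr fun a b ha hb ↦ ?_
    have h1 : (e.mul m).vec b ∈ (Flag.ofFrame e).sub i (𝟙 T) := by
      rw [h _ (𝟙 T)]
      intro j hj
      rw [Frame.res_id, Frame.coord_vec, Pi.single_eq_of_ne]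
      rintro rfl
      omega
    have h2 := h1 a ha
    rw [Frame.res_id, Frame.mul_vec, Frame.coord_equiv] at h2
    exact h2
  · have key {T' : Over S} (f : Frame V T') (m : GL (Fin n) Γ(T'.left, ⊤))
        (hm : Preserves (i : ℕ) m.val) (x : V.Sec T')
        (hx : ∀ j : Fin n, (i : ℕ) ≤ j → f.coord x j = 0) :
        ∀ j : Fin n, (i : ℕ) ≤ j → (f.mul m).coord x j = 0 := by
      intro j hj
      rw [Frame.mul_coord, mulVec, dotProduct]
      refine Finset.sum_eq_zero fun a _ ↦ ?_
      rcases lt_or_ge (a : ℕ) i with ha | ha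
      · rw [preserves_iff.mp hm.inv j a hj ha, zero_mul]
      · rw [hx a ha, mul_zero]
    intro h T' g
    have hg : Preserves (i : ℕ) (resGL g m).val :=
      preserves_iff.mpr fun a b ha hb ↦ by
        rw [resGL_val, map_apply, preserves_iff.mp h a b ha hb, map_zero]
    ext x
    rw [Flag.mem_ofFrame, Flag.mem_ofFrame, Frame.mul_res]
    refine ⟨key _ _ hg x, fun hx ↦ ?_⟩
    have := key ((e.res g).mul (resGL g m)) (resGL g m)⁻¹ hg.inv x hx
    rwa [Frame.mul_mul, mul_inv_cancel, Frame.mul_one] at this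

theorem isUpper_of_forall_preserves {R : Type*} [CommRing R] {m : Matrix (Fin n) (Fin n) R}
    (h : ∀ i : Fin (n + 1), Preserves (i : ℕ) m) : IsUpper m :=
  isUpper_iff.mpr fun a b hab ↦
    preserves_iff.mp (h a.castSucc) a b le_rfl hab

theorem Flag.ofFrame_eq_ofFrame_mul {T : Over S} {e : Frame V T}
    {m : GL (Fin n) Γ(T.left, ⊤)} :
    Flag.ofFrame e = Flag.ofFrame (e.mul m) ↔ IsUpper m.val := by
  simp only [Flag.eq_iff_sameMember, sameMember_ofFrame_mul]
  exact ⟨isUpper_of_forall_preserves, fun h i ↦ h i⟩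

/-- In a fixed frame, the flags that come from frames are the cosets of the upper triangular
matrices in GL_n. -/
theorem Flag.ofFrame_mul_eq_iff {T : Over S} {e : Frame V T}
    {m m' : GL (Fin n) Γ(T.left, ⊤)} :
    Flag.ofFrame (e.mul m) = Flag.ofFrame (e.mul m') ↔ IsUpper (m⁻¹ * m').val := by
  rw [← Flag.ofFrame_eq_ofFrame_mul (e := e.mul m), Frame.mul_mul, mul_inv_cancel_left]

theorem Flag.ofFrame_mul_mul {T : Over S} {e : Frame V T}
    {m u : GL (Fin n) Γ(T.left, ⊤)} (hu : IsUpper u.val) :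
    Flag.ofFrame (e.mul (m * u)) = Flag.ofFrame (e.mul m) := by
  rw [← Frame.mul_mul]
  exact (Flag.ofFrame_eq_ofFrame_mul.mpr hu).symm

theorem sameMember_comm {i : Fin (n + 1)} {T : Over S} {F F' : Flag V T}
    (h : SameMember i F F') : SameMember i F' F := fun _ g ↦ (h _ g).symm

/-- An open immersion of `S`-schemes whose range is a neighbourhood of `t`. -/
structure IsNbhd {T T' : Over S} (g : T' ⟶ T) (t : T.left) : Prop where
  isOpenImmersion : IsOpenImmersion g.left
  mem_range : t ∈ Set.range g.left

theorem isNbhd_openIncl (T : Over S) {U : T.left.Opens} {t : T.left} (h : t ∈ U) :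
    IsNbhd (openIncl T U) t where
  isOpenImmersion := inferInstanceAs (IsOpenImmersion U.ι)
  mem_range := ⟨⟨t, h⟩, rfl⟩

theorem IsNbhd.comp {T T' T'' : Over S} {g : T' ⟶ T} {h : T'' ⟶ T'} {t' : T'.left}
    {t : T.left} (hh : IsNbhd h t') (hg : IsNbhd g t) (ht : g.left t' = t) : IsNbhd (h ≫ g) t where
  isOpenImmersion := by
    have := hh.isOpenImmersion
    have := hg.isOpenImmersion
    exact inferInstanceAs (IsOpenImmersion (h.left ≫ g.left))
  mem_range := by
    obtain ⟨x, rfl⟩ := hh.mem_range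
    exact ⟨x, ht⟩

theorem IsNbhd.exists_openIncl {T T' : Over S} {g : T' ⟶ T} {t : T.left} (hg : IsNbhd g t) :
    ∃ U : T.left.Opens, t ∈ U ∧ ∃ k : openOver T U ⟶ T', k ≫ g = openIncl T U := by
  have := hg.isOpenImmersion
  refine ⟨g.left.opensRange, hg.mem_range, Over.homMk
    (IsOpenImmersion.lift g.left g.left.opensRange.ι (by simp)) ?_, ?_⟩
  · rw [← Over.w g, IsOpenImmersion.lift_fac_assoc]
    rfl
  · ext1
    exact IsOpenImmersion.lift_fac _ _ _

/-- The pullback of an open subscheme. -/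
noncomputable def openRes {T' T : Over S} (g : T' ⟶ T) (U : T.left.Opens) :
    openOver T' (g.left ⁻¹ᵁ U) ⟶ openOver T U :=
  Over.homMk (g.left ∣_ U) (by simp)

theorem openRes_comp {T' T : Over S} (g : T' ⟶ T) (U : T.left.Opens) :
    openRes g U ≫ openIncl T U = openIncl T' (g.left ⁻¹ᵁ U) ≫ g := by
  ext1
  simp [openRes]

/-- Neighbourhoods pull back. -/
theorem IsNbhd.exists_pullback {T T' X : Over S} {g : T' ⟶ T} (f : X ⟶ T) {x : X.left}
    (hg : IsNbhd g (f.left x)) :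
    ∃ (X' : Over S) (g' : X' ⟶ X) (f' : X' ⟶ T'), IsNbhd g' x ∧ f' ≫ g = g' ≫ f := by
  obtain ⟨U, hU, k, hk⟩ := hg.exists_openIncl
  exact ⟨_, openIncl X (f.left ⁻¹ᵁ U), openRes f U ≫ k, isNbhd_openIncl X hU, by
    rw [Category.assoc, hk, openRes_comp]⟩

theorem exists_common_nbhd {ι : Type*} [Finite ι] {T : Over S} {t : T.left}
    (P : ι → ∀ {T' : Over S}, (T' ⟶ T) → Prop)
    (hP : ∀ i {T'' T' : Over S} (h : T'' ⟶ T') (g : T' ⟶ T), P i g → P i (h ≫ g))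
    (H : ∀ i, ∃ (T' : Over S) (g : T' ⟶ T), IsNbhd g t ∧ P i g) :
    ∃ (T' : Over S) (g : T' ⟶ T), IsNbhd g t ∧ ∀ i, P i g := by
  choose T' g hg hp using H
  choose U hU k hk using fun i ↦ (hg i).exists_openIncl
  let W : T.left.Opens := ⟨⋂ i, (U i : Set T.left), isOpen_iInter_of_finite fun i ↦ (U i).2⟩
  have hW (i) : W ≤ U i := Set.iInter_subset _ i
  refine ⟨_, openIncl T W, isNbhd_openIncl T (Set.mem_iInter.mpr hU), fun i ↦ ?_⟩
  let l : openOver T W ⟶ openOver T (U i) :=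
    Over.homMk (T.left.homOfLE (hW i)) (by simp)
  have : l ≫ k i ≫ g i = openIncl T W := by
    rw [hk]
    ext1
    simp [l]
  rw [← this]
  exact hP i _ _ (hP i _ _ (hp i))

theorem SameMember.of_locally {i : Fin (n + 1)} {T : Over S} {F F' : Flag V T}
    (H : ∀ t : T.left, ∃ (T' : Over S) (g : T' ⟶ T), IsNbhd g t ∧
      SameMember i (F.res g) (F'.res g)) : SameMember i F F' := by
  have key (F F' : Flag V T) (H : ∀ t : T.left, ∃ (T' : Over S) (g : T' ⟶ T), IsNbhd g t ∧
      SameMember i (F.res g) (F'.res g)) {T' : Over S} (g : T' ⟶ T) : F.sub i g ≤ F'.sub i g := by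
    intro x hx
    refine F'.mem_of_locally g fun t ↦ ?_
    obtain ⟨Y, h, hh, hs⟩ := H (g.left t)
    obtain ⟨U, hU, k, hk⟩ := hh.exists_openIncl
    refine ⟨g.left ⁻¹ᵁ U, hU, ?_⟩
    have h1 := F.res_mem (openIncl T' (g.left ⁻¹ᵁ U)) g hx
    rw [← openRes_comp, ← hk, ← Category.assoc] at h1 ⊢
    have h2 := hs _ (openRes g U ≫ k)
    change F.sub i ((openRes g U ≫ k) ≫ h) = F'.sub i ((openRes g U ≫ k) ≫ h) at h2
    rwa [← h2]
  exact fun _ g ↦ le_antisymm (key F F' H g) (key F' F (fun t ↦ by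
    obtain ⟨Y, h, hh, hs⟩ := H t
    exact ⟨Y, h, hh, sameMember_comm hs⟩) g)

theorem Flag.eq_of_locally {T : Over S} {F F' : Flag V T}
    (H : ∀ t : T.left, ∃ (T' : Over S) (g : T' ⟶ T), IsNbhd g t ∧ F.res g = F'.res g) :
    F = F' :=
  Flag.eq_iff_sameMember.mpr fun i ↦ SameMember.of_locally fun t ↦ by
    obtain ⟨T', g, hg, h⟩ := H t
    exact ⟨T', g, hg, Flag.eq_iff_sameMember.mp h i⟩

theorem Flag.exists_ofFrame {T : Over S} (F : Flag V T) (t : T.left) :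
    ∃ (T' : Over S) (g : T' ⟶ T), IsNbhd g t ∧ ∃ e : Frame V T', F.res g = Flag.ofFrame e := by
  obtain ⟨U, hU, e, he⟩ := F.exists_frame t
  exact ⟨_, _, isNbhd_openIncl T hU, e, adaptedTo_iff.mp he⟩

theorem isUnit_resHom_openIncl {T : Over S} (f : Γ(T.left, ⊤)) :
    IsUnit (resHom (openIncl T (T.left.basicOpen f)) f) := by
  have key (W : T.left.Opens) (hW : W ≤ T.left.basicOpen f) :
      IsUnit ((T.left.presheaf.map (homOfLE (le_top : W ≤ ⊤)).op).hom f) := by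
    have h1 := (RingedSpace.isUnit_res_basicOpen T.left.toRingedSpace f).map
      (T.left.presheaf.map (homOfLE hW).op).hom
    have h2 : (homOfLE (le_top : W ≤ ⊤)).op =
      (homOfLE (le_top : T.left.basicOpen f ≤ ⊤)).op ≫ (homOfLE hW).op := rfl
    rw [h2, Functor.map_comp]
    exact h1
  have h2 := key ((T.left.basicOpen f).ι ''ᵁ ⊤) (by simp)
  change IsUnit ((T.left.basicOpen f).ι.appTop.hom f)
  rw [Scheme.Opens.ι_appTop]
  exact h2

theorem exists_isUnit_nbhd {T : Over S} {t : T.left} {f : Γ(T.left, ⊤)}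
    (h : t ∈ T.left.basicOpen f) :
    ∃ (T' : Over S) (g : T' ⟶ T), IsNbhd g t ∧ IsUnit (resHom g f) :=
  ⟨_, _, isNbhd_openIncl T h, isUnit_resHom_openIncl f⟩

theorem mem_basicOpen_of_isUnit {T T' : Over S} (g : T' ⟶ T) {f : Γ(T.left, ⊤)}
    (h : IsUnit (resHom g f)) (t : T'.left) : g.left t ∈ T.left.basicOpen f := by
  have h1 : g.left ⁻¹ᵁ T.left.basicOpen f = T'.left.basicOpen (resHom g f) :=
    Scheme.preimage_basicOpen _ _
  have h2 : T'.left.basicOpen (resHom g f) = ⊤ := Scheme.basicOpen_of_isUnit _ h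
  have h3 : t ∈ g.left ⁻¹ᵁ T.left.basicOpen f := by
    rw [h1, h2]
    trivial
  exact h3

end

end RelFlag

/-! ### Representability of Zariski sheaves over S by open charts -/

namespace RelFlag

section

variable {S : Scheme.{u}}

theorem nonempty_representableBy_iff {C : Type*} [Category C] {G : Cᵒᵖ ⥤ Type*} {Z : C} :
    Nonempty (G.RepresentableBy Z) ↔
      ∃ z : G.obj (op Z), ∀ (T : C) (x : G.obj (op T)), ∃! h : T ⟶ Z, G.map h.op z = x := by
  constructor
  · rintro ⟨r⟩
    refine ⟨r.homEquiv (𝟙 Z), fun T x ↦ ?_⟩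
    have (h : T ⟶ Z) : G.map h.op (r.homEquiv (𝟙 Z)) = r.homEquiv h := by
      rw [← r.homEquiv_comp, Category.comp_id]
    simp only [this]
    exact r.homEquiv.bijective.existsUnique x
  · rintro ⟨z, hz⟩
    refine ⟨⟨Equiv.ofBijective _ ((Function.bijective_iff_existsUnique _).mpr (hz _)), ?_⟩⟩
    intro X Y f g
    exact ConcreteCategory.congr_hom (G.map_comp g.op f.op) z

/-- Sheaves for the Zariski topology on `S`-schemes. -/
def IsZariskiSheaf (G : (Over S)ᵒᵖ ⥤ Type*) : Prop :=
  ∀ (T : Over S) (κ : Type (u + 1)) (X : κ → Over S) (j : ∀ k, X k ⟶ T),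
    (∀ k, IsOpenImmersion (j k).left) → (∀ t : T.left, ∃ k, t ∈ Set.range (j k).left) →
    ∀ x : ∀ k, G.obj (op (X k)), (∀ k l (W : Over S) (a : W ⟶ X k) (b : W ⟶ X l),
      a ≫ j k = b ≫ j l → G.map a.op (x k) = G.map b.op (x l)) →
    ∃! y : G.obj (op T), ∀ k, G.map (j k).op y = x k

section

variable (G : (Over S)ᵒᵖ ⥤ Type*) [∀ T, Small.{u} (G.obj T)]

/-- The points of an `S`-functor `G` with values in a scheme whose structure morphism is not
given. -/
def TotalPoint (T : Scheme.{u}) : Type u :=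
  Σ f : T ⟶ S, Shrink.{u} (G.obj (op (Over.mk f)))

namespace TotalPoint

variable {G}

noncomputable def mk {T : Over S} (x : G.obj (op T)) : TotalPoint G T.left :=
  ⟨T.hom, equivShrink (G.obj (op T)) x⟩

noncomputable def val {T : Scheme.{u}} (x : TotalPoint G T) : G.obj (op (Over.mk x.1)) :=
  (equivShrink _).symm x.2

theorem val_mk {T : Over S} (x : G.obj (op T)) : (mk x).val = x :=
  (equivShrink (G.obj (op T))).symm_apply_apply x

theorem mk_val {T : Scheme.{u}} (x : TotalPoint G T) : mk x.val = x :=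
  Sigma.ext rfl (heq_of_eq ((equivShrink _).apply_symm_apply x.2))

theorem mk_eq_iff {T : Over S} (x y : G.obj (op T)) : mk x = mk y ↔ x = y := by
  refine ⟨fun h ↦ ?_, fun h ↦ h ▸ rfl⟩
  exact (equivShrink (G.obj (op T))).injective (eq_of_heq (Sigma.mk.inj h).2)

theorem mk_eq_mk {T : Scheme.{u}} {f f' : T ⟶ S} (k : Over.mk f ⟶ Over.mk f')
    (hk : k.left = 𝟙 T) {x : G.obj (op (Over.mk f))} {y : G.obj (op (Over.mk f'))}
    (h : G.map k.op y = x) : (mk x : TotalPoint G T) = mk y := by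
  obtain rfl : f' = f := by
    have hw := Over.w k
    rw [hk] at hw
    exact (Category.id_comp f').symm.trans hw
  have : k = 𝟙 _ := by
    ext1
    exact hk
  subst this
  rw [mk_eq_iff, ← h]
  exact ConcreteCategory.congr_hom (G.map_id _) y

/-- Pullback of points. -/
noncomputable def res {T' T : Scheme.{u}} (g : T' ⟶ T) (x : TotalPoint G T) : TotalPoint G T' :=
  mk (G.map (Over.homMk g : Over.mk (g ≫ x.1) ⟶ Over.mk x.1).op x.val)

theorem res_mk {T T' : Over S} (g : T' ⟶ T) (x : G.obj (op T)) :
    (mk x).res g.left = mk (G.map g.op x) := by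
  have h : g.left ≫ (mk x).1 = T'.hom := Over.w g
  refine mk_eq_mk (f := g.left ≫ (mk x).1) (f' := T'.hom)
    (Over.homMk (𝟙 T'.left) ((Category.id_comp _).trans h.symm)) rfl ?_
  rw [val_mk]
  refine (ConcreteCategory.congr_hom (G.map_comp _ _) x).symm.trans ?_
  rw [← op_comp]
  congr 3

theorem res_left_eq {T : Scheme.{u}} (x : TotalPoint G T) {W : Over S} (a : W ⟶ Over.mk x.1) :
    x.res a.left = mk (G.map a.op x.val) := by
  rw [← res_mk a x.val, mk_val]

theorem res_id {T : Scheme.{u}} (x : TotalPoint G T) : x.res (𝟙 T) = x := by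
  have := res_mk (𝟙 (Over.mk x.1)) x.val
  rw [mk_val] at this
  refine this.trans ?_
  conv_rhs => rw [← x.mk_val]
  rw [op_id, G.map_id]
  rfl

theorem res_comp {T T' T'' : Scheme.{u}} (h : T'' ⟶ T') (g : T' ⟶ T) (x : TotalPoint G T) :
    x.res (h ≫ g) = (x.res g).res h := by
  let b : Over.mk (g ≫ x.1) ⟶ Over.mk x.1 := Over.homMk g
  let a : Over.mk (h ≫ g ≫ x.1) ⟶ Over.mk (g ≫ x.1) := Over.homMk h
  have h1 := res_mk (a ≫ b) x.val
  rw [mk_val] at h1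
  have h2 := res_mk a (G.map b.op x.val)
  refine h1.trans (Eq.trans ?_ h2.symm)
  rw [op_comp, G.map_comp]
  rfl

end TotalPoint

/-- The functor on schemes whose points are those of an `S`-functor, with arbitrary structure
morphism. -/
noncomputable def totalFunctor : Scheme.{u}ᵒᵖ ⥤ Type u where
  obj T := TotalPoint G T.unop
  map g := ↾(TotalPoint.res g.unop)
  map_id _ := ConcreteCategory.hom_ext _ _ fun x ↦ x.res_id
  map_comp g h := ConcreteCategory.hom_ext _ _ fun x ↦ x.res_comp h.unop g.unop

variable {G}

/-- A point carries its structure morphism to S as data. The structure morphisms are glued first,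
and then the sheaf property of `G` applies over the glued one. -/
theorem isSheaf_totalFunctor (hG : IsZariskiSheaf G) :
    Presieve.IsSheaf Scheme.zariskiTopology (totalFunctor G) := by
  rw [Precoverage.isSheaf_toGrothendieck_iff_of_isStableUnderBaseChange]
  rintro Y R hR x hx
  obtain ⟨(𝓤 : Scheme.OpenCover Y), rfl⟩ := Scheme.exists_cover_of_mem_pretopology hR
  let z (k : 𝓤.I₀) : TotalPoint G (𝓤.X k) := x (𝓤.f k) (.mk _)
  have hz (k l : 𝓤.I₀) {W : Scheme.{u}} (a : W ⟶ 𝓤.X k) (b : W ⟶ 𝓤.X l)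
    (h : a ≫ 𝓤.f k = b ≫ 𝓤.f l) : (z k).res a = (z l).res b := hx a b (.mk _) (.mk _) h
  let e : Y ⟶ S := 𝓤.glueMorphisms (fun k ↦ (z k).1) fun k l ↦
    congrArg Sigma.fst (hz k l _ _ Limits.pullback.condition)
  have he (k) : 𝓤.f k ≫ e = (z k).1 := 𝓤.ι_glueMorphisms _ _ _
  have hG' := hG (Over.mk e) 𝓤.I₀ (fun k ↦ Over.mk (z k).1) (fun k ↦ Over.homMk (𝓤.f k) (he k))
    (fun k ↦ inferInstanceAs (IsOpenImmersion (𝓤.f k))) (fun t ↦ 𝓤.exists_eq t)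
    (fun k ↦ (z k).val) (fun k l W a b h ↦ by
      have := hz k l a.left b.left (congrArg CommaMorphism.left h)
      rw [TotalPoint.res_left_eq, TotalPoint.res_left_eq] at this
      exact (TotalPoint.mk_eq_iff _ _).mp this)
  obtain ⟨y, hy, hu⟩ := hG'
  refine ⟨TotalPoint.mk y, ?_, ?_⟩
  · rintro _ _ ⟨k⟩
    refine (TotalPoint.res_mk (Over.homMk (𝓤.f k) (he k) : Over.mk (z k).1 ⟶ Over.mk e) y).trans ?_
    rw [hy k, TotalPoint.mk_val]
  · intro y' hy'
    have h1 (k : 𝓤.I₀) : y'.res (𝓤.f k) = z k := hy' _ (.mk k)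
    obtain ⟨f, y', rfl⟩ : ∃ (f : Y ⟶ S) (v : G.obj (op (Over.mk f))), TotalPoint.mk v = y' :=
      ⟨_, _, y'.mk_val⟩
    obtain rfl : f = e := 𝓤.hom_ext _ _ fun k ↦
      (congrArg Sigma.fst (h1 k)).trans (he k).symm
    refine congrArg TotalPoint.mk (hu y' fun k ↦ ?_)
    have h2 := h1 k
    rw [← (z k).mk_val] at h2
    erw [TotalPoint.res_mk (Over.homMk (𝓤.f k) (he k) : Over.mk (z k).1 ⟶ Over.mk e)] at h2
    exact (TotalPoint.mk_eq_iff _ _).mp h2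

theorem nonempty_representableBy_of_totalFunctor {Z : Scheme.{u}}
    (r : (totalFunctor G).RepresentableBy Z) : ∃ Z : Over S, Nonempty (G.RepresentableBy Z) := by
  obtain ⟨z, hz⟩ := nonempty_representableBy_iff.mp ⟨r⟩
  obtain ⟨f, z, rfl⟩ : ∃ (f : Z ⟶ S) (v : G.obj (op (Over.mk f))), TotalPoint.mk v = z :=
    ⟨_, _, TotalPoint.mk_val z⟩
  refine ⟨Over.mk f, nonempty_representableBy_iff.mpr ⟨z, fun T x ↦ ?_⟩⟩
  obtain ⟨h, hh, hu⟩ := hz T.left (TotalPoint.mk x)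
  change (TotalPoint.mk z).res h = _ at hh
  have hw : h ≫ f = T.hom := congrArg Sigma.fst hh
  have key (g : T ⟶ Over.mk f) : G.map g.op z = x ↔ (TotalPoint.mk z).res g.left =
      TotalPoint.mk x := by
    rw [← TotalPoint.mk_eq_iff]
    erw [TotalPoint.res_mk]
  refine ⟨Over.homMk h hw, (key _).mpr hh, fun g hg ↦ ?_⟩
  ext1
  exact hu g.left ((key g).mp hg)

theorem map_comp_apply' {C : Type*} [Category C] (G : Cᵒᵖ ⥤ Type*) {T'' T' T : C} (h : T'' ⟶ T')
    (g : T' ⟶ T) (x : G.obj (op T)) : G.map (h ≫ g).op x = G.map h.op (G.map g.op x) :=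
  ConcreteCategory.congr_hom (G.map_comp g.op h.op) x

/-- The pullback of the chart along a point `x` over `T` is the open locus `U` of `x`: the map from
`U` to the chart is given by `openLocus`, and `mono` makes it the only one. -/
theorem openImmersion_presheaf_mk (i : Over S) (y : G.obj (op i))
    (mono : ∀ (T : Over S) (a b : T ⟶ i), G.map a.op y = G.map b.op y → a = b)
    (openLocus : ∀ (T : Over S) (x : G.obj (op T)), ∃ U : T.left.Opens,
      ∀ (T' : Over S) (g : T' ⟶ T), (∃ a : T' ⟶ i, G.map a.op y = G.map g.op x) ↔
        ∀ t, g.left t ∈ U) :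
    IsOpenImmersion.presheaf
      (yonedaEquiv.symm (show (totalFunctor G).obj (op i.left) from TotalPoint.mk y)) := by
  refine MorphismProperty.relative.of_exists fun T g ↦ ?_
  obtain ⟨x, rfl⟩ := yonedaEquiv.symm.surjective g
  obtain ⟨f, x, rfl⟩ : ∃ (f : T ⟶ S) (v : G.obj (op (Over.mk f))), TotalPoint.mk v = x :=
    ⟨_, _, TotalPoint.mk_val x⟩
  obtain ⟨U, hU⟩ := openLocus _ x
  obtain ⟨a, ha⟩ := (hU _ (openIncl (Over.mk f) U)).mpr fun t ↦ t.2
  have key (W : Scheme.{u}) (b : W ⟶ i.left) (c : W ⟶ T) :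
      (TotalPoint.mk y).res b = (TotalPoint.mk x).res c ↔ ∃ (w : b ≫ i.hom = c ≫ f),
        G.map (Over.homMk b w : Over.mk (c ≫ f) ⟶ i).op y =
          G.map (Over.homMk c : Over.mk (c ≫ f) ⟶ Over.mk f).op x := by
    have h2 : (TotalPoint.mk x).res c = _ :=
      TotalPoint.res_mk (Over.homMk c : Over.mk (c ≫ f) ⟶ Over.mk f) x
    rw [h2]
    have h1 (w) : (TotalPoint.mk y).res b = _ :=
      TotalPoint.res_mk (Over.homMk b w : Over.mk (c ≫ f) ⟶ i) y
    constructor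
    · intro h
      have w : b ≫ i.hom = c ≫ f := congrArg Sigma.fst h
      exact ⟨w, (TotalPoint.mk_eq_iff _ _).mp ((h1 w).symm.trans h)⟩
    · rintro ⟨w, h⟩
      rw [h1 w, h]
  refine ⟨U.toScheme, yoneda.map a.left, U.ι, ?_, inferInstance⟩
  refine IsPullback.of_forall_isPullback_app fun W ↦ ?_
  rw [Limits.Types.isPullback_iff]
  refine ⟨?_, ?_, ?_⟩
  · ext c
    change (TotalPoint.mk y).res (c ≫ a.left) = (TotalPoint.mk x).res (c ≫ U.ι)
    have h1 := TotalPoint.res_mk a y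
    have h2 := TotalPoint.res_mk (openIncl (Over.mk f) U) x
    rw [TotalPoint.res_comp, TotalPoint.res_comp, h1]
    erw [h2]
    rw [ha]
  · rintro c c' ⟨-, h⟩
    change c ≫ U.ι = c' ≫ U.ι at h
    exact (cancel_mono _).mp h
  · intro b c h
    change (TotalPoint.mk y).res b = (TotalPoint.mk x).res c at h
    obtain ⟨w, h⟩ := (key _ _ _).mp h
    have hc := (hU _ (Over.homMk c : Over.mk (c ≫ f) ⟶ Over.mk f)).mp ⟨_, h⟩
    have hr : Set.range (show W.unop ⟶ T from c) ⊆ Set.range U.ι := by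
      rintro _ ⟨t, rfl⟩
      simpa using hc t
    let d : W.unop ⟶ U.toScheme := IsOpenImmersion.lift U.ι c hr
    have hd : d ≫ U.ι = c := IsOpenImmersion.lift_fac _ _ _
    refine ⟨d, ?_, hd⟩
    let d' : Over.mk (c ≫ f) ⟶ openOver (Over.mk f) U :=
      Over.homMk d ((Category.assoc _ _ _).symm.trans (congrArg (· ≫ f) hd))
    have hd' : d' ≫ openIncl (Over.mk f) U = Over.homMk c := by
      ext1
      exact hd
    have := mono _ (d' ≫ a) (Over.homMk b w) (by
      rw [map_comp_apply', ha, ← map_comp_apply', hd', h])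
    exact congrArg CommaMorphism.left this

/-- A Zariski sheaf on `S`-schemes which is covered by representable open subfunctors is
representable. -/
theorem exists_representableBy_of_charts (hG : IsZariskiSheaf G) {ι : Type u} (Y : ι → Over S)
    (y : ∀ i, G.obj (op (Y i)))
    (mono : ∀ i (T : Over S) (a b : T ⟶ Y i), G.map a.op (y i) = G.map b.op (y i) → a = b)
    (openLocus : ∀ i (T : Over S) (x : G.obj (op T)), ∃ U : T.left.Opens,
      ∀ (T' : Over S) (g : T' ⟶ T), (∃ a : T' ⟶ Y i, G.map a.op (y i) = G.map g.op x) ↔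
        ∀ t, g.left t ∈ U)
    (cover : ∀ (T : Over S) (x : G.obj (op T)) (t : T.left), ∃ (T' : Over S) (g : T' ⟶ T),
      IsNbhd g t ∧ ∃ i, ∃ a : T' ⟶ Y i, G.map a.op (y i) = G.map g.op x) :
    ∃ Z : Over S, Nonempty (G.RepresentableBy Z) := by
  let F : Sheaf Scheme.zariskiTopology.{u} (Type u) :=
    ⟨totalFunctor G, (isSheaf_iff_isSheaf_of_type _ _).mpr (isSheaf_totalFunctor hG)⟩
  let f (i : ι) : yoneda.obj (Y i).left ⟶ F.1 :=
    yonedaEquiv.symm (show (totalFunctor G).obj (op (Y i).left) from TotalPoint.mk (y i))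
  have hf (i : ι) : IsOpenImmersion.presheaf (f i) :=
    openImmersion_presheaf_mk (Y i) (y i) (mono i) (openLocus i)
  have : Presheaf.IsLocallySurjective Scheme.zariskiTopology (Limits.Sigma.desc f) := by
    refine ⟨fun {T} x ↦ ?_⟩
    obtain ⟨f₀, x, rfl⟩ : ∃ (f : T ⟶ S) (v : G.obj (op (Over.mk f))), TotalPoint.mk v = x :=
      ⟨_, _, TotalPoint.mk_val x⟩
    rw [Scheme.mem_grothendieckTopology_iff]
    choose T' g hg i a ha using cover _ x
    have hgo (t : T) : IsOpenImmersion (g t).left := (hg t).isOpenImmersion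
    let 𝓤 : Scheme.OpenCover.{u} T :=
      { I₀ := T
        X := fun t ↦ (T' t).left
        f := fun t ↦ (g t).left
        mem₀ := by
          rw [Scheme.presieve₀_mem_precoverage_iff]
          exact ⟨fun t ↦ ⟨t, (hg t).mem_range⟩, hgo⟩ }
    refine ⟨𝓤, Presieve.ofArrows_le_iff.mpr fun t ↦ ?_⟩
    refine ⟨(Limits.Sigma.ι (fun i ↦ yoneda.obj (Y i).left) (i t)).app _ (a t).left, ?_⟩
    have h1 : (Limits.Sigma.desc f).app (op (T' t).left)
        ((Limits.Sigma.ι (fun i ↦ yoneda.obj (Y i).left) (i t)).app _ (a t).left) =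
        (f (i t)).app (op (T' t).left) (a t).left := by
      rw [← Limits.Sigma.ι_desc f (i t)]
      rfl
    refine h1.trans ?_
    change (TotalPoint.mk (y (i t))).res (a t).left = (TotalPoint.mk x).res (g t).left
    erw [TotalPoint.res_mk, TotalPoint.res_mk]
    rw [ha]
  exact nonempty_representableBy_of_totalFunctor
    (Scheme.LocalRepresentability.representableBy hf)

end

end

end RelFlag

/-! ### Smoothness by retracts, and closed subschemes defined by local vanishing conditions -/

namespace RelFlag

/-- A lifting problem for `A` is pulled back to `B` along `r`, solved there, and restricted along
`i`. -/
theorem formallySmooth_of_retract {R A B : Type*} [CommRing R] [CommRing A] [CommRing B]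
    (f : R →+* A) (i : A →+* B) (r : B →+* A) (h : r.comp i = RingHom.id A)
    (H : (i.comp f).FormallySmooth) : f.FormallySmooth := by
  algebraize [f, i.comp f]
  refine Algebra.FormallySmooth.of_comp_surjective fun C _ _ I hI g ↦ ?_
  let r' : B →ₐ[R] A :=
    { r with commutes' := fun x ↦ RingHom.congr_fun h (f x) }
  let i' : A →ₐ[R] B := { i with commutes' := fun _ ↦ rfl }
  obtain ⟨l, hl⟩ := Algebra.FormallySmooth.exists_lift I ⟨2, hI⟩ (g.comp r')
  refine ⟨l.comp i', ?_⟩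
  change ((Ideal.Quotient.mkₐ R I).comp l).comp i' = g
  rw [hl]
  ext a
  exact congrArg g (RingHom.congr_fun h a)

/-- For morphisms locally of finite presentation, smoothness is formal smoothness of the stalk maps.
A local section `i` of `r` makes the local ring of `Z` a retract of one of `P`. No smoothness of `r`
is required. -/
theorem smooth_of_retracts {Z K : Scheme.{u}} (f : Z ⟶ K) [LocallyOfFinitePresentation f]
    (H : ∀ z : Z, ∃ (N P : Scheme.{u}) (i : N ⟶ P) (r : P ⟶ Z), IsOpenImmersion (i ≫ r) ∧
      z ∈ Set.range (i ≫ r) ∧ Smooth (r ≫ f)) : Smooth f := by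
  rw [← Scheme.Hom.smoothLocus_eq_top_iff, ← top_le_iff]
  rintro z -
  obtain ⟨N, P, i, r, hj, ⟨x, rfl⟩, _⟩ := H z
  have hj' : IsIso ((i ≫ r).stalkMap x) := inferInstance
  rw [Scheme.Hom.mem_smoothLocus]
  have h1 : i x ∈ (r ≫ f).smoothLocus := by
    rw [Scheme.Hom.smoothLocus_eq_top]
    trivial
  rw [Scheme.Hom.mem_smoothLocus, Scheme.Hom.stalkMap_comp] at h1
  refine formallySmooth_of_retract _ (r.stalkMap (i x)).hom
    (i.stalkMap x ≫ inv ((i ≫ r).stalkMap x)).hom ?_ h1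
  have h3 := IsIso.hom_inv_id ((i ≫ r).stalkMap x)
  exact congrArg CommRingCat.Hom.hom
    ((congrArg (· ≫ inv ((i ≫ r).stalkMap x)) (Scheme.Hom.stalkMap_comp i r x)).symm.trans h3)

/-- The closed subscheme of an affine scheme on which a set of functions vanishes. -/
theorem exists_isClosedImmersion_of_isAffine {W : Scheme.{u}} [IsAffine W] (A : Set Γ(W, ⊤)) :
    ∃ (T : Scheme.{u}) (i : T ⟶ W), IsClosedImmersion i ∧ (∀ a ∈ A, i.appTop.hom a = 0) ∧
      ∀ (X : Scheme.{u}) (g : X ⟶ W), (∀ a ∈ A, g.appTop.hom a = 0) → ∃ h, h ≫ i = g := by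
  let I := Scheme.IdealSheafData.ofIdealTop (X := W) (Ideal.span A)
  have hI : I.ideal ⟨⊤, isAffineOpen_top W⟩ = Ideal.span A :=
    (Scheme.IdealSheafData.equivOfIsAffine (X := W)).apply_symm_apply (Ideal.span A)
  refine ⟨I.subscheme, I.subschemeι, inferInstance, fun a ha ↦ ?_, fun X g hg ↦ ?_⟩
  · have h1 : a ∈ I.subschemeι.ker.ideal ⟨⊤, isAffineOpen_top W⟩ := by
      rw [Scheme.IdealSheafData.ker_subschemeι, hI]
      exact Ideal.subset_span ha
    exact Scheme.Hom.ideal_ker_le _ _ h1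
  · have h : I.subschemeι.ker ≤ g.ker := by
      rw [Scheme.IdealSheafData.ker_subschemeι]
      refine Scheme.IdealSheafData.le_of_isAffine ?_
      rw [hI, Scheme.ker_of_isAffine, Ideal.span_le]
      intro a ha
      have := (Scheme.IdealSheafData.equivOfIsAffine (X := W)).apply_symm_apply
        (RingHom.ker g.appTop.hom)
      exact this.ge (hg a ha)
    exact ⟨IsClosedImmersion.lift _ _ h, IsClosedImmersion.lift_fac _ _ h⟩

theorem morphismRestrict_appTop_eq_zero_iff {T Y : Scheme.{u}} (f : T ⟶ Y) (W : Y.Opens)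
    (a : Γ(W, ⊤)) : (f ∣_ W).appTop.hom a = 0 ↔ (f.app (W.ι ''ᵁ ⊤)).hom a = 0 := by
  rw [morphismRestrict_appTop]
  exact map_eq_zero_iff _ (ConcreteCategory.bijective_of_isIso
    (T.presheaf.map (eqToHom (image_morphismRestrict_preimage f W ⊤)).op)).1

theorem eq_zero_of_locally' {X : Scheme.{u}} (V : X.Opens) (f : Γ(X, V))
    (h : ∀ x ∈ V, ∃ (N : Scheme.{u}) (g : N ⟶ X), IsOpenImmersion g ∧ x ∈ Set.range g ∧
      (g.app V).hom f = 0) : f = 0 := by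
  apply X.IsSheaf.section_ext
  intro x hx
  obtain ⟨N, g, _, ⟨y, rfl⟩, h⟩ := h x hx
  refine ⟨g ''ᵁ g ⁻¹ᵁ V, Set.image_preimage_subset g V, ⟨_, hx, rfl⟩, ?_⟩
  rw [map_zero]
  apply (g.appIso _).commRingCatIsoToRingEquiv.injective
  rw [map_zero, ← RingEquiv.coe_toRingHom, Iso.commRingCatIsoToRingEquiv_toRingHom,
    Scheme.Hom.appIso_hom']
  simp only [homOfLE_leOfHom, ← RingHom.comp_apply, ← CommRingCat.hom_comp,
    Scheme.Hom.map_appLE]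
  rw [Scheme.Hom.app_eq_appLE] at h
  exact h

section

variable {S : Scheme.{u}}

/-- A condition on morphisms to a Noetherian `S`-scheme which is local on the source and given
locally on the target by the vanishing of functions is represented by a closed subscheme. -/
theorem exists_isClosedImmersion (Y : Over S) [IsLocallyNoetherian Y.left] [CompactSpace Y.left]
    (C : ∀ (T : Over S), (T ⟶ Y) → Prop)
    (hres : ∀ (T' T : Over S) (h : T' ⟶ T) (g : T ⟶ Y), C T g → C T' (h ≫ g))
    (hloc : ∀ (T : Over S) (g : T ⟶ Y), (∀ t : T.left, ∃ (T' : Over S) (h : T' ⟶ T), IsNbhd h t ∧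
      C T' (h ≫ g)) → C T g)
    (hcl : ∀ y : Y.left, ∃ (Y' : Over S) (j : Y' ⟶ Y), IsNbhd j y ∧ ∃ A : Set Γ(Y'.left, ⊤),
      ∀ (T : Over S) (g : T ⟶ Y'), C T (g ≫ j) ↔ ∀ a ∈ A, resHom g a = 0) :
    ∃ (X : Over S) (i : X ⟶ Y), IsClosedImmersion i.left ∧ C X i ∧
      ∀ (T : Over S) (g : T ⟶ Y), C T g → ∃ h, h ≫ i = g := by
  have h1 (y : Y.left) : ∃ W : Y.left.Opens, y ∈ W ∧ IsAffineOpen W ∧ ∃ A : Set Γ(W, ⊤),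
      ∀ (T : Over S) (g : T ⟶ openOver Y W), C T (g ≫ openIncl Y W) ↔
        ∀ a ∈ A, resHom g a = 0 := by
    obtain ⟨Y', j, hj, A, hA⟩ := hcl y
    obtain ⟨U, hU, k, hk⟩ := hj.exists_openIncl
    obtain ⟨W, hW, hyW, hWU⟩ : ∃ W : Y.left.Opens, IsAffineOpen W ∧ y ∈ W ∧ W ≤ U := by
      obtain ⟨_, ⟨W, hW, rfl⟩, hyW, hWU⟩ :=
        Y.left.isBasis_affineOpens.exists_subset_of_mem_open hU U.2
      exact ⟨W, hW, hyW, hWU⟩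
    let l : openOver Y W ⟶ openOver Y U := Over.homMk (Y.left.homOfLE hWU) (by simp)
    have hl : (l ≫ k) ≫ j = openIncl Y W := by
      rw [Category.assoc, hk]
      ext1
      simp [l]
    refine ⟨W, hyW, hW, (resHom (l ≫ k)) '' A, fun T g ↦ ?_⟩
    rw [← hl, ← Category.assoc, hA, Set.forall_mem_image]
    simp only [resHom_comp g, RingHom.comp_apply]
  choose W hyW hW A hA using h1
  obtain ⟨s, hs⟩ := isCompact_univ.elim_finite_subcover (fun y ↦ (W y : Set Y.left))
    (fun y ↦ (W y).2) (fun y _ ↦ Set.mem_iUnion.mpr ⟨y, hyW y⟩)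
  have hcov (y : Y.left) : ∃ l : s, y ∈ W l := by
    have := hs (Set.mem_univ y)
    simp only [Set.mem_iUnion] at this
    obtain ⟨l, hl, h⟩ := this
    exact ⟨⟨l, hl⟩, h⟩
  have hWa (y : Y.left) : IsAffine (W y) := hW y
  choose T₀ i₀ hi₀ hi₀A hlift using fun y ↦ exists_isClosedImmersion_of_isAffine (A y)
  let f (y : Y.left) : T₀ y ⟶ Y.left := i₀ y ≫ (W y).ι
  have hf (y : Y.left) : C (Over.mk (f y ≫ Y.hom)) (Over.homMk (f y)) := by
    let g : Over.mk (f y ≫ Y.hom) ⟶ openOver Y (W y) := Over.homMk (i₀ y) (by simp [f])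
    exact (hA y _ g).mpr (hi₀A y)
  have hfqc (y : Y.left) : QuasiCompact (f y) := by
    have := hi₀ y
    infer_instance
  have key (y : Y.left) (T : Over S) (g : T ⟶ Y) (hg : C T g) (a : Γ(W y, ⊤)) (ha : a ∈ A y) :
      (g.left.app ((W y).ι ''ᵁ ⊤)).hom a = 0 := by
    rw [← morphismRestrict_appTop_eq_zero_iff]
    refine (hA y _ (openRes g (W y))).mp ?_ a ha
    rw [openRes_comp]
    exact hres _ _ _ _ hg
  have hW' (y : Y.left) : IsAffineOpen ((W y).ι ''ᵁ ⊤) := by simpa using hW y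
  -- The scheme-theoretic union of finitely many local zero schemes, each mapped to all of `Y`.
  -- Every piece satisfies the condition on the whole of `Y`, so the equations on any `W y` vanish
  -- on all pieces and lie in `I`. Conversely a map satisfying the condition factors locally through
  -- a piece, hence kills `I`. The Noetherian hypothesis makes the pieces quasi-compact over `Y`, so
  -- that their kernels are computed on affine opens.
  let I : Y.left.IdealSheafData := ⨅ l : s, (f l).ker
  let X : Over S := Over.mk (I.subschemeι ≫ Y.hom)
  let i : X ⟶ Y := Over.homMk I.subschemeι
  refine ⟨X, i, (inferInstance : IsClosedImmersion I.subschemeι), ?_, fun T g hg ↦ ?_⟩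
  · refine hloc _ _ fun t ↦ ?_
    obtain ⟨y, hy⟩ := hcov (i.left t)
    refine ⟨_, openIncl _ (i.left ⁻¹ᵁ (W y)), isNbhd_openIncl X hy, ?_⟩
    suffices C _ (openRes i (W y) ≫ openIncl Y (W y)) by rwa [openRes_comp] at this
    refine (hA y _ _).mpr fun a ha ↦ ?_
    refine (morphismRestrict_appTop_eq_zero_iff I.subschemeι (W y) a).mpr ?_
    have h3 : a ∈ I.ideal ⟨_, hW' y⟩ := by
      rw [Scheme.IdealSheafData.ideal_iInf, iInf_apply]
      refine Ideal.mem_iInf.mpr fun l ↦ ?_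
      rw [Scheme.Hom.ker_apply]
      exact key y _ _ (hf l) a ha
    rw [← Scheme.IdealSheafData.ker_subschemeι_app I] at h3
    exact h3
  · have h2 : I ≤ g.left.ker := by
      refine Scheme.IdealSheafData.le_ofIdeals_iff.mpr fun V a ha ↦ ?_
      refine eq_zero_of_locally' _ _ fun t ht ↦ ?_
      obtain ⟨y, hy⟩ := hcov (g.left t)
      obtain ⟨h, hh⟩ := hlift y _ (g.left ∣_ W y) ((hA y _ (openRes g (W y))).mp (by
        rw [openRes_comp]
        exact hres _ _ _ _ hg))
      refine ⟨_, (g.left ⁻¹ᵁ W y).ι, inferInstance, ⟨⟨t, hy⟩, rfl⟩, ?_⟩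
      have h3 : (g.left ⁻¹ᵁ W y).ι ≫ g.left = h ≫ f y := by
        rw [← morphismRestrict_ι, ← hh, Category.assoc]
      have h4 : a ∈ (f y).ker.ideal V := by
        have := (iInf_le (fun l : s ↦ (f l).ker) y) V
        exact this ha
      have h5 : a ∈ ((g.left ⁻¹ᵁ W y).ι ≫ g.left).ker.ideal V := by
        rw [h3]
        exact Scheme.Hom.le_ker_comp _ _ _ h4
      have h6 := Scheme.Hom.ideal_ker_le _ _ h5
      rw [RingHom.mem_ker, Scheme.Hom.comp_app] at h6
      exact h6
    have h3 : I.subschemeι.ker ≤ g.left.ker := by rwa [Scheme.IdealSheafData.ker_subschemeι]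
    refine ⟨Over.homMk (IsClosedImmersion.lift _ _ h3) ?_, ?_⟩
    · have := IsClosedImmersion.lift_fac I.subschemeι g.left h3
      exact (Category.assoc _ _ _).symm.trans ((congrArg (· ≫ Y.hom) this).trans (Over.w g))
    · ext1
      exact IsClosedImmersion.lift_fac _ _ h3

end

end RelFlag

/-! ### The sheaf of flags and its cover by big cells -/

namespace RelFlag

open Matrix

section

variable {R : Type*} [CommRing R] {n : ℕ}

/-- Uniqueness of the LU factorization: going down the rows, the equation `L * u = L'` determines
each row of `u` from the previous ones and shows it to be that of the identity. -/
theorem IsLowerUnipotent.eq_of_mul_isUpper {L L' u : Matrix (Fin n) (Fin n) R}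
    (hL : IsLowerUnipotent L) (hL' : IsLowerUnipotent L') (hu : IsUpper u) (h : L * u = L') :
    L = L' := by
  have key (a b : Fin n) : L' a b = u a b + ∑ c ∈ Finset.univ.filter (· < a), L a c * u c b := by
    rw [← h, Matrix.mul_apply, ← Finset.sum_filter_add_sum_filter_not _ (fun c ↦ c < a), add_comm]
    congr 1
    rw [Finset.sum_eq_single a]
    · rw [hL.1 a, one_mul]
    · intro c hc hca
      rw [hL.2 a c, zero_mul]
      have := (Finset.mem_filter.mp hc).2
      omega
    · intro ha
      exact absurd (Finset.mem_filter.mpr ⟨Finset.mem_univ a, lt_irrefl a⟩) ha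
  have h1 (a b : Fin n) : u a b = (1 : Matrix (Fin n) (Fin n) R) a b := by
    induction a using WellFoundedLT.induction with
    | ind a ih =>
      rcases lt_or_ge b a with hba | hab
      · rw [isUpper_iff.mp hu a b hba, one_apply_ne hba.ne']
      have h0 : ∑ c ∈ Finset.univ.filter (· < a), L a c * u c b = 0 :=
        Finset.sum_eq_zero fun c hc ↦ by
          have hc := (Finset.mem_filter.mp hc).2
          rw [ih c hc, one_apply_ne (hc.trans_le hab).ne, mul_zero]
      have := key a b
      rw [h0, add_zero] at this
      rw [← this]
      rcases hab.eq_or_lt with rfl | hab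
      · rw [hL'.1 a, one_apply_eq]
      · rw [hL'.2 a b hab, one_apply_ne hab.ne]
  have : u = 1 := by
    ext a b
    exact h1 a b
  rw [← h, this, mul_one]

theorem IsLowerUnipotent.map {S : Type*} [CommRing S] {m : Matrix (Fin n) (Fin n) R}
    (h : IsLowerUnipotent m) (f : R →+* S) : IsLowerUnipotent (m.map f) :=
  ⟨fun a ↦ by rw [map_apply, h.1, map_one], fun a b hab ↦ by rw [map_apply, h.2 a b hab, map_zero]⟩

theorem IsLowerUnipotent.det_leading {m : Matrix (Fin n) (Fin n) R} (h : IsLowerUnipotent m)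
    {j : ℕ} (hj : j ≤ n) : (leading m hj).det = 1 :=
  IsLowerUnipotent.det ⟨fun _ ↦ h.1 _, fun _ _ hab ↦ h.2 _ _ hab⟩

theorem det_leading_map {S : Type*} [CommRing S] (m : Matrix (Fin n) (Fin n) R) (f : R →+* S)
    {j : ℕ} (hj : j ≤ n) : (leading (m.map f) hj).det = f (leading m hj).det := by
  rw [RingHom.map_det]
  rfl

/-- Column reduction at the point `f`, with arbitrary nonzero pivots, shows that the point lies in
one of the permuted big cells. This is why the big cells cover. -/
theorem exists_perm_leading_ne_zero {K : Type*} [Field K] (f : R →+* K) (m : GL (Fin n) R) :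
    ∃ w : Equiv.Perm (Fin n), ∀ j : Fin (n + 1),
      f (leading ((permGL R w)⁻¹ * m).val j.is_le).det ≠ 0 := by
  obtain ⟨w, u, hu, hL, -⟩ := exists_normalForm (GeneralLinearGroup.map f m) (fun v i ↦ v i ≠ 0)
    (fun v hv ↦ by
      obtain ⟨i, hi⟩ := Function.ne_iff.mp hv
      exact ⟨i, hi, hi⟩) (fun v i c hc hv ↦ mul_ne_zero hc hv)
  refine ⟨w, fun j ↦ ?_⟩
  have h1 : ((permGL R w)⁻¹ * m).val.map f =
      (permGL K w)⁻¹.val * (GeneralLinearGroup.map f m).val := by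
    rw [← permGL_map f w, ← map_inv, ← Units.val_mul, ← map_mul]
    rfl
  have h2 : IsLowerUnipotent (((permGL R w)⁻¹ * m).val.map f * u.val) := by
    rw [h1, Matrix.mul_assoc]
    exact hL
  have h3 := h2.det_leading j.is_le
  rw [leading_mul_of_isUpper _ hu, det_mul, det_leading_map] at h3
  exact left_ne_zero_of_mul_eq_one h3

end

section

variable {S : Scheme.{u}} {n : ℕ} {V : VectorBundle S n}

/-- Members of a flag are Zariski sheaves, so they glue, and frames adapted to the pieces are
adapted to the result. -/
theorem isZariskiSheaf_flagBundle (V : VectorBundle S n) : IsZariskiSheaf (flagBundle V) := by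
  intro T κ X j hj hcov F hF
  replace hF (k l : κ) (W : Over S) (a : W ⟶ X k) (b : W ⟶ X l) (h : a ≫ j k = b ≫ j l)
      (i : Fin (n + 1)) : Flag.sub (F k) i a = Flag.sub (F l) i b := by
    have := congrArg (fun F : Flag V W ↦ F.sub i (𝟙 W)) (hF k l W a b h)
    change Flag.sub (F k) i (𝟙 W ≫ a) = Flag.sub (F l) i (𝟙 W ≫ b) at this
    simpa only [Category.id_comp] using this
  -- A section belongs to the glued member if all its restrictions to schemes that factor through
  -- the cover belong to the given members.
  let sub (i : Fin (n + 1)) {T' : Over S} (g : T' ⟶ T) :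
      Submodule Γ(T'.left, ⊤) (V.Sec T') :=
    { carrier := {x | ∀ (k : κ) (W : Over S) (h : W ⟶ T') (a : W ⟶ X k), a ≫ j k = h ≫ g →
        V.res h x ∈ Flag.sub (F k) i a}
      add_mem' := fun hx hy k W h a e ↦ by
        rw [map_add]
        exact add_mem (hx k W h a e) (hy k W h a e)
      zero_mem' := fun k W h a e ↦ by
        rw [map_zero]
        exact zero_mem _
      smul_mem' := fun c x hx k W h a e ↦ by
        rw [map_smulₛₗ]
        exact Submodule.smul_mem _ _ (hx k W h a e) }
  have hsub (i : Fin (n + 1)) (k : κ) {T' : Over S} (g : T' ⟶ X k) :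
      sub i (g ≫ j k) = Flag.sub (F k) i g := by
    ext x
    constructor
    · intro hx
      have := hx k T' (𝟙 _) g (Category.id_comp _).symm
      rwa [V.res_id] at this
    · intro hx l W h a e
      rw [hF l k W a (h ≫ g) (e.trans (Category.assoc _ _ _).symm)]
      exact Flag.res_mem (F k) h g hx
  let Φ : Flag V T :=
    { sub := sub
      res_mem := fun {i T'' T'} h g x hx k W h' a e ↦ by
        rw [← V.res_comp]
        exact hx k W (h' ≫ h) a (e.trans (Category.assoc _ _ _).symm)
      mem_of_locally := fun {i T'} g x hx k W h a e ↦ by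
        refine Flag.mem_of_locally (F k) a fun w ↦ ?_
        obtain ⟨U, hU, hxU⟩ := hx (h.left w)
        refine ⟨h.left ⁻¹ᵁ U, hU, ?_⟩
        have := hxU k _ (openRes h U) (openIncl W (h.left ⁻¹ᵁ U) ≫ a) (by
          rw [Category.assoc, e, ← Category.assoc, ← Category.assoc, openRes_comp])
        rwa [← V.res_comp, openRes_comp, V.res_comp] at this
      exists_frame := fun t ↦ by
        obtain ⟨k, x, rfl⟩ := hcov t
        obtain ⟨T', g, hg, e, he⟩ := Flag.exists_ofFrame (F k) x
        have hgj : IsNbhd (g ≫ j k) ((j k).left x) :=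
          hg.comp ⟨hj k, ⟨x, rfl⟩⟩ rfl
        obtain ⟨U, hU, l, hl⟩ := hgj.exists_openIncl
        refine ⟨U, hU, e.res l, fun i T'' h ↦ ?_⟩
        have h1 := adaptedTo_iff.mpr he i (h ≫ l)
        rw [← hsub, Category.assoc, Category.assoc, hl] at h1
        refine h1.trans ?_
        simp only [V.res_comp]
        rfl }
  refine ⟨Φ, fun k ↦ Flag.ext ?_, fun Φ' h ↦ ?_⟩
  · funext i T' g
    exact hsub i k g
  · refine Flag.eq_of_locally fun t ↦ ?_
    obtain ⟨k, x, rfl⟩ := hcov t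
    refine ⟨X k, j k, ⟨hj k, ⟨x, rfl⟩⟩, (h k).trans (Flag.ext ?_)⟩
    funext i T' g
    exact (hsub i k g).symm

/-- A flag is a datum on all `T`-schemes and so lives in a larger universe. It is nevertheless
determined by its members over the open subsets of `T`, since the matrix comparing two local frames
can be read off on the frame vectors themselves. -/
instance small_flag (T : Over S) : Small.{u} (Flag V T) := by
  refine small_of_injective (β := ∀ (_ : Fin (n + 1)) (U : T.left.Opens),
    Set (V.Sec (openOver T U))) (f := fun F i U ↦ F.sub i (openIncl T U)) ?_
  intro F F' h
  replace h (i : Fin (n + 1)) (U : T.left.Opens) :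
    F.sub i (openIncl T U) = F'.sub i (openIncl T U) :=
      SetLike.coe_injective (congrFun (congrFun h i) U)
  refine Flag.eq_of_locally fun t ↦ ?_
  obtain ⟨T', g, hg, hF⟩ := exists_common_nbhd (ι := Bool) (t := t)
    (fun b {T'} g ↦ ∃ e : Frame V T', (bif b then F else F').res g = Flag.ofFrame e) (by
      rintro b T'' T' h g ⟨e, he⟩
      exact ⟨e.res h, by rw [Flag.res_comp, he, Flag.ofFrame_res]⟩) (fun b ↦ by
      obtain ⟨T', g, hg, e, he⟩ := Flag.exists_ofFrame (bif b then F else F') t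
      exact ⟨T', g, hg, e, he⟩)
  obtain ⟨U, hU, k, hk⟩ := hg.exists_openIncl
  refine ⟨_, openIncl T U, isNbhd_openIncl T hU, ?_⟩
  obtain ⟨e, he⟩ := hF true
  obtain ⟨e', he'⟩ := hF false
  replace he : F.res (openIncl T U) = Flag.ofFrame (e.res k) := by
    rw [← hk, Flag.res_comp, ← Flag.ofFrame_res]
    exact congrArg _ he
  replace he' : F'.res (openIncl T U) = Flag.ofFrame (e'.res k) := by
    rw [← hk, Flag.res_comp, ← Flag.ofFrame_res]
    exact congrArg _ he'
  obtain ⟨m, hm⟩ := (e.res k).exists_eq_mul (e'.res k)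
  rw [he, he', hm, Flag.ofFrame_eq_ofFrame_mul]
  refine isUpper_of_forall_preserves fun i ↦ preserves_iff.mpr fun a b ha hb ↦ ?_
  have h1 : (e'.res k).vec b ∈ (F'.res (openIncl T U)).sub i (𝟙 _) := by
    rw [he', Flag.mem_ofFrame]
    intro j hj
    rw [Frame.res_id, Frame.coord_vec, Pi.single_eq_of_ne]
    rintro rfl
    omega
  have h2 : (e'.res k).vec b ∈ (F.res (openIncl T U)).sub i (𝟙 _) := by
    change _ ∈ F.sub i (𝟙 _ ≫ openIncl T U)
    rw [Category.id_comp, h, ← Category.id_comp (openIncl T U)]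
    exact h1
  rw [he, Flag.mem_ofFrame] at h2
  have h3 := h2 a ha
  rwa [Frame.res_id, hm, Frame.mul_vec, Frame.coord_equiv] at h3

instance (T : (Over S)ᵒᵖ) : Small.{u} ((flagBundle V).obj T) := small_flag T.unop

/-- The flag `F` is opposite to the flag of the last members of the frame `d`. -/
def InBigCell {T : Over S} (d : Frame V T) (F : Flag V T) : Prop :=
  ∃ L : GL (Fin n) Γ(T.left, ⊤), IsLowerUnipotent L.val ∧ F = Flag.ofFrame (d.mul L)

theorem InBigCell.res {T T' : Over S} {d : Frame V T} {F : Flag V T} (h : InBigCell d F)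
    (g : T' ⟶ T) : InBigCell (d.res g) (F.res g) := by
  obtain ⟨L, hL, rfl⟩ := h
  exact ⟨resGL g L, hL.map _, by rw [Flag.ofFrame_res, Frame.mul_res]⟩

/-- LU factorization: leading minors are multiplied by units when the matrix is multiplied by an
invertible upper triangular one, so the criterion depends on the flag only. -/
theorem inBigCell_iff {T : Over S} {d : Frame V T} {m : GL (Fin n) Γ(T.left, ⊤)} :
    InBigCell d (Flag.ofFrame (d.mul m)) ↔ ∀ j : Fin (n + 1), IsUnit (leading m.val j.is_le).det := by
  constructor
  · rintro ⟨L, hL, h⟩ j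
    have hu := Flag.ofFrame_mul_eq_iff.mp h.symm
    have h1 : m = L * (L⁻¹ * m) := by rw [mul_inv_cancel_left]
    rw [h1, Units.val_mul, leading_mul_of_isUpper _ hu, det_mul, hL.det_leading, one_mul]
    exact hu.isUnit_det_leading _
  · intro h
    obtain ⟨u, hu, hL⟩ := exists_isLowerUnipotent_mul m.val fun {j} hj ↦
      h ⟨j, Nat.lt_succ_of_le hj⟩
    exact ⟨m * u, hL, (Flag.ofFrame_mul_mul hu).symm⟩

theorem eq_of_isLowerUnipotent {T : Over S} {d : Frame V T} {L L' : GL (Fin n) Γ(T.left, ⊤)}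
    (hL : IsLowerUnipotent L.val) (hL' : IsLowerUnipotent L'.val)
    (h : Flag.ofFrame (d.mul L) = Flag.ofFrame (d.mul L')) : L = L' :=
  Units.ext (hL.eq_of_mul_isUpper hL' (Flag.ofFrame_mul_eq_iff.mp h)
    (by rw [← Units.val_mul, mul_inv_cancel_left]))

theorem exists_ofFrame_mul {T : Over S} (d : Frame V T) (F : Flag V T) (t : T.left) :
    ∃ (T' : Over S) (g : T' ⟶ T), IsNbhd g t ∧ ∃ m : GL (Fin n) Γ(T'.left, ⊤),
      F.res g = Flag.ofFrame ((d.res g).mul m) := by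
  obtain ⟨T', g, hg, e, he⟩ := F.exists_ofFrame t
  obtain ⟨m, rfl⟩ := (d.res g).exists_eq_mul e
  exact ⟨T', g, hg, m, he⟩

theorem exists_nbhd_isUnit {ι : Type*} [Finite ι] {T : Over S} {t : T.left} (f : ι → Γ(T.left, ⊤))
    (h : ∀ i, t ∈ T.left.basicOpen (f i)) :
    ∃ (T' : Over S) (g : T' ⟶ T), IsNbhd g t ∧ ∀ i, IsUnit (resHom g (f i)) :=
  exists_common_nbhd (fun i _ g ↦ IsUnit (resHom g (f i)))
    (fun i _ _ h g hg ↦ by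
      rw [resHom_comp]
      exact hg.map (resHom h)) fun i ↦ exists_isUnit_nbhd (h i)

/-- The big cells are open. -/
theorem InBigCell.exists_nbhd {T X : Over S} {d : Frame V T} {F : Flag V T} {g : X ⟶ T}
    (h : InBigCell (d.res g) (F.res g)) (x : X.left) :
    ∃ (T' : Over S) (k : T' ⟶ T), IsNbhd k (g.left x) ∧ InBigCell (d.res k) (F.res k) := by
  obtain ⟨T₁, g₁, hg₁, m, hm⟩ := exists_ofFrame_mul d F (g.left x)
  obtain ⟨y, hy⟩ := hg₁.mem_range
  obtain ⟨X', g', f', hg', hf'⟩ := hg₁.exists_pullback g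
  obtain ⟨x', rfl⟩ := hg'.mem_range
  have h1 := h.res g'
  rw [← Flag.res_comp, ← Frame.res_comp, ← hf', Flag.res_comp, hm, Frame.res_comp,
    Flag.ofFrame_res, Frame.mul_res, inBigCell_iff] at h1
  have hy' : f'.left x' = y := by
    have := hg₁.isOpenImmersion
    refine g₁.left.isOpenEmbedding.injective ?_
    rw [hy]
    have := congrArg (fun f : X' ⟶ T ↦ f.left x') hf'
    simpa using this
  obtain ⟨T', k, hk, hu⟩ := exists_nbhd_isUnit (T := T₁) (t := y)
    (fun j : Fin (n + 1) ↦ (leading m.val j.is_le).det) (fun j ↦ by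
      rw [← hy']
      refine mem_basicOpen_of_isUnit f' ?_ x'
      rw [← det_leading_map]
      exact h1 j)
  refine ⟨T', k ≫ g₁, hk.comp hg₁ hy, ?_⟩
  rw [Flag.res_comp, hm, Frame.res_comp, Flag.ofFrame_res, Frame.mul_res, inBigCell_iff]
  intro j
  rw [resGL_val, det_leading_map]
  exact hu j

/-- The value of a function at a point. -/
noncomputable def valueAt {X : Scheme.{u}} (t : X) :
    Γ(X, ⊤) →+* IsLocalRing.ResidueField (X.presheaf.stalk t) :=
  (IsLocalRing.residue _).comp (X.presheaf.germ ⊤ t trivial).hom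

theorem mem_basicOpen_iff_valueAt {X : Scheme.{u}} {t : X} {f : Γ(X, ⊤)} :
    t ∈ X.basicOpen f ↔ valueAt t f ≠ 0 := by
  rw [Scheme.mem_basicOpen X f t trivial]
  exact (IsLocalRing.residue_ne_zero_iff_isUnit _).symm

theorem inBigCell_res_mul_permGL_iff {T T' : Over S} {d : Frame V T}
    {m : GL (Fin n) Γ(T.left, ⊤)} {k : T' ⟶ T} {w : Equiv.Perm (Fin n)} :
    InBigCell ((d.mul (permGL _ w)).res k) ((Flag.ofFrame (d.mul m)).res k) ↔
      ∀ j : Fin (n + 1), IsUnit (resHom k (leading ((permGL _ w)⁻¹ * m).val j.is_le).det) := by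
  have h : d.mul m = (d.mul (permGL _ w)).mul ((permGL _ w)⁻¹ * m) := by
    rw [Frame.mul_mul, mul_inv_cancel_left]
  rw [h, Flag.ofFrame_res, Frame.mul_res k (d.mul _), inBigCell_iff]
  simp only [resGL_val, det_leading_map]

/-- The big cells of the permutations of a frame cover the flag bundle. -/
theorem exists_inBigCell {T : Over S} (d : Frame V T) (F : Flag V T) (t : T.left) :
    ∃ (T' : Over S) (k : T' ⟶ T), IsNbhd k t ∧ ∃ w : Equiv.Perm (Fin n),
      InBigCell ((d.mul (permGL _ w)).res k) (F.res k) := by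
  obtain ⟨T₁, g₁, hg₁, m, hm⟩ := exists_ofFrame_mul d F t
  obtain ⟨y, hy⟩ := hg₁.mem_range
  obtain ⟨w, hw⟩ := exists_perm_leading_ne_zero (valueAt y) m
  have h := exists_nbhd_isUnit _ fun j ↦ mem_basicOpen_iff_valueAt.mpr (hw j)
  obtain ⟨T', k, hk, hu⟩ := h
  have h1 := inBigCell_res_mul_permGL_iff (d := d.res g₁).mpr hu
  rw [← hm, ← Flag.res_comp, ← resGL_permGL g₁, ← Frame.mul_res, ← Frame.res_comp] at h1
  exact ⟨T', k ≫ g₁, hk.comp hg₁ hy, w, h1⟩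

end

end RelFlag

/-! ### Gluing along neighbourhoods, open loci, and the affine space of a big cell -/

namespace RelFlag

section

variable {S : Scheme.{u}}

/-- The open cover given by a family of neighbourhoods of all points. -/
def coverOfNbhds {X : Scheme.{u}} (N : X → Scheme.{u}) (j : ∀ x, N x ⟶ X)
    (hj : ∀ x, IsOpenImmersion (j x)) (hx : ∀ x, x ∈ Set.range (j x)) : X.OpenCover where
  I₀ := X
  X := N
  f := j
  mem₀ := by
    rw [Scheme.presieve₀_mem_precoverage_iff]
    exact ⟨fun t ↦ ⟨t, hx t⟩, hj⟩

theorem of_nbhds {P : MorphismProperty Scheme.{u}} [IsZariskiLocalAtSource P] {X Y : Scheme.{u}}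
    (f : X ⟶ Y) (H : ∀ x : X, ∃ (N : Scheme.{u}) (j : N ⟶ X), IsOpenImmersion j ∧
      x ∈ Set.range j ∧ P (j ≫ f)) : P f := by
  choose N j hj hx hP using H
  exact (IsZariskiLocalAtSource.iff_of_openCover (P := P) (coverOfNbhds N j hj hx)).mpr hP

section

variable {G : (Over S)ᵒᵖ ⥤ Type*}

theorem IsZariskiSheaf.eq_of_nbhds (hG : IsZariskiSheaf G) {T : Over S} {x y : G.obj (op T)}
    (H : ∀ t : T.left, ∃ (T' : Over S) (g : T' ⟶ T), IsNbhd g t ∧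
      G.map g.op x = G.map g.op y) : x = y := by
  choose T' g hg h using H
  obtain ⟨z, -, hz⟩ := hG T (ULift.{u + 1} T.left) (fun t ↦ T' t.down) (fun t ↦ g t.down)
    (fun t ↦ (hg t.down).isOpenImmersion) (fun t ↦ ⟨⟨t⟩, (hg t).mem_range⟩)
    (fun t ↦ G.map (g t.down).op x) (fun k l W a b e ↦ by
      rw [← map_comp_apply', e, map_comp_apply'])
  exact (hz x fun _ ↦ rfl).trans (hz y fun t ↦ (h t.down).symm).symm

variable {Y : Over S} {y : G.obj (op Y)}
  (mono : ∀ (T : Over S) (a b : T ⟶ Y), G.map a.op y = G.map b.op y → a = b)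
include mono

/-- The chart is a monomorphism of functors, so the local lifts agree on overlaps and glue. -/
theorem IsZariskiSheaf.exists_hom_of_nbhds (hG : IsZariskiSheaf G) {T : Over S}
    (x : G.obj (op T)) (H : ∀ t : T.left, ∃ (T' : Over S) (g : T' ⟶ T), IsNbhd g t ∧
      ∃ a : T' ⟶ Y, G.map a.op y = G.map g.op x) : ∃ a : T ⟶ Y, G.map a.op y = x := by
  choose T' g hg a ha using H
  let 𝓤 := coverOfNbhds (fun t ↦ (T' t).left) (fun t ↦ (g t).left)
    (fun t ↦ (hg t).isOpenImmersion) (fun t ↦ (hg t).mem_range)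
  have hc (k l : T.left) : Limits.pullback.fst (g k).left (g l).left ≫ (a k).left =
      Limits.pullback.snd (g k).left (g l).left ≫ (a l).left := by
    let p : Over.mk (Limits.pullback.fst (g k).left (g l).left ≫ (T' k).hom) ⟶ T' k :=
      Over.homMk (Limits.pullback.fst (g k).left (g l).left)
    let q : Over.mk (Limits.pullback.fst (g k).left (g l).left ≫ (T' k).hom) ⟶ T' l :=
      Over.homMk (Limits.pullback.snd (g k).left (g l).left) (by
        rw [← Over.w (g l), ← Limits.pullback.condition_assoc, Over.w (g k)]
        rfl)
    have hpq : p ≫ g k = q ≫ g l := by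
      ext1
      exact Limits.pullback.condition
    have := mono _ (p ≫ a k) (q ≫ a l) (by
      rw [map_comp_apply', map_comp_apply', ha, ha, ← map_comp_apply', ← map_comp_apply', hpq])
    exact congrArg CommaMorphism.left this
  let b : T.left ⟶ Y.left := 𝓤.glueMorphisms (fun t ↦ (a t).left) hc
  have hb (t : T.left) : (g t).left ≫ b = (a t).left := 𝓤.ι_glueMorphisms _ _ t
  have hw' (t : T.left) : (g t).left ≫ b ≫ Y.hom = (g t).left ≫ T.hom := by
    rw [← Category.assoc, hb, Over.w, Over.w]
  have hw : b ≫ Y.hom = T.hom := 𝓤.hom_ext _ _ hw'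
  refine ⟨Over.homMk b hw, hG.eq_of_nbhds fun t ↦ ⟨T' t, g t, hg t, ?_⟩⟩
  have : g t ≫ Over.homMk b hw = a t := by
    ext1
    exact hb t
  rw [← map_comp_apply', this, ha]

theorem IsZariskiSheaf.exists_openLocus (hG : IsZariskiSheaf G)
    (hopen : ∀ (T X : Over S) (x : G.obj (op T)) (g : X ⟶ T) (a : X ⟶ Y),
      G.map a.op y = G.map g.op x → ∀ t : X.left, ∃ (T' : Over S) (k : T' ⟶ T),
        IsNbhd k (g.left t) ∧ ∃ a : T' ⟶ Y, G.map a.op y = G.map k.op x)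
    (T : Over S) (x : G.obj (op T)) : ∃ U : T.left.Opens,
      ∀ (T' : Over S) (g : T' ⟶ T), (∃ a : T' ⟶ Y, G.map a.op y = G.map g.op x) ↔
        ∀ t, g.left t ∈ U := by
  refine ⟨⟨{t | ∃ (T' : Over S) (k : T' ⟶ T), IsNbhd k t ∧
    ∃ a : T' ⟶ Y, G.map a.op y = G.map k.op x}, ?_⟩, fun T' g ↦ ⟨?_, ?_⟩⟩
  · refine isOpen_iff_forall_mem_open.mpr fun t ⟨T', k, hk, a, ha⟩ ↦ ?_
    have := hk.isOpenImmersion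
    refine ⟨Set.range k.left, fun t' ht' ↦ ⟨T', k, ⟨this, ht'⟩, a, ha⟩,
      k.left.isOpenEmbedding.isOpen_range, hk.mem_range⟩
  · rintro ⟨a, ha⟩ t
    exact hopen T T' x g a ha t
  · intro h
    refine hG.exists_hom_of_nbhds mono _ fun t ↦ ?_
    obtain ⟨T₁, k, hk, a, ha⟩ := h t
    obtain ⟨T₂, g', f', hg', hf⟩ := hk.exists_pullback g
    refine ⟨T₂, g', hg', f' ≫ a, ?_⟩
    rw [map_comp_apply', ha, ← map_comp_apply', ← map_comp_apply', hf]

end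

/-- Both `Y` and the open locus `U` in `Z` represent the same subfunctor of `Z`, so `j` is an
isomorphism onto `U` followed by the inclusion. -/
theorem isOpenImmersion_of_openLocus {G : (Over S)ᵒᵖ ⥤ Type*} {Y : Over S} {y : G.obj (op Y)}
    (mono : ∀ (T : Over S) (a b : T ⟶ Y), G.map a.op y = G.map b.op y → a = b)
    {Z : Over S} {z : G.obj (op Z)}
    (monoZ : ∀ (T : Over S) (a b : T ⟶ Z), G.map a.op z = G.map b.op z → a = b)
    (j : Y ⟶ Z) (hj : G.map j.op z = y)
    (hU : ∃ U : Z.left.Opens,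
      ∀ (T' : Over S) (g : T' ⟶ Z), (∃ a : T' ⟶ Y, G.map a.op y = G.map g.op z) ↔
        ∀ t, g.left t ∈ U) : IsOpenImmersion j.left := by
  obtain ⟨U, hU⟩ := hU
  obtain ⟨a, ha⟩ := (hU _ (openIncl Z U)).mpr fun t ↦ t.2
  have h1 : a ≫ j = openIncl Z U := monoZ _ _ _ (by rw [map_comp_apply', hj, ha])
  have h2 := (hU _ j).mp ⟨𝟙 Y, by rw [hj, op_id, G.map_id]; rfl⟩
  have hr : Set.range j.left ⊆ Set.range U.ι := by
    rintro _ ⟨t, rfl⟩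
    simpa using h2 t
  let b : Y ⟶ openOver Z U := Over.homMk (IsOpenImmersion.lift U.ι j.left hr) (by
    change _ ≫ U.ι ≫ _ = _
    rw [IsOpenImmersion.lift_fac_assoc, Over.w])
  have h3 : b ≫ openIncl Z U = j := by
    ext1
    exact IsOpenImmersion.lift_fac _ _ _
  have h4 : b ≫ a = 𝟙 Y := mono _ _ _ (by
    rw [map_comp_apply', ha, ← map_comp_apply', h3, hj, op_id, G.map_id]
    rfl)
  have h5 : a ≫ b = 𝟙 _ := by
    have : Mono (openIncl Z U).left := inferInstanceAs (Mono U.ι)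
    have : Mono (openIncl Z U) := Over.mono_of_mono_left _
    rw [← cancel_mono (openIncl Z U), Category.assoc, h3, h1, Category.id_comp]
  have : IsIso b := ⟨a, h4, h5⟩
  have : IsIso b.left := inferInstanceAs (IsIso ((Over.forget S).map b))
  rw [← h3]
  have : IsOpenImmersion (openIncl Z U).left := inferInstanceAs (IsOpenImmersion U.ι)
  exact inferInstanceAs (IsOpenImmersion (b.left ≫ (openIncl Z U).left))

end

section

variable {n : ℕ}

/-- The positions below the diagonal. -/
abbrev BelowDiagonal (n : ℕ) : Type u := ULift.{u} {p : Fin n × Fin n // p.2 < p.1}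

/-- The lower unipotent matrix with given entries below the diagonal. -/
def lowerMatrix {R : Type*} [CommRing R] (c : BelowDiagonal.{u} n → R) : Matrix (Fin n) (Fin n) R :=
  Matrix.of fun a b ↦ if h : b < a then c ⟨⟨(a, b), h⟩⟩ else if a = b then 1 else 0

theorem isLowerUnipotent_lowerMatrix {R : Type*} [CommRing R] (c : BelowDiagonal.{u} n → R) :
    IsLowerUnipotent (lowerMatrix c) :=
  ⟨fun a ↦ by simp [lowerMatrix], fun a b h ↦ by simp [lowerMatrix, h.not_gt, h.ne]⟩

theorem lowerMatrix_apply {R : Type*} [CommRing R] (c : BelowDiagonal.{u} n → R)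
    (p : BelowDiagonal.{u} n) : lowerMatrix c p.down.1.1 p.down.1.2 = c p := by
  simp [lowerMatrix, p.down.2]

theorem lowerMatrix_map {R R' : Type*} [CommRing R] [CommRing R'] (f : R →+* R')
    (c : BelowDiagonal.{u} n → R) : (lowerMatrix c).map f = lowerMatrix fun p ↦ f (c p) := by
  ext a b
  simp only [lowerMatrix, Matrix.map_apply, Matrix.of_apply]
  split_ifs <;> simp

theorem IsLowerUnipotent.eq_lowerMatrix {R : Type*} [CommRing R] {L : Matrix (Fin n) (Fin n) R}
    (h : IsLowerUnipotent L) :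
    L = lowerMatrix fun p : BelowDiagonal.{u} n ↦ L p.down.1.1 p.down.1.2 := by
  ext a b
  simp only [lowerMatrix, Matrix.of_apply]
  split_ifs with h1 h2
  · rfl
  · rw [h2, h.1]
  · exact h.2 a b (by omega)

noncomputable def lowerGL {R : Type*} [CommRing R] (c : BelowDiagonal.{u} n → R) :
    Matrix.GeneralLinearGroup (Fin n) R :=
  toGL (lowerMatrix c) (by rw [(isLowerUnipotent_lowerMatrix c).det]; exact isUnit_one)

theorem lowerGL_val {R : Type*} [CommRing R] (c : BelowDiagonal.{u} n → R) :
    (lowerGL c).val = lowerMatrix c := toGL_val _ _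

variable {S : Scheme.{u}}

/-- The space of lower unipotent matrices over an `S`-scheme. -/
noncomputable def cellSpace (U : Over S) (n : ℕ) : Over S :=
  Over.mk (𝔸(BelowDiagonal.{u} n; U.left) ↘ U.left ≫ U.hom)

noncomputable def cellSpaceToBase (U : Over S) (n : ℕ) : cellSpace U n ⟶ U :=
  Over.homMk (𝔸(BelowDiagonal.{u} n; U.left) ↘ U.left)

/-- The coordinates of the space of lower unipotent matrices. -/
noncomputable def cellCoord (U : Over S) (n : ℕ) :
    BelowDiagonal.{u} n → Γ((cellSpace U n).left, ⊤) :=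
  AffineSpace.coord U.left

/-- The universal lower unipotent matrix. -/
noncomputable def cellMatrix (U : Over S) (n : ℕ) :
    Matrix.GeneralLinearGroup (Fin n) Γ((cellSpace U n).left, ⊤) :=
  lowerGL (cellCoord U n)

theorem cellMatrix_val (U : Over S) (n : ℕ) :
    (cellMatrix U n).val = lowerMatrix (cellCoord U n) :=
  lowerGL_val _

theorem isLowerUnipotent_cellMatrix (U : Over S) (n : ℕ) :
    IsLowerUnipotent (cellMatrix U n).val := by
  rw [cellMatrix_val]
  exact isLowerUnipotent_lowerMatrix _

theorem cellSpace_exists_hom {U T : Over S} (f : T ⟶ U)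
    {L : Matrix.GeneralLinearGroup (Fin n) Γ(T.left, ⊤)} (hL : IsLowerUnipotent L.val) :
    ∃ a : T ⟶ cellSpace U n, a ≫ cellSpaceToBase U n = f ∧ resGL a (cellMatrix U n) = L := by
  let b : T.left ⟶ 𝔸(BelowDiagonal.{u} n; U.left) :=
    AffineSpace.homOfVector f.left fun p ↦ L.val p.down.1.1 p.down.1.2
  have hb : b ≫ 𝔸(BelowDiagonal.{u} n; U.left) ↘ U.left = f.left :=
    AffineSpace.homOfVector_over _ _
  refine ⟨Over.homMk b ?_, ?_, ?_⟩
  · change b ≫ _ ≫ _ = _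
    rw [reassoc_of% hb, Over.w]
  · ext1
    exact hb
  · apply Units.ext
    rw [resGL_val, cellMatrix_val, lowerMatrix_map, hL.eq_lowerMatrix]
    congr 1
    funext p
    exact AffineSpace.homOfVector_appTop_coord _ _ _

theorem cellSpace_hom_ext {U T : Over S} {a b : T ⟶ cellSpace U n}
    (h : a ≫ cellSpaceToBase U n = b ≫ cellSpaceToBase U n)
    (h' : resGL a (cellMatrix U n) = resGL b (cellMatrix U n)) : a = b := by
  ext1
  refine AffineSpace.hom_ext (congrArg CommaMorphism.left h) fun p ↦ ?_
  have := congrArg (fun L ↦ L.val p.down.1.1 p.down.1.2) h'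
  simp only [resGL_val, cellMatrix_val, lowerMatrix_map, lowerMatrix_apply] at this
  exact this

variable {V : VectorBundle S n}

/-- The universal flag of a big cell. -/
noncomputable def cellFlag {U : Over S} (e : Frame V U) : Flag V (cellSpace U n) :=
  Flag.ofFrame ((e.res (cellSpaceToBase U n)).mul (cellMatrix U n))

/-- The points of the affine space are the flags in the big cell of `e`; a map to `U` is part of the
data, and it is unique when `U` is an open subscheme of S. -/
theorem exists_cellFlag_res_iff {U T : Over S} {e : Frame V U} {F : Flag V T} :
    (∃ a : T ⟶ cellSpace U n, (cellFlag e).res a = F) ↔ ∃ f : T ⟶ U, InBigCell (e.res f) F := by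
  constructor
  · rintro ⟨a, rfl⟩
    refine ⟨a ≫ cellSpaceToBase U n, ?_⟩
    rw [Frame.res_comp]
    exact InBigCell.res ⟨_, isLowerUnipotent_cellMatrix U n, rfl⟩ a
  · rintro ⟨f, L, hL, rfl⟩
    obtain ⟨a, rfl, rfl⟩ := cellSpace_exists_hom f hL
    refine ⟨a, ?_⟩
    rw [cellFlag, Flag.ofFrame_res, Frame.mul_res, Frame.res_comp]

theorem cellFlag_mono {U T : Over S} {e : Frame V U} (hU : ∀ f g : T ⟶ U, f = g)
    {a b : T ⟶ cellSpace U n} (h : (cellFlag e).res a = (cellFlag e).res b) : a = b := by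
  have h1 : a ≫ cellSpaceToBase U n = b ≫ cellSpaceToBase U n := hU _ _
  refine cellSpace_hom_ext h1 ?_
  rw [cellFlag, Flag.ofFrame_res, Flag.ofFrame_res, Frame.mul_res, Frame.mul_res,
    ← Frame.res_comp, ← Frame.res_comp, h1] at h
  exact eq_of_isLowerUnipotent ((isLowerUnipotent_cellMatrix U n).map _)
    ((isLowerUnipotent_cellMatrix U n).map _) h

end

end RelFlag

/-! ### The flag bundle as a scheme of finite type -/

namespace RelFlag

open Matrix

section

variable {S : Scheme.{u}} {n : ℕ} {V : VectorBundle S n}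

theorem over_ι_hom_ext {U : S.Opens} {T : Over S} (f g : T ⟶ Over.mk U.ι) : f = g := by
  ext1
  have hf : f.left ≫ U.ι = T.hom := Over.w f
  have hg : g.left ≫ U.ι = T.hom := Over.w g
  rw [← cancel_mono U.ι, hf, hg]

/-- The open subscheme of `T` over an open subscheme of the base. -/
abbrev restrictBase (T : Over S) (U : S.Opens) : Over S := openOver T (T.hom ⁻¹ᵁ U)

noncomputable def restrictBaseHom (T : Over S) (U : S.Opens) : restrictBase T U ⟶ Over.mk U.ι :=
  Over.homMk (T.hom ∣_ U) (by simp)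

theorem VectorBundle.exists_frame (V : VectorBundle S n) (s : S) :
    ∃ U : S.Opens, s ∈ U ∧ IsAffineOpen U ∧ Nonempty (Frame V (Over.mk U.ι)) := by
  obtain ⟨U, hU, e, he⟩ := V.locally_trivial s
  obtain ⟨W, hW, hsW, hWU⟩ : ∃ W : S.Opens, IsAffineOpen W ∧ s ∈ W ∧ W ≤ U := by
    obtain ⟨_, ⟨W, hW, rfl⟩, hyW, hWU⟩ :=
      S.isBasis_affineOpens.exists_subset_of_mem_open hU U.2
    exact ⟨W, hW, hyW, hWU⟩
  let d : Frame V (Over.mk U.ι) := ⟨e, fun g x ↦ he g x⟩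
  exact ⟨W, hsW, hW, ⟨d.res (Over.homMk (S.homOfLE hWU) (by simp) : Over.mk W.ι ⟶ Over.mk U.ι)⟩⟩

theorem exists_cellFlag_res {T : Over S} (F : Flag V T) (t : T.left) {U : S.Opens}
    (e : Frame V (Over.mk U.ι)) (ht : T.hom t ∈ U) :
    ∃ (T' : Over S) (g : T' ⟶ T), IsNbhd g t ∧ ∃ (w : Equiv.Perm (Fin n))
      (a : T' ⟶ cellSpace (Over.mk U.ι) n), (cellFlag (e.mul (permGL _ w))).res a = F.res g := by
  have h1 : IsNbhd (openIncl T (T.hom ⁻¹ᵁ U)) t := isNbhd_openIncl T ht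
  obtain ⟨x, hx⟩ := h1.mem_range
  obtain ⟨T', k, hk, w, hw⟩ := exists_inBigCell (e.res (restrictBaseHom T U))
    (F.res (openIncl T (T.hom ⁻¹ᵁ U))) x
  refine ⟨T', k ≫ openIncl T _, hk.comp h1 hx, w, exists_cellFlag_res_iff.mpr
    ⟨k ≫ restrictBaseHom T U, ?_⟩⟩
  rw [Frame.mul_res, resGL_permGL, ← Frame.res_comp, ← Flag.res_comp] at hw
  rw [Frame.mul_res, resGL_permGL]
  exact hw

theorem exists_cellFlag_res_nbhd {T X : Over S} (F : Flag V T) (g : X ⟶ T) {U : S.Opens}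
    (e : Frame V (Over.mk U.ι)) (a : X ⟶ cellSpace (Over.mk U.ι) n)
    (ha : (cellFlag e).res a = F.res g) (x : X.left) :
    ∃ (T' : Over S) (k : T' ⟶ T), IsNbhd k (g.left x) ∧
      ∃ a : T' ⟶ cellSpace (Over.mk U.ι) n, (cellFlag e).res a = F.res k := by
  obtain ⟨f, hf⟩ := exists_cellFlag_res_iff.mp ⟨a, ha⟩
  have hx : T.hom (g.left x) ∈ U := by
    have h1 : g.left ≫ T.hom = f.left ≫ U.ι := (Over.w g).trans (Over.w f).symm
    have h2 := congrArg (fun h : X.left ⟶ S ↦ h x) h1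
    simp only [Scheme.Hom.comp_apply] at h2
    rw [h2]
    exact (f.left x).2
  have h1 : IsNbhd (openIncl T (T.hom ⁻¹ᵁ U)) (g.left x) := isNbhd_openIncl T hx
  obtain ⟨X', g', f', hg', hf'⟩ := h1.exists_pullback g
  obtain ⟨x', rfl⟩ := hg'.mem_range
  have h2 : InBigCell ((e.res (restrictBaseHom T U)).res f')
      ((F.res (openIncl T (T.hom ⁻¹ᵁ U))).res f') := by
    have := hf.res g'
    rwa [← Frame.res_comp, ← Flag.res_comp, ← hf', over_ι_hom_ext (g' ≫ f)
      (f' ≫ restrictBaseHom T U), Frame.res_comp, Flag.res_comp] at this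
  obtain ⟨T', k, hk, hc⟩ := h2.exists_nbhd x'
  rw [← Frame.res_comp, ← Flag.res_comp] at hc
  refine ⟨T', k ≫ openIncl T _, hk.comp h1 ?_, exists_cellFlag_res_iff.mpr ⟨_, hc⟩⟩
  have := congrArg (fun h : X' ⟶ T ↦ h.left x') hf'
  simpa using this

/-- `F` is a universal flag. -/
def Flag.IsUniversal {Z : Over S} (F : Flag V Z) : Prop :=
  ∀ (T : Over S) (F' : Flag V T), ∃! h : T ⟶ Z, F.res h = F'

theorem Flag.IsUniversal.mono {Z : Over S} {F : Flag V Z} (hF : F.IsUniversal) (T : Over S)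
    (a b : T ⟶ Z) (h : F.res a = F.res b) : a = b :=
  (hF T (F.res b)).unique h rfl

/-- The charts are the big cells of all frames of `V` over all opens of S. The index set includes
the permuted frames, which are needed for the charts to cover. -/
theorem exists_isUniversal (V : VectorBundle S n) : ∃ (Z : Over S) (F : Flag V Z),
    F.IsUniversal := by
  have key : ∃ Z : Over S, Nonempty ((flagBundle V).RepresentableBy Z) := by
    refine exists_representableBy_of_charts (isZariskiSheaf_flagBundle V)
      (ι := Σ U : S.Opens, Frame V (Over.mk U.ι)) (fun i ↦ cellSpace (Over.mk i.1.ι) n)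
      (fun i ↦ cellFlag i.2) (fun i T a b h ↦ cellFlag_mono over_ι_hom_ext h)
      (fun i ↦ (isZariskiSheaf_flagBundle V).exists_openLocus
        (fun _ _ _ h ↦ cellFlag_mono over_ι_hom_ext h) fun _ _ F g a ha t ↦
          exists_cellFlag_res_nbhd F g i.2 a ha t) fun T F t ↦ ?_
    obtain ⟨U, hU, -, ⟨e⟩⟩ := V.exists_frame (T.hom t)
    obtain ⟨T', g, hg, w, h⟩ := exists_cellFlag_res F t e hU
    exact ⟨T', g, hg, ⟨U, e.mul (permGL _ w)⟩, h⟩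
  obtain ⟨Z, hZ⟩ := key
  obtain ⟨F, hF⟩ := nonempty_representableBy_iff.mp hZ
  exact ⟨Z, F, hF⟩

namespace Flag.IsUniversal

variable {Z : Over S} {F : Flag V Z} (hF : F.IsUniversal)
include hF

theorem exists_chart (z : Z.left) {U : S.Opens} (e : Frame V (Over.mk U.ι))
    (hz : Z.hom z ∈ U) : ∃ (w : Equiv.Perm (Fin n)) (c : cellSpace (Over.mk U.ι) n ⟶ Z),
      F.res c = cellFlag (e.mul (permGL _ w)) ∧ z ∈ Set.range c.left := by
  obtain ⟨T', g, hg, w, a, h⟩ := exists_cellFlag_res F z e hz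
  obtain ⟨c, hc, -⟩ := hF _ (cellFlag (e.mul (permGL _ w)))
  refine ⟨w, c, hc, ?_⟩
  obtain ⟨x, rfl⟩ := hg.mem_range
  have : a ≫ c = g := hF.mono _ _ _ (by rw [Flag.res_comp, hc, h])
  exact ⟨a.left x, by rw [← this]; rfl⟩

theorem isOpenImmersion_chart {U : S.Opens} {e : Frame V (Over.mk U.ι)}
    {c : cellSpace (Over.mk U.ι) n ⟶ Z} (hc : F.res c = cellFlag e) :
    IsOpenImmersion c.left :=
  isOpenImmersion_of_openLocus (G := flagBundle V) (y := cellFlag e)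
    (fun _ _ _ h ↦ cellFlag_mono over_ι_hom_ext h) (z := F) hF.mono c hc
    ((isZariskiSheaf_flagBundle V).exists_openLocus
        (fun _ _ _ h ↦ cellFlag_mono over_ι_hom_ext h) (fun _ _ F g a ha t ↦
          exists_cellFlag_res_nbhd F g e a ha t) Z F)

theorem locallyOfFiniteType : LocallyOfFiniteType Z.hom := by
  have : IsZariskiLocalAtSource @LocallyOfFiniteType.{u} := by
    have h : HasRingHomProperty @LocallyOfFiniteType.{u} RingHom.FiniteType := inferInstance
    exact @HasRingHomProperty.instIsZariskiLocalAtSource _ _ h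
  refine of_nbhds (P := @LocallyOfFiniteType) Z.hom fun z ↦ ?_
  obtain ⟨U, hU, -, ⟨e⟩⟩ := V.exists_frame (Z.hom z)
  obtain ⟨w, c, hc, hz⟩ := hF.exists_chart z e hU
  refine ⟨_, c.left, hF.isOpenImmersion_chart hc, hz, ?_⟩
  rw [Over.w]
  have : LocallyOfFiniteType (𝔸(BelowDiagonal.{u} n; (U : Scheme.{u})) ↘ (U : Scheme.{u})) := inferInstance
  exact inferInstanceAs (LocallyOfFiniteType ((𝔸(BelowDiagonal.{u} n; (U : Scheme.{u})) ↘ (U : Scheme.{u})) ≫ U.ι))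

/-- Finitely many affine opens with a frame cover S, and over each of them the cells of the finitely
many permutations suffice. -/
theorem compactSpace [CompactSpace S] : CompactSpace Z.left := by
  choose U hU hUa e using V.exists_frame
  obtain ⟨s, hs⟩ := isCompact_univ.elim_finite_subcover (fun y ↦ (U y : Set S))
    (fun y ↦ (U y).2) (fun y _ ↦ Set.mem_iUnion.mpr ⟨y, hU y⟩)
  choose c hc using fun (l : S) (w : Equiv.Perm (Fin n)) ↦
    (hF _ (cellFlag ((e l).some.mul (permGL _ w)))).exists
  have hcomp (l : S) : CompactSpace (cellSpace (Over.mk (U l).ι) n).left := by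
    have : IsAffine (U l) := hUa l
    exact inferInstanceAs (CompactSpace 𝔸(BelowDiagonal.{u} n; (U l)))
  have key : (Set.univ : Set Z.left) =
      ⋃ x : s × Equiv.Perm (Fin n), Set.range (c x.1 x.2).left := by
    refine (Set.eq_univ_of_forall fun z ↦ ?_).symm
    have := hs (Set.mem_univ (Z.hom z))
    simp only [Set.mem_iUnion] at this
    obtain ⟨l, hl, h⟩ := this
    obtain ⟨w, c', hc', hz⟩ := hF.exists_chart z (e l).some h
    refine Set.mem_iUnion.mpr ⟨⟨⟨l, hl⟩, w⟩, ?_⟩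
    rwa [hF.mono _ _ _ ((hc l w).trans hc'.symm)]
  refine ⟨?_⟩
  rw [key]
  exact isCompact_iUnion fun x ↦ isCompact_range (c x.1 x.2).left.continuous

end Flag.IsUniversal

end

end RelFlag

/-! ### Iwasawa decomposition and properness of the flag bundle -/

namespace RelFlag

open Matrix

section

variable {R K : Type*} [CommRing R] [IsDomain R] [ValuationRing R] [Field K] [Algebra R K]
  [IsFractionRing R K] {n : ℕ}

theorem isUpper_of_map {A B : Type*} [CommRing A] [CommRing B] {f : A →+* B}
    (hf : Function.Injective f) {m : Matrix (Fin n) (Fin n) A} (h : IsUpper (m.map f)) :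
    IsUpper m := by
  rw [isUpper_iff] at h ⊢
  exact fun a b hab ↦ hf ((h a b hab).trans (map_zero f).symm)

theorem isLowerUnipotent_of_map {A B : Type*} [CommRing A] [CommRing B] {f : A →+* B}
    (hf : Function.Injective f) {m : Matrix (Fin n) (Fin n) A} (h : IsLowerUnipotent (m.map f)) :
    IsLowerUnipotent m :=
  ⟨fun a ↦ hf ((h.1 a).trans (map_one f).symm), fun a b hab ↦
    hf ((h.2 a b hab).trans (map_zero f).symm)⟩

/-- The Iwasawa decomposition: over the fraction field `K` of a valuation ring `R`,
`GL_n(K)` is the product of `GL_n(R)` and the upper triangular matrices. -/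
theorem exists_map_eq_mul_isUpper (m : GL (Fin n) K) : ∃ (m' : GL (Fin n) R) (u : GL (Fin n) K),
    IsUpper u.val ∧ GeneralLinearGroup.map (algebraMap R K) m' = m * u := by
  -- The pivot is an entry of largest valuation, so the other entries of its column are multiples of
  -- it by elements of `R`. Once the pivots are 1, the reduced matrix has entries in `R`; up to a
  -- permutation of rows it is lower unipotent, hence invertible over `R`.
  obtain ⟨w, u, hu, hL, hQ⟩ := exists_normalForm m
    (fun v i ↦ ∀ i', ∃ r : R, v i' = algebraMap R K r * v i) (fun v hv ↦ by
      obtain ⟨i₀, hi₀⟩ := Function.ne_iff.mp hv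
      have : Nonempty (Fin n) := ⟨i₀⟩
      obtain ⟨i, hi⟩ := Finite.exists_max fun i ↦ ValuationRing.valuation R K (v i)
      have h0 : v i ≠ 0 := by
        intro h
        have := hi i₀
        rw [h, map_zero, le_zero_iff, map_eq_zero] at this
        exact hi₀ this
      refine ⟨i, h0, fun i' ↦ ?_⟩
      have h1 : ValuationRing.valuation R K (v i' / v i) ≤ 1 := by
        rw [map_div₀]
        exact div_le_one_of_le₀ (hi i') zero_le
      obtain ⟨r, hr⟩ := (ValuationRing.mem_integer_iff R K _).mp h1
      exact ⟨r, by rw [hr, div_mul_cancel₀ _ h0]⟩) (fun v i c _ h i' ↦ by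
      obtain ⟨r, hr⟩ := h i'
      exact ⟨r, by simp only [Pi.smul_apply, smul_eq_mul, hr]; ring⟩)
  have hone (b : Fin n) : (m.val * u.val) (w b) b = 1 :=
    (permGL_inv_mul_apply (m.val * u.val) w b b).symm.trans (hL.1 b)
  have hx (a b : Fin n) : ∃ r : R, algebraMap R K r = (m.val * u.val) a b := by
    obtain ⟨r, hr⟩ := hQ b a
    exact ⟨r, (hr.trans ((congrArg _ (hone b)).trans (mul_one _))).symm⟩
  choose M hM using hx
  have hM' : ((permGL R w)⁻¹.val * Matrix.of M).map (algebraMap R K) =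
      (permGL K w)⁻¹.val * (m.val * u.val) := by
    ext a b
    rw [map_apply, permGL_inv_mul_apply, permGL_inv_mul_apply, of_apply, hM]
  have hN : IsLowerUnipotent ((permGL R w)⁻¹.val * Matrix.of M) :=
    isLowerUnipotent_of_map (IsFractionRing.injective R K) (by rwa [hM'])
  refine ⟨permGL R w * toGL _ (by rw [hN.det]; exact isUnit_one), u, hu, ?_⟩
  have key : GeneralLinearGroup.map (algebraMap R K) (toGL _ (by rw [hN.det]; exact isUnit_one)) =
      (permGL K w)⁻¹ * (m * u) := Units.ext hM'
  rw [map_mul, permGL_map, key, mul_inv_cancel_left]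

/-- Transport to rings merely isomorphic to `R` and `K`, such as the global sections of their
spectra. -/
theorem exists_map_eq_mul_isUpper' {A B : Type*} [CommRing A] [CommRing B] (f : A →+* B)
    (ψ : A ≃+* R) (φ : B ≃+* K) (h : ∀ a, φ (f a) = algebraMap R K (ψ a)) (m : GL (Fin n) B) :
    ∃ (m' : GL (Fin n) A) (u : GL (Fin n) B), IsUpper u.val ∧
      GeneralLinearGroup.map f m' = m * u := by
  obtain ⟨m', u, hu, hm⟩ := exists_map_eq_mul_isUpper (R := R)
    (GeneralLinearGroup.map (φ : B →+* K) m)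
  refine ⟨GeneralLinearGroup.map (ψ.symm : R →+* A) m',
    GeneralLinearGroup.map (φ.symm : K →+* B) u, hu.map _, ?_⟩
  have hf : f.comp (ψ.symm : R →+* A) = (φ.symm : K →+* B).comp (algebraMap R K) := by
    ext r
    apply φ.injective
    simp [h]
  have := congrArg (GeneralLinearGroup.map (φ.symm : K →+* B)) hm
  rw [map_mul] at this
  refine Eq.trans ?_ (this.trans ?_)
  · ext a b
    exact congrArg (fun g : R →+* B ↦ g (m' a b)) hf
  · congr 1
    ext a b
    exact φ.symm_apply_apply _

end

section

variable {S : Scheme.{u}} {n : ℕ} {V : VectorBundle S n}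

/-- `t` is contained in no proper open subset. -/
def IsClosedCenter (T : Over S) (t : T.left) : Prop := ∀ U : T.left.Opens, t ∈ U → U = ⊤

namespace IsClosedCenter

variable {T : Over S} {t : T.left} (ht : IsClosedCenter T t)
include ht

theorem exists_section {T' : Over S} {g : T' ⟶ T} (hg : IsNbhd g t) :
    ∃ k : T ⟶ T', k ≫ g = 𝟙 T := by
  obtain ⟨U, hU, k, hk⟩ := hg.exists_openIncl
  obtain rfl := ht U hU
  let l : T ⟶ openOver T ⊤ := Over.homMk T.left.topIso.inv (by simp [openOver])
  refine ⟨l ≫ k, ?_⟩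
  rw [Category.assoc, hk]
  ext1
  simp [l]

theorem exists_frame (V : VectorBundle S n) : Nonempty (Frame V T) := by
  obtain ⟨U, hU, -, ⟨e⟩⟩ := V.exists_frame (T.hom t)
  obtain ⟨k, -⟩ := ht.exists_section (isNbhd_openIncl T (U := T.hom ⁻¹ᵁ U) hU)
  exact ⟨e.res (k ≫ restrictBaseHom T U)⟩

theorem exists_ofFrame (F : Flag V T) : ∃ e : Frame V T, F = Flag.ofFrame e := by
  obtain ⟨T', g, hg, e, he⟩ := F.exists_ofFrame t
  obtain ⟨k, hk⟩ := ht.exists_section hg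
  refine ⟨e.res k, ?_⟩
  rw [← Flag.ofFrame_res, ← he, ← Flag.res_comp, hk, Flag.res_id]

theorem exists_ofFrame_mul (F : Flag V T) (d : Frame V T) :
    ∃ m : GL (Fin n) Γ(T.left, ⊤), F = Flag.ofFrame (d.mul m) := by
  obtain ⟨e, rfl⟩ := ht.exists_ofFrame F
  obtain ⟨m, rfl⟩ := d.exists_eq_mul e
  exact ⟨m, rfl⟩

end IsClosedCenter

theorem isClosedCenter_closedPoint {R : Type u} [CommRing R] [IsLocalRing R]
    (f : Spec (CommRingCat.of R) ⟶ S) :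
    IsClosedCenter (Over.mk f) (IsLocalRing.closedPoint R) := fun _ hU ↦
  (IsLocalRing.closed_point_mem_iff).mp hU

section

variable {R K : Type u} [CommRing R] [IsDomain R] [ValuationRing R] [Field K] [Algebra R K]
  [IsFractionRing R K]

/-- Over a local scheme every flag is given by a matrix in one global frame. Existence is the
Iwasawa decomposition; uniqueness holds because upper triangularity can be tested after the
injection of `R` into `K`. -/
theorem Flag.existsUnique_res_eq (f : Spec (CommRingCat.of R) ⟶ S) {T' : Over S}
    (j : T' ⟶ Over.mk f) (φ : Γ(T'.left, ⊤) ≃+* K)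
    (h : ∀ a, φ (resHom j a) = algebraMap R K ((Scheme.ΓSpecIso (.of R)).hom a))
    (hT' : ∃ t, IsClosedCenter T' t) (F' : Flag V T') :
    ∃! F : Flag V (Over.mk f), F.res j = F' := by
  let ψ : Γ((Over.mk f).left, ⊤) ≃+* R :=
    (Scheme.ΓSpecIso (.of R)).commRingCatIsoToRingEquiv
  obtain ⟨t', ht'⟩ := hT'
  have ht := isClosedCenter_closedPoint f
  have hinj : Function.Injective (resHom j) := by
    have : Function.Injective fun a ↦ φ (resHom j a) := by
      simp_rw [h]
      exact (IsFractionRing.injective R K).comp ψ.injective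
    exact fun a b hab ↦ this (congrArg φ hab)
  refine existsUnique_of_exists_of_unique ?_ ?_
  · obtain ⟨e⟩ := ht.exists_frame V
    obtain ⟨m, rfl⟩ := ht'.exists_ofFrame_mul F' (e.res j)
    obtain ⟨m', u, hu, hm⟩ := exists_map_eq_mul_isUpper' (resHom j) ψ φ h m
    refine ⟨Flag.ofFrame (e.mul m'), ?_⟩
    rw [Flag.ofFrame_res, Frame.mul_res, ← Flag.ofFrame_mul_mul (m := m) hu, ← hm]
    rfl
  · rintro F₁ F₂ h₁ h₂
    obtain ⟨e, rfl⟩ := ht.exists_ofFrame F₁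
    obtain ⟨m, rfl⟩ := ht.exists_ofFrame_mul F₂ e
    rw [← h₂, Flag.ofFrame_res, Flag.ofFrame_res, Frame.mul_res, Flag.ofFrame_eq_ofFrame_mul,
      resGL_val] at h₁
    exact Flag.ofFrame_eq_ofFrame_mul.mpr (isUpper_of_map hinj h₁)

end

theorem Flag.IsUniversal.valuativeCriterion {Z : Over S} {F : Flag V Z} (hF : F.IsUniversal) :
    ValuativeCriterion Z.hom := by
  rintro ⟨R, K, i₁, i₂, ⟨w⟩⟩
  let a := Spec.map (CommRingCat.ofHom (algebraMap R K))
  let j : Over.mk (a ≫ i₂) ⟶ Over.mk i₂ := Over.homMk a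
  let l₁ : Over.mk (a ≫ i₂) ⟶ Z := Over.homMk i₁ w
  have key := Flag.existsUnique_res_eq (K := K) i₂ j
    (Scheme.ΓSpecIso (.of K)).commRingCatIsoToRingEquiv (fun x ↦
      congrArg (fun g ↦ g.hom x) (Scheme.ΓSpecIso_naturality (CommRingCat.ofHom (algebraMap R K))))
    ⟨_, isClosedCenter_closedPoint (R := K) (a ≫ i₂)⟩ (F.res l₁)
  obtain ⟨F', hF', huniq⟩ := key
  obtain ⟨l, hl, -⟩ := hF _ F'
  have hjl : j ≫ l = l₁ := hF.mono _ _ _ (by rw [Flag.res_comp, hl, hF'])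
  refine ⟨⟨⟨l.left, congrArg CommaMorphism.left hjl, Over.w l⟩⟩, fun ⟨l', h₁, h₂⟩ ↦ ?_⟩
  let m : Over.mk i₂ ⟶ Z := Over.homMk l' h₂
  have hjm : j ≫ m = l₁ := by ext1; exact h₁
  have : m = l := hF.mono _ _ _ (by rw [hl]; exact huniq _ ((Flag.res_comp j m F).symm.trans (congrArg (fun g ↦ F.res g) hjm)))
  ext1
  exact congrArg CommaMorphism.left this

theorem Flag.IsUniversal.isProper {Z : Over S} {F : Flag V Z} (hF : F.IsUniversal)
    [IsLocallyNoetherian S] [CompactSpace S] : IsProper Z.hom := by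
  have := hF.locallyOfFiniteType
  have : IsLocallyNoetherian Z.left := LocallyOfFiniteType.isLocallyNoetherian Z.hom
  have := hF.compactSpace
  have : IsNoetherian Z.left := {}
  have : QuasiCompact Z.hom := inferInstance
  exact IsProper.of_valuativeCriterion _ hF.valuativeCriterion

end

end RelFlag

/-! ### Closed conditions on flags, and products of flag bundles -/

namespace RelFlag

open Matrix

section

variable {S : Scheme.{u}}

theorem resHom_eq_zero_of_locally {T : Over S} {f : Γ(T.left, ⊤)}
    (h : ∀ t : T.left, ∃ (T' : Over S) (g : T' ⟶ T), IsNbhd g t ∧ resHom g f = 0) : f = 0 :=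
  eq_zero_of_locally' ⊤ f fun t _ ↦ by
    obtain ⟨T', g, hg, hf⟩ := h t
    exact ⟨T'.left, g.left, hg.isOpenImmersion, hg.mem_range, hf⟩

/-- A condition on morphisms to `Y` which is local on the source and given locally on `Y` by the
vanishing of functions. -/
structure IsClosedCondition {Y : Over S} (C : ∀ T : Over S, (T ⟶ Y) → Prop) : Prop where
  res : ∀ (T' T : Over S) (h : T' ⟶ T) (g : T ⟶ Y), C T g → C T' (h ≫ g)
  of_locally : ∀ (T : Over S) (g : T ⟶ Y), (∀ t : T.left, ∃ (T' : Over S) (h : T' ⟶ T),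
    IsNbhd h t ∧ C T' (h ≫ g)) → C T g
  exists_functions : ∀ y : Y.left, ∃ (Y' : Over S) (j : Y' ⟶ Y), IsNbhd j y ∧
    ∃ A : Set Γ(Y'.left, ⊤), ∀ (T : Over S) (g : T ⟶ Y'), C T (g ≫ j) ↔ ∀ a ∈ A, resHom g a = 0

theorem IsClosedCondition.forall {ι : Type*} [Finite ι] {Y : Over S}
    {C : ι → ∀ T : Over S, (T ⟶ Y) → Prop} (hC : ∀ i, IsClosedCondition (C i)) :
    IsClosedCondition fun T g ↦ ∀ i, C i T g where
  res T' T h g H i := (hC i).res T' T h g (H i)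
  of_locally T g H i := (hC i).of_locally T g fun t ↦ by
    obtain ⟨T', h, hh, hi⟩ := H t
    exact ⟨T', h, hh, hi i⟩
  exists_functions y := by
    obtain ⟨Y', j, hj, hA⟩ := exists_common_nbhd (t := y) (fun i {Y'} j ↦ ∃ A : Set Γ(Y'.left, ⊤),
      ∀ (T : Over S) (g : T ⟶ Y'), C i T (g ≫ j) ↔ ∀ a ∈ A, resHom g a = 0) (by
        rintro i T'' T' h g ⟨A, hA⟩
        refine ⟨resHom h '' A, fun T k ↦ ?_⟩
        rw [← Category.assoc, hA, Set.forall_mem_image]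
        simp only [resHom_comp, RingHom.comp_apply]) fun i ↦ (hC i).exists_functions y
    choose A hA using hA
    refine ⟨Y', j, hj, ⋃ i, A i, fun T g ↦ ?_⟩
    simp only [hA, Set.mem_iUnion]
    exact ⟨fun h a ⟨i, ha⟩ ↦ h i a ha, fun h i a ha ↦ h a ⟨i, ha⟩⟩

theorem IsClosedCondition.and {Y : Over S} {C D : ∀ T : Over S, (T ⟶ Y) → Prop}
    (hC : IsClosedCondition C) (hD : IsClosedCondition D) :
    IsClosedCondition fun T g ↦ C T g ∧ D T g := by
  have := IsClosedCondition.forall (C := fun b : Bool ↦ bif b then C else D)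
    (Bool.forall_bool.mpr ⟨hD, hC⟩)
  simpa only [Bool.forall_bool, cond_true, cond_false, and_comm] using this

theorem IsClosedCondition.exists_isClosedImmersion {Y : Over S} [IsLocallyNoetherian Y.left]
    [CompactSpace Y.left] {C : ∀ T : Over S, (T ⟶ Y) → Prop} (hC : IsClosedCondition C) :
    ∃ (X : Over S) (i : X ⟶ Y), IsClosedImmersion i.left ∧ C X i ∧
      ∀ (T : Over S) (g : T ⟶ Y), C T g → ∃ h, h ≫ i = g :=
  RelFlag.exists_isClosedImmersion Y C hC.res hC.of_locally hC.exists_functions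

variable {n : ℕ} {V : VectorBundle S n}

theorem exists_ofFrame_pair {T : Over S} (P F : Flag V T) (t : T.left) :
    ∃ (T' : Over S) (g : T' ⟶ T), IsNbhd g t ∧ ∃ (d : Frame V T') (m : GL (Fin n) Γ(T'.left, ⊤)),
      P.res g = Flag.ofFrame d ∧ F.res g = Flag.ofFrame (d.mul m) := by
  obtain ⟨T₁, g, hg, d, hd⟩ := P.exists_ofFrame t
  obtain ⟨x, hx⟩ := hg.mem_range
  obtain ⟨T₂, k, hk, m, hm⟩ := exists_ofFrame_mul d (F.res g) x
  refine ⟨T₂, k ≫ g, hk.comp hg hx, d.res k, m, ?_, ?_⟩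
  · rw [Flag.res_comp, hd, Flag.ofFrame_res]
  · rw [Flag.res_comp, hm]

theorem isClosedCondition_sameMember {Y : Over S} (i : Fin (n + 1)) (F F' : Flag V Y) :
    IsClosedCondition fun T (g : T ⟶ Y) ↦ SameMember i (F.res g) (F'.res g) where
  res T' T h g H := by
    rw [Flag.res_comp, Flag.res_comp]
    exact H.res h
  of_locally T g H := SameMember.of_locally fun t ↦ by
    obtain ⟨T', h, hh, H⟩ := H t
    rw [Flag.res_comp, Flag.res_comp] at H
    exact ⟨T', h, hh, H⟩
  exists_functions y := by
    obtain ⟨Y', j, hj, d, m, hd, hm⟩ := exists_ofFrame_pair F F' y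
    refine ⟨Y', j, hj, {f | ∃ a b : Fin n, (i : ℕ) ≤ a ∧ (b : ℕ) < i ∧ f = m.val a b},
      fun T g ↦ ?_⟩
    rw [Flag.res_comp, Flag.res_comp, hd, hm, Flag.ofFrame_res, Flag.ofFrame_res, Frame.mul_res,
      sameMember_ofFrame_mul, preserves_iff, resGL_val]
    constructor
    · rintro h _ ⟨a, b, ha, hb, rfl⟩
      exact h a b ha hb
    · exact fun h a b ha hb ↦ h _ ⟨a, b, ha, hb, rfl⟩

theorem isClosedCondition_eq {Y : Over S} (F F' : Flag V Y) :
    IsClosedCondition fun T (g : T ⟶ Y) ↦ F.res g = F'.res g := by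
  simp only [Flag.eq_iff_sameMember]
  exact .forall fun i ↦ isClosedCondition_sameMember i F F'

/-- The rank conditions are stable under base change and under upper triangular factors on both
sides, so one pair of adapted frames decides for all of them. -/
theorem relativePositionLE_ofFrame_iff {σ : Equiv.Perm (Fin n)} {T : Over S} {d : Frame V T}
    {m : GL (Fin n) Γ(T.left, ⊤)} :
    RelativePositionLE σ (Flag.ofFrame d) (Flag.ofFrame (d.mul m)) ↔ RankConditions σ m.val := by
  constructor
  · intro h i j α β hα hβ
    exact h T (𝟙 T) d (d.mul m) (adaptedTo_iff.mpr (Flag.res_id _))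
      (adaptedTo_iff.mpr (Flag.res_id _)) m.val ((Frame.vec_eq_sum_iff d _ _ m rfl).mpr rfl)
      i j α β hα hβ
  · intro h T' g d' e' hd he c hc i j α β hα hβ
    rw [adaptedTo_iff, Flag.ofFrame_res] at hd he
    obtain ⟨u, rfl⟩ := (d.res g).exists_eq_mul d'
    obtain ⟨v, rfl⟩ := ((d.mul m).res g).exists_eq_mul e'
    have hu := Flag.ofFrame_eq_ofFrame_mul.mp hd
    have hv := Flag.ofFrame_eq_ofFrame_mul.mp he
    have h1 : ((d.mul m).res g).mul v = ((d.res g).mul u).mul (u⁻¹ * resGL g m * v) := by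
      rw [Frame.mul_mul, Frame.mul_res, Frame.mul_mul, ← mul_assoc, ← mul_assoc, mul_inv_cancel,
        one_mul]
    rw [Frame.vec_eq_sum_iff _ _ _ _ h1] at hc
    have h2 : RankConditions σ (resGL g m).val := fun i j ↦ by
      rw [resGL_val]
      exact (h i j).map _
    have h3 : RankConditions σ (u⁻¹ * resGL g m * v).val := (h2.mul_left hu.inv).mul_right hv
    rw [hc]
    exact h3 i j α β hα hβ

theorem RelativePositionLE.of_locally {σ : Equiv.Perm (Fin n)} {T : Over S} {P F : Flag V T}
    (H : ∀ t : T.left, ∃ (T' : Over S) (g : T' ⟶ T), IsNbhd g t ∧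
      RelativePositionLE σ (P.res g) (F.res g)) : RelativePositionLE σ P F := by
  intro T' g d e hd he c hc i j α β hα hβ
  refine resHom_eq_zero_of_locally fun t ↦ ?_
  obtain ⟨T₁, k, hk, h⟩ := H (g.left t)
  obtain ⟨T₂, g', f', hg', hf⟩ := hk.exists_pullback g
  refine ⟨T₂, g', hg', ?_⟩
  rw [adaptedTo_iff] at hd he
  have hd' : AdaptedTo (P.res k).sub f' (d.res g') := by
    rw [adaptedTo_iff, ← Flag.res_comp, hf, Flag.res_comp, hd, Flag.ofFrame_res]
  have he' : AdaptedTo (F.res k).sub f' (e.res g') := by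
    rw [adaptedTo_iff, ← Flag.res_comp, hf, Flag.res_comp, he, Flag.ofFrame_res]
  have := h T₂ f' _ _ hd' he' (c.map (resHom g')) (fun b ↦ by
    change V.res g' (e.vec b) = _
    rw [hc, map_sum]
    exact Finset.sum_congr rfl fun a _ ↦ (V.res g').map_smulₛₗ (c a b) (d.vec a)) i j α β hα hβ
  rw [RingHom.map_det]
  exact this

theorem isClosedCondition_relativePositionLE {Y : Over S} (σ : Equiv.Perm (Fin n))
    (P F : Flag V Y) :
    IsClosedCondition fun T (g : T ⟶ Y) ↦ RelativePositionLE σ (P.res g) (F.res g) where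
  res T' T h g H := by
    rw [Flag.res_comp, Flag.res_comp]
    exact H.res h
  of_locally T g H := RelativePositionLE.of_locally fun t ↦ by
    obtain ⟨T', h, hh, H⟩ := H t
    rw [Flag.res_comp, Flag.res_comp] at H
    exact ⟨T', h, hh, H⟩
  exists_functions y := by
    obtain ⟨Y', j, hj, d, m, hd, hm⟩ := exists_ofFrame_pair P F y
    refine ⟨Y', j, hj, {f | ∃ (i j : Fin (n + 1)) (α β : Fin (positionRank σ i j + 1) → Fin n),
      (∀ x, (i : ℕ) ≤ α x) ∧ (∀ x, (β x : ℕ) < j) ∧ f = (m.val.submatrix α β).det},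
      fun T g ↦ ?_⟩
    rw [Flag.res_comp, Flag.res_comp, hd, hm, Flag.ofFrame_res, Flag.ofFrame_res, Frame.mul_res,
      relativePositionLE_ofFrame_iff, resGL_val]
    constructor
    · rintro h _ ⟨i, j, α, β, hα, hβ, rfl⟩
      rw [RingHom.map_det]
      exact h i j α β hα hβ
    · intro h i j α β hα hβ
      have := h _ ⟨i, j, α, β, hα, hβ, rfl⟩
      rw [RingHom.map_det] at this
      exact this

/-- The fiber product over S of copies of the flag bundle indexed by `κ`, built one factor at a
time; it is the ambient space for the chains of flags. -/
theorem exists_universal_flags [IsLocallyNoetherian S] [CompactSpace S] (V : VectorBundle S n)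
    (κ : Type) [Finite κ] : ∃ (Y : Over S) (F : κ → Flag V Y), IsProper Y.hom ∧
      ∀ (T : Over S) (F' : κ → Flag V T), ∃! h : T ⟶ Y, ∀ i, (F i).res h = F' i := by
  induction κ using Finite.induction_empty_option with
  | of_equiv ε h =>
    obtain ⟨Y, F, hY, H⟩ := h
    refine ⟨Y, F ∘ ε.symm, hY, fun T F' ↦ ?_⟩
    refine (existsUnique_congr fun h ↦ ?_).mp (H T (F' ∘ ε))
    exact ⟨fun h i ↦ by simpa using h (ε.symm i), fun h i ↦ by simpa using h (ε i)⟩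
  | h_empty =>
    refine ⟨Over.mk (𝟙 S), fun i ↦ i.elim, (inferInstance : IsProper (𝟙 S)), fun T F' ↦ ?_⟩
    exact ⟨Over.homMk T.hom, fun i ↦ i.elim, fun _ _ ↦ Over.mkIdTerminal.hom_ext _ _⟩
  | @h_option κ _ h =>
    obtain ⟨Y, F, hY, H⟩ := h
    obtain ⟨Z, G, hG⟩ := exists_isUniversal V
    have hZ := hG.isProper
    let W : Over S := Over.mk (Limits.pullback.fst Y.hom Z.hom ≫ Y.hom)
    let a : W ⟶ Y := Over.homMk (Limits.pullback.fst Y.hom Z.hom)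
    let b : W ⟶ Z := Over.homMk (Limits.pullback.snd Y.hom Z.hom)
      Limits.pullback.condition.symm
    refine ⟨W, fun i ↦ i.elim (G.res b) fun i ↦ (F i).res a,
      (inferInstance : IsProper (Limits.pullback.fst Y.hom Z.hom ≫ Y.hom)), fun T F' ↦ ?_⟩
    obtain ⟨k, hk, -⟩ := H T fun i ↦ F' (some i)
    obtain ⟨l, hl, -⟩ := hG T (F' none)
    have hw : k.left ≫ Y.hom = l.left ≫ Z.hom := (Over.w k).trans (Over.w l).symm
    let m : T ⟶ W := Over.homMk (Limits.pullback.lift k.left l.left hw)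
      ((Limits.pullback.lift_fst_assoc k.left l.left hw Y.hom).trans (Over.w k))
    have hma : m ≫ a = k := by ext1; exact Limits.pullback.lift_fst _ _ hw
    have hmb : m ≫ b = l := by ext1; exact Limits.pullback.lift_snd _ _ hw
    refine ⟨m, fun i ↦ ?_, fun m' hm' ↦ ?_⟩
    · cases i with
      | none => exact (Flag.res_comp m b G).symm.trans (by rw [hmb, hl])
      | some i => exact (Flag.res_comp m a (F i)).symm.trans (by rw [hma, hk])
    · have ha : m' ≫ a = m ≫ a := (H T fun i ↦ F' (some i)).unique
        (fun i ↦ (Flag.res_comp m' a (F i)).trans (hm' (some i))) (fun i ↦ by rw [hma, hk])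
      have hb : m' ≫ b = m ≫ b := (hG T (F' none)).unique
        ((Flag.res_comp m' b G).trans (hm' none)) (by rw [hmb, hl])
      ext1
      exact Limits.pullback.hom_ext (congrArg CommaMorphism.left ha)
        (congrArg CommaMorphism.left hb)

end

end RelFlag

/-! ### Representing schemes of the fiber product and of the Richardson variety -/

namespace RelFlag

section

variable {S : Scheme.{u}} {n : ℕ} {V : VectorBundle S n} {p q : Flag V (Over.mk (𝟙 S))}
  {ρ ρ' : List (Fin (n - 1))}

theorem BottSamelsonPoint.sameMember {T : Over S} (x : BottSamelsonPoint p ρ T)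
    (m : Fin ρ.length) {i : Fin (n + 1)} (hi : (i : ℕ) ≠ (ρ.get m : ℕ) + 1) :
    SameMember i (x.flag m.castSucc) (x.flag m.succ) :=
  fun _ g ↦ x.step m i hi g

theorem BottSamelsonPoint.res_comp {T'' T' T : Over S} (h : T'' ⟶ T') (g : T' ⟶ T)
    (x : BottSamelsonPoint p ρ T) : x.res (h ≫ g) = (x.res g).res h :=
  BottSamelsonPoint.ext (funext fun m ↦ Flag.res_comp h g (x.flag m))

theorem BottSamelsonPoint.res_id {T : Over S} (x : BottSamelsonPoint p ρ T) : x.res (𝟙 T) = x :=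
  BottSamelsonPoint.ext (funext fun m ↦ Flag.res_id (x.flag m))

theorem BottSamelsonPoint.last_res {T' T : Over S} (g : T' ⟶ T) (x : BottSamelsonPoint p ρ T) :
    (x.res g).last = x.last.res g := rfl

/-- The condition for a sequence of flags to be a point of the Bott–Samelson variety. -/
def IsChain (p : Flag V (Over.mk (𝟙 S))) (ρ : List (Fin (n - 1))) {T : Over S}
    (F : Fin (ρ.length + 1) → Flag V T) : Prop :=
  F 0 = p.at T ∧ ∀ (m : Fin ρ.length) (i : {i : Fin (n + 1) // (i : ℕ) ≠ (ρ.get m : ℕ) + 1}),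
    SameMember i (F m.castSucc) (F m.succ)

theorem BottSamelsonPoint.isChain {T : Over S} (x : BottSamelsonPoint p ρ T) :
    IsChain p ρ x.flag :=
  ⟨x.flag_zero, fun m i ↦ x.sameMember m i.2⟩

def IsChain.point {T : Over S} {F : Fin (ρ.length + 1) → Flag V T} (h : IsChain p ρ F) :
    BottSamelsonPoint p ρ T where
  flag := F
  flag_zero := h.1
  step m i hi _ g := h.2 m ⟨i, hi⟩ _ g

theorem isClosedCondition_isChain {Y : Over S} (F : Fin (ρ.length + 1) → Flag V Y) :
    IsClosedCondition fun T (g : T ⟶ Y) ↦ IsChain p ρ fun m ↦ (F m).res g := by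
  refine IsClosedCondition.and ?_ (.forall fun m ↦ .forall fun i ↦
    isClosedCondition_sameMember _ _ _)
  have := isClosedCondition_eq (F 0) (p.at Y)
  simpa only [Flag.res_at] using this

/-- A pair of points of two Bott–Samelson varieties which is universal among those with the same
last flag. -/
def IsUniversalPair {Z : Over S} (x : BottSamelsonPoint p ρ Z) (y : BottSamelsonPoint q ρ' Z) :
    Prop :=
  x.last = y.last ∧ ∀ (T : Over S) (x' : BottSamelsonPoint p ρ T) (y' : BottSamelsonPoint q ρ' T),
    x'.last = y'.last → ∃! h : T ⟶ Z, x.res h = x' ∧ y.res h = y'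

/-- A universal point of the Richardson variety. -/
def IsUniversalRichardson (p q : Flag V (Over.mk (𝟙 S))) (σ τ : Equiv.Perm (Fin n)) {X : Over S}
    (F : Flag V X) : Prop :=
  F ∈ (richardson p q σ τ).obj (op X) ∧ ∀ (T : Over S) (F' : Flag V T),
    F' ∈ (richardson p q σ τ).obj (op T) → ∃! h : T ⟶ X, F.res h = F'

/-- Being two chains with a common last flag is a finite conjunction of closed conditions on a
product of flag bundles, so the solution space is a closed subscheme, in particular proper over S.
-/
theorem exists_isUniversalPair [IsLocallyNoetherian S] [CompactSpace S]
    (p q : Flag V (Over.mk (𝟙 S))) (ρ ρ' : List (Fin (n - 1))) :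
    ∃ (Z : Over S) (x : BottSamelsonPoint p ρ Z) (y : BottSamelsonPoint q ρ' Z),
      IsUniversalPair x y ∧ IsProper Z.hom := by
  obtain ⟨Y, F, hY, H⟩ := exists_universal_flags V (Fin (ρ.length + 1) ⊕ Fin (ρ'.length + 1))
  have : IsLocallyNoetherian Y.left := LocallyOfFiniteType.isLocallyNoetherian Y.hom
  have : CompactSpace Y.left := QuasiCompact.compactSpace_of_compactSpace Y.hom
  obtain ⟨Z, i, hi, ⟨hx, hy, hxy⟩, hZ⟩ := ((isClosedCondition_isChain (p := p) fun m ↦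
    F (.inl m)).and ((isClosedCondition_isChain (p := q) fun m ↦ F (.inr m)).and
      (isClosedCondition_eq (F (.inl (Fin.last _))) (F (.inr (Fin.last _)))))).exists_isClosedImmersion
  refine ⟨Z, hx.point, hy.point, ⟨hxy, fun T x' y' h' ↦ ?_⟩, ?_⟩
  · obtain ⟨k, hk, huniq⟩ := H T (Sum.elim x'.flag y'.flag)
    have hk₁ (m) : (F (.inl m)).res k = x'.flag m := hk (.inl m)
    have hk₂ (m) : (F (.inr m)).res k = y'.flag m := hk (.inr m)
    obtain ⟨h, rfl⟩ := hZ T k ⟨by simpa only [hk₁] using x'.isChain, by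
      simpa only [hk₂] using y'.isChain, by
      rw [hk₁, hk₂]
      exact h'⟩
    simp only [Flag.res_comp] at hk₁ hk₂
    refine ⟨h, ⟨BottSamelsonPoint.ext (funext hk₁), BottSamelsonPoint.ext (funext hk₂)⟩, ?_⟩
    rintro h₂ ⟨hx₂, hy₂⟩
    have h3 : h₂ ≫ i = h ≫ i := huniq _ (by
      rintro (m | m)
      · rw [Flag.res_comp]
        exact congrFun (congrArg BottSamelsonPoint.flag hx₂) m
      · rw [Flag.res_comp]
        exact congrFun (congrArg BottSamelsonPoint.flag hy₂) m)
    ext1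
    exact (cancel_mono i.left).mp (congrArg CommaMorphism.left h3)
  · rw [← Over.w i]
    infer_instance

theorem exists_isUniversalRichardson [IsLocallyNoetherian S] [CompactSpace S]
    (p q : Flag V (Over.mk (𝟙 S))) (σ τ : Equiv.Perm (Fin n)) :
    ∃ (X : Over S) (F : Flag V X), IsUniversalRichardson p q σ τ F ∧ IsProper X.hom := by
  obtain ⟨Y, G, hG⟩ := exists_isUniversal V
  have := hG.isProper
  have : IsLocallyNoetherian Y.left := LocallyOfFiniteType.isLocallyNoetherian Y.hom
  have : CompactSpace Y.left := QuasiCompact.compactSpace_of_compactSpace Y.hom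
  have hC := (isClosedCondition_relativePositionLE σ (p.at Y) G).and
    (isClosedCondition_relativePositionLE τ (q.at Y) G)
  simp only [Flag.res_at] at hC
  obtain ⟨X, i, hi, hX, hU⟩ := hC.exists_isClosedImmersion
  refine ⟨X, G.res i, ⟨hX, fun T F' hF' ↦ ?_⟩, ?_⟩
  · obtain ⟨k, rfl, huniq⟩ := hG T F'
    obtain ⟨h, rfl⟩ := hU T k hF'
    refine ⟨h, (Flag.res_comp _ _ _).symm, fun h' hh' ↦ ?_⟩
    have := huniq (h' ≫ i) ((Flag.res_comp _ _ _).trans hh')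
    ext1
    exact (cancel_mono i.left).mp (congrArg CommaMorphism.left this)
  · rw [← Over.w i]
    infer_instance

/-- Any representing scheme is isomorphic over S to the proper one constructed above. -/
theorem IsUniversalPair.isProper [IsLocallyNoetherian S] [CompactSpace S] {Z : Over S}
    {x : BottSamelsonPoint p ρ Z} {y : BottSamelsonPoint q ρ' Z} (h : IsUniversalPair x y) :
    IsProper Z.hom := by
  obtain ⟨Z', x', y', h', hZ'⟩ := exists_isUniversalPair p q ρ ρ'
  obtain ⟨a, ⟨rfl, rfl⟩, -⟩ := h'.2 Z x y h.1
  obtain ⟨b, ⟨hx, hy⟩, -⟩ := h.2 Z' x' y' h'.1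
  have hab : a ≫ b = 𝟙 Z := (h.2 Z _ _ h.1).unique
    (by rw [BottSamelsonPoint.res_comp, BottSamelsonPoint.res_comp, hx, hy]; exact ⟨rfl, rfl⟩)
    ⟨BottSamelsonPoint.res_id _, BottSamelsonPoint.res_id _⟩
  have hba : b ≫ a = 𝟙 Z' := (h'.2 Z' _ _ h'.1).unique
    (by rw [BottSamelsonPoint.res_comp, BottSamelsonPoint.res_comp, hx, hy]; exact ⟨rfl, rfl⟩)
    ⟨BottSamelsonPoint.res_id _, BottSamelsonPoint.res_id _⟩
  have : IsIso a := ⟨b, hab, hba⟩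
  have : IsIso a.left := inferInstanceAs (IsIso ((Over.forget S).map a))
  rw [← Over.w a]
  infer_instance

theorem IsUniversalRichardson.isProper [IsLocallyNoetherian S] [CompactSpace S]
    {σ τ : Equiv.Perm (Fin n)} {X : Over S} {F : Flag V X}
    (h : IsUniversalRichardson p q σ τ F) : IsProper X.hom := by
  obtain ⟨X', F', h', hX'⟩ := exists_isUniversalRichardson p q σ τ
  obtain ⟨a, rfl, -⟩ := h'.2 X F h.1
  obtain ⟨b, hb, -⟩ := h.2 X' F' h'.1
  have hab : a ≫ b = 𝟙 X := (h.2 X _ h.1).unique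
    (by rw [Flag.res_comp, hb]) (Flag.res_id _)
  have hba : b ≫ a = 𝟙 X' := (h'.2 X' _ h'.1).unique
    (by rw [Flag.res_comp, hb]) (Flag.res_id _)
  have : IsIso a := ⟨b, hab, hba⟩
  have : IsIso a.left := inferInstanceAs (IsIso ((Over.forget S).map a))
  rw [← Over.w a]
  infer_instance

section

variable {T : Over S}

theorem isPullback_bottSamelsonProduct (T : Over S) :
    IsPullback ((Limits.pullback.fst (bottSamelsonToFlag p ρ) (bottSamelsonToFlag q ρ')).app (op T))
      ((Limits.pullback.snd (bottSamelsonToFlag p ρ) (bottSamelsonToFlag q ρ')).app (op T))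
      ((bottSamelsonToFlag p ρ).app (op T)) ((bottSamelsonToFlag q ρ').app (op T)) :=
  (IsPullback.of_hasPullback (bottSamelsonToFlag p ρ) (bottSamelsonToFlag q ρ')).map
    ((evaluation _ _).obj (op T))

noncomputable def prodFst (z : (bottSamelsonProduct p q ρ ρ').obj (op T)) :
    BottSamelsonPoint p ρ T :=
  (Limits.pullback.fst (bottSamelsonToFlag p ρ) (bottSamelsonToFlag q ρ')).app (op T) z

noncomputable def prodSnd (z : (bottSamelsonProduct p q ρ ρ').obj (op T)) :
    BottSamelsonPoint q ρ' T :=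
  (Limits.pullback.snd (bottSamelsonToFlag p ρ) (bottSamelsonToFlag q ρ')).app (op T) z

theorem prodFst_last (z : (bottSamelsonProduct p q ρ ρ').obj (op T)) :
    (prodFst z).last = (prodSnd z).last :=
  ConcreteCategory.congr_hom (isPullback_bottSamelsonProduct (p := p) (q := q) T).w z

theorem prod_ext {z z' : (bottSamelsonProduct p q ρ ρ').obj (op T)} (h : prodFst z = prodFst z')
    (h' : prodSnd z = prodSnd z') : z = z' :=
  Limits.Types.ext_of_isPullback (isPullback_bottSamelsonProduct T) h h'

theorem exists_prod (x : BottSamelsonPoint p ρ T) (y : BottSamelsonPoint q ρ' T)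
    (h : x.last = y.last) : ∃ z : (bottSamelsonProduct p q ρ ρ').obj (op T),
      prodFst z = x ∧ prodSnd z = y :=
  Limits.Types.exists_of_isPullback (isPullback_bottSamelsonProduct T) x y h

theorem prodFst_map {T' : Over S} (g : T' ⟶ T) (z : (bottSamelsonProduct p q ρ ρ').obj (op T)) :
    prodFst ((bottSamelsonProduct p q ρ ρ').map g.op z) = (prodFst z).res g :=
  NatTrans.naturality_apply
    (Limits.pullback.fst (bottSamelsonToFlag p ρ) (bottSamelsonToFlag q ρ')) g.op z

theorem prodSnd_map {T' : Over S} (g : T' ⟶ T) (z : (bottSamelsonProduct p q ρ ρ').obj (op T)) :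
    prodSnd ((bottSamelsonProduct p q ρ ρ').map g.op z) = (prodSnd z).res g :=
  NatTrans.naturality_apply
    (Limits.pullback.snd (bottSamelsonToFlag p ρ) (bottSamelsonToFlag q ρ')) g.op z

end

theorem isRepresentable_bottSamelsonProduct [IsLocallyNoetherian S] [CompactSpace S]
    (p q : Flag V (Over.mk (𝟙 S))) (ρ ρ' : List (Fin (n - 1))) :
    (bottSamelsonProduct p q ρ ρ').IsRepresentable := by
  obtain ⟨Z, x, y, h, -⟩ := exists_isUniversalPair p q ρ ρ'
  obtain ⟨z, rfl, rfl⟩ := exists_prod x y h.1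
  refine ⟨Z, nonempty_representableBy_iff.mpr ⟨z, fun T w ↦ ?_⟩⟩
  refine (existsUnique_congr fun k ↦ ?_).mp (h.2 T (prodFst w) (prodSnd w) (prodFst_last w))
  rw [← prodFst_map, ← prodSnd_map]
  exact ⟨fun h ↦ prod_ext h.1 h.2, fun h ↦ by rw [h]; exact ⟨rfl, rfl⟩⟩

theorem isUniversalPair_of_representableBy {Z : Over S}
    (hZ : (bottSamelsonProduct p q ρ ρ').RepresentableBy Z) :
    IsUniversalPair (prodFst (hZ.homEquiv (𝟙 Z))) (prodSnd (hZ.homEquiv (𝟙 Z))) := by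
  refine ⟨prodFst_last _, fun T x y h ↦ ?_⟩
  obtain ⟨z, rfl, rfl⟩ := exists_prod x y h
  refine ⟨hZ.homEquiv.symm z, ?_, fun k hk ↦ ?_⟩
  · dsimp only
    rw [← prodFst_map, ← prodSnd_map, ← hZ.homEquiv_eq, Equiv.apply_symm_apply]
    exact ⟨rfl, rfl⟩
  · dsimp only at hk
    rw [← prodFst_map, ← prodSnd_map, ← hZ.homEquiv_eq] at hk
    rw [Equiv.eq_symm_apply]
    exact prod_ext hk.1 hk.2

theorem isRepresentable_richardson [IsLocallyNoetherian S] [CompactSpace S]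
    (p q : Flag V (Over.mk (𝟙 S))) (σ τ : Equiv.Perm (Fin n)) :
    (richardson p q σ τ).toFunctor.IsRepresentable := by
  obtain ⟨X, F, h, -⟩ := exists_isUniversalRichardson p q σ τ
  refine ⟨X, nonempty_representableBy_iff.mpr ⟨⟨F, h.1⟩, fun T F' ↦ ?_⟩⟩
  refine (existsUnique_congr fun k ↦ ?_).mp (h.2 T F'.1 F'.2)
  exact ⟨fun h ↦ Subtype.ext h, fun h ↦ congrArg Subtype.val h⟩

theorem isUniversalRichardson_of_representableBy {σ τ : Equiv.Perm (Fin n)} {X : Over S}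
    (hX : (richardson p q σ τ).toFunctor.RepresentableBy X) :
    IsUniversalRichardson p q σ τ (hX.homEquiv (𝟙 X)).1 := by
  refine ⟨(hX.homEquiv (𝟙 X)).2, fun T F' hF' ↦ ?_⟩
  have h (k : T ⟶ X) : (hX.homEquiv k).1 = Flag.res k (hX.homEquiv (𝟙 X)).1 :=
    congrArg Subtype.val (hX.homEquiv_eq k)
  obtain ⟨k, hk⟩ := (hX.homEquiv (X := T)).surjective ⟨F', hF'⟩
  refine ⟨k, (h k).symm.trans (congrArg Subtype.val hk), fun l hl ↦ hX.homEquiv.injective ?_⟩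
  exact Subtype.ext ((h l).trans (hl.trans (congrArg Subtype.val hk).symm))

end

end RelFlag

/-! ### Chains over a Bruhat cell: factorization, existence and uniqueness -/

namespace RelFlag

open Matrix

section

variable {S : Scheme.{u}} {n : ℕ} {V : VectorBundle S n}

theorem isParabolic_iff_sameMember {T : Over S} {e : Frame V T} {m : GL (Fin n) Γ(T.left, ⊤)}
    {r : Fin (n - 1)} : (∀ i : Fin (n + 1), (i : ℕ) ≠ r + 1 →
      SameMember i (Flag.ofFrame e) (Flag.ofFrame (e.mul m))) ↔ IsParabolic r m.val := by
  simp only [sameMember_ofFrame_mul]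
  refine ⟨fun h i hi ↦ ?_, fun h i hi ↦ h i hi⟩
  by_cases hin : i < n + 1
  · exact h ⟨i, hin⟩ hi
  · exact preserves_iff.mpr fun a b ha _ ↦ by omega

theorem IsReducedWord.partialProd_lt {ρ : List (Fin (n - 1))} {σ : Equiv.Perm (Fin n)}
    (h : IsReducedWord ρ σ) (m : Fin ρ.length) :
    partialProd ρ m (lo (ρ.get m)) < partialProd ρ m (hi (ρ.get m)) :=
  h.lt m

section

variable {p : Flag V (Over.mk (𝟙 S))} {ρ : List (Fin (n - 1))} {σ : Equiv.Perm (Fin n)} {T : Over S}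

/-- Consecutive flags differ by a parabolic matrix, and in a reduced word each letter creates an
inversion, which is the hypothesis of `RankConditions.mul_isParabolic`. -/
theorem BottSamelsonPoint.relativePositionLE (hρ : IsReducedWord ρ σ)
    (x : BottSamelsonPoint p ρ T) (m : Fin (ρ.length + 1)) :
    RelativePositionLE (partialProd ρ m) (p.at T) (x.flag m) := by
  induction m using Fin.induction with
  | zero =>
    refine RelativePositionLE.of_locally fun t ↦ ?_
    obtain ⟨T', g, hg, d, hd⟩ := (p.at T).exists_ofFrame t
    refine ⟨T', g, hg, ?_⟩
    have h := (relativePositionLE_ofFrame_iff (d := d)).mpr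
      (rankConditions_one (c := (1 : GL (Fin n) Γ(T'.left, ⊤)).val) isUpper_one)
    rw [Frame.mul_one] at h
    rwa [x.flag_zero, hd, Fin.val_zero, partialProd_zero]
  | succ m ih =>
    refine RelativePositionLE.of_locally fun t ↦ ?_
    obtain ⟨T₁, g, hg, d, c, hd, hc⟩ := exists_ofFrame_pair (p.at T) (x.flag m.castSucc) t
    obtain ⟨t₁, ht₁⟩ := hg.mem_range
    obtain ⟨T₂, k, hk, h, hh⟩ := exists_ofFrame_mul (d.mul c) ((x.flag m.succ).res g) t₁
    refine ⟨T₂, k ≫ g, hk.comp hg ht₁, ?_⟩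
    have h₁ : (p.at T).res (k ≫ g) = Flag.ofFrame (d.res k) := by
      rw [Flag.res_comp, hd, Flag.ofFrame_res]
    have h₂ : (x.flag m.castSucc).res (k ≫ g) = Flag.ofFrame ((d.res k).mul (resGL k c)) := by
      rw [Flag.res_comp, hc, Flag.ofFrame_res, Frame.mul_res]
    have h₃ : (x.flag m.succ).res (k ≫ g) = Flag.ofFrame ((d.res k).mul (resGL k c * h)) := by
      rw [Flag.res_comp, hh, Frame.mul_res, Frame.mul_mul]
    have hpar : IsParabolic (ρ.get m) h.val :=
      isParabolic_iff_sameMember (e := (d.res k).mul (resGL k c)).mp fun i hi ↦ by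
        have := (x.sameMember m hi).res (k ≫ g)
        rwa [h₂, h₃, ← Frame.mul_mul] at this
    have h₄ := ih.res (k ≫ g)
    rw [h₁, h₂, relativePositionLE_ofFrame_iff] at h₄
    rw [h₁, h₃, relativePositionLE_ofFrame_iff, Fin.val_succ, partialProd_succ]
    exact h₄.mul_isParabolic (hρ.partialProd_lt m) hpar

theorem BottSamelsonPoint.last_relativePositionLE (hρ : IsReducedWord ρ σ)
    (x : BottSamelsonPoint p ρ T) : RelativePositionLE σ (p.at T) x.last := by
  have := x.relativePositionLE hρ (Fin.last _)
  rwa [Fin.val_last, hρ.partialProd_length] at this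

/-- The flags `P` and `F` are in relative position `σ`. -/
def InCell (σ : Equiv.Perm (Fin n)) (P F : Flag V T) : Prop :=
  ∃ d : Frame V T, P = Flag.ofFrame d ∧ F = Flag.ofFrame (d.mul (permGL _ σ))

theorem InCell.res {P F : Flag V T} (h : InCell σ P F) {T' : Over S} (g : T' ⟶ T) :
    InCell σ (P.res g) (F.res g) := by
  obtain ⟨d, rfl, rfl⟩ := h
  exact ⟨d.res g, Flag.ofFrame_res g d, by rw [Flag.ofFrame_res, Frame.mul_res, resGL_permGL]⟩

theorem inCell_ofFrame_iff {d : Frame V T} {m : GL (Fin n) Γ(T.left, ⊤)} :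
    InCell σ (Flag.ofFrame d) (Flag.ofFrame (d.mul m)) ↔ ∃ u v : GL (Fin n) Γ(T.left, ⊤),
      IsUpper u.val ∧ IsUpper v.val ∧ m * u = v * permGL _ σ := by
  constructor
  · rintro ⟨d', h, h'⟩
    obtain ⟨v, rfl⟩ := d.exists_eq_mul d'
    rw [Frame.mul_mul, Flag.ofFrame_mul_eq_iff] at h'
    exact ⟨_, v, h', Flag.ofFrame_eq_ofFrame_mul.mp h, mul_inv_cancel_left _ _⟩
  · rintro ⟨u, v, hu, hv, h⟩
    refine ⟨d.mul v, Flag.ofFrame_eq_ofFrame_mul.mpr hv, ?_⟩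
    rw [Frame.mul_mul, ← h, Flag.ofFrame_mul_mul hu]

/-- Inside the determinantal locus the cell is characterized by invertibility of the leading minors
of `σ⁻¹ m`. A function that becomes invertible on `X` is invertible near the image of each point. -/
theorem InCell.exists_nbhd {X : Over S} {P F : Flag V T} {g : X ⟶ T}
    (hPF : RelativePositionLE σ P F) (h : InCell σ (P.res g) (F.res g)) (x : X.left) :
    ∃ (T' : Over S) (k : T' ⟶ T), IsNbhd k (g.left x) ∧ InCell σ (P.res k) (F.res k) := by
  obtain ⟨T₁, j, hj, d, m, hd, hm⟩ := exists_ofFrame_pair P F (g.left x)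
  obtain ⟨X', g', f', hg', hf'⟩ := hj.exists_pullback g
  obtain ⟨x', rfl⟩ := hg'.mem_range
  have h₁ := h.res g'
  rw [← Flag.res_comp, ← Flag.res_comp, ← hf', Flag.res_comp, Flag.res_comp, hd, hm,
    Flag.ofFrame_res, Flag.ofFrame_res, Frame.mul_res, inCell_ofFrame_iff] at h₁
  obtain ⟨u, v, hu, hv, huv⟩ := h₁
  obtain ⟨T₂, k, hk, hunit⟩ := exists_nbhd_isUnit (t := f'.left x') (fun j : Fin (n + 1) ↦
    (leading ((permGL _ σ)⁻¹ * m).val j.is_le).det) fun j ↦ mem_basicOpen_of_isUnit f' (by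
      have := isUnit_det_leading_of_mul_permGL hu hv huv j.is_le
      rw [← det_leading_map, ← resGL_val, map_mul, map_inv, resGL_permGL]
      exact this) x'
  refine ⟨T₂, k ≫ j, hk.comp hj ?_, ?_⟩
  · have := congrArg (fun h : X' ⟶ T ↦ h.left x') hf'
    simpa using this
  · have h₂ := hPF.res (k ≫ j)
    rw [Flag.res_comp, Flag.res_comp, hd, hm, Flag.ofFrame_res, Flag.ofFrame_res,
      Frame.mul_res] at h₂ ⊢
    rw [inCell_ofFrame_iff]
    refine (relativePositionLE_ofFrame_iff.mp h₂).exists_isUpper_mul_permGL fun {j} hj ↦ ?_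
    have := hunit ⟨j, Nat.lt_succ_of_le hj⟩
    rw [← det_leading_map, ← resGL_val, map_mul, map_inv, resGL_permGL] at this
    exact this

theorem sameMember_ofFrame_of_isParabolic {d : Frame V T} {m m' : GL (Fin n) Γ(T.left, ⊤)}
    {r : Fin (n - 1)} (h : IsParabolic r (m⁻¹ * m').val) {i : Fin (n + 1)} (hi : (i : ℕ) ≠ r + 1) :
    SameMember i (Flag.ofFrame (d.mul m)) (Flag.ofFrame (d.mul m')) := by
  have := isParabolic_iff_sameMember (e := d.mul m).mpr h i hi
  rwa [Frame.mul_mul, mul_inv_cancel_left] at this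

/-- A chain of coordinate flags: staying put and multiplying by the simple transposition are both
parabolic steps. -/
theorem exists_point_of_perms (v : Fin (ρ.length + 1) → Equiv.Perm (Fin n)) (h₀ : v 0 = 1)
    (hv : ∀ m : Fin ρ.length, v m.castSucc = v m.succ ∨
      v m.castSucc * simpleTransposition (ρ.get m) = v m.succ)
    {d : Frame V T} (hd : p.at T = Flag.ofFrame d) :
    ∃ x : BottSamelsonPoint p ρ T, ∀ m, x.flag m = Flag.ofFrame (d.mul (permGL _ (v m))) := by
  refine ⟨IsChain.point (F := fun m ↦ Flag.ofFrame (d.mul (permGL _ (v m)))) ⟨?_, fun m i ↦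
    sameMember_ofFrame_of_isParabolic ?_ i.2⟩, fun _ ↦ rfl⟩
  · dsimp only
    rw [h₀, permGL_one, Frame.mul_one, hd]
  · rcases hv m with h | h
    · rw [h, inv_mul_cancel]
      exact isUpper_one.isParabolic
    · rw [← h, permGL_mul, inv_mul_cancel_left]
      exact isParabolic_permGL _

theorem InCell.exists_point (hρ : IsReducedWord ρ σ) {F : Flag V T} (h : InCell σ (p.at T) F) :
    ∃ x : BottSamelsonPoint p ρ T, x.last = F := by
  obtain ⟨d, hd, rfl⟩ := h
  obtain ⟨x, hx⟩ := exists_point_of_perms (fun m : Fin (ρ.length + 1) ↦ partialProd ρ m)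
    (by simp [partialProd]) (fun m ↦ .inr (partialProd_succ ρ m).symm) hd
  refine ⟨x, (hx _).trans ?_⟩
  rw [Fin.val_last, hρ.partialProd_length]

/-- Descending from the last flag. The flag before a given one is constrained by the rank conditions
of the shorter partial product, and `RankConditions.isUpper_of_isParabolic` leaves only one
candidate. -/
theorem BottSamelsonPoint.flag_eq_of_last_eq (hρ : IsReducedWord ρ σ) (x : BottSamelsonPoint p ρ T)
    {d : Frame V T} (hd : p.at T = Flag.ofFrame d)
    (hx : x.last = Flag.ofFrame (d.mul (permGL _ σ))) (m : Fin (ρ.length + 1)) :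
    x.flag m = Flag.ofFrame (d.mul (permGL _ (partialProd ρ m))) := by
  induction m using Fin.reverseInduction with
  | last => rwa [Fin.val_last, hρ.partialProd_length]
  | cast m ih =>
    refine Flag.eq_of_locally fun t ↦ ?_
    obtain ⟨T', g, hg, c, hc⟩ := exists_ofFrame_mul d (x.flag m.castSucc) t
    refine ⟨T', g, hg, ?_⟩
    have h₁ := (x.relativePositionLE hρ m.castSucc).res g
    rw [hd, hc, Flag.ofFrame_res, relativePositionLE_ofFrame_iff] at h₁
    have h₂ : IsParabolic (ρ.get m) ((permGL _ (partialProd ρ (m + 1)))⁻¹ * c).val :=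
      isParabolic_iff_sameMember
        (e := (d.res g).mul (permGL _ (partialProd ρ (m + 1)))).mp fun i hi ↦ by
        have := sameMember_comm ((x.sameMember m hi).res g)
        rwa [ih, hc, Flag.ofFrame_res, Frame.mul_res, resGL_permGL, Fin.val_succ,
          ← mul_inv_cancel_left (permGL _ (partialProd ρ (m + 1))) c, ← Frame.mul_mul] at this
    rw [partialProd_succ] at h₂
    have h₃ := RankConditions.isUpper_of_isParabolic (hρ.partialProd_lt m) h₂ (by
      rw [← Units.val_mul, mul_inv_cancel_left]
      exact h₁)
    rw [hc, Flag.ofFrame_res, Frame.mul_res, resGL_permGL, eq_comm, Flag.ofFrame_mul_eq_iff]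
    rw [← Units.val_mul, permGL_mul, _root_.mul_inv_rev, ← mul_assoc, ← mul_assoc, permGL_inv,
      simpleTransposition_inv, ← permGL_mul, simpleTransposition_mul_self, permGL_one,
      one_mul] at h₃
    exact h₃

theorem InCell.point_eq (hρ : IsReducedWord ρ σ) {F : Flag V T} (h : InCell σ (p.at T) F)
    (x y : BottSamelsonPoint p ρ T) (hx : x.last = F) (hy : y.last = F) : x = y := by
  obtain ⟨d, hd, rfl⟩ := h
  refine BottSamelsonPoint.ext (funext fun m ↦ ?_)
  rw [x.flag_eq_of_last_eq hρ hd hx, y.flag_eq_of_last_eq hρ hd hy]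

theorem BottSamelsonPoint.eq_of_locally {x y : BottSamelsonPoint p ρ T}
    (H : ∀ t : T.left, ∃ (T' : Over S) (g : T' ⟶ T), IsNbhd g t ∧ x.res g = y.res g) : x = y :=
  BottSamelsonPoint.ext (funext fun m ↦ Flag.eq_of_locally fun t ↦ by
    obtain ⟨T', g, hg, h⟩ := H t
    exact ⟨T', g, hg, congrFun (congrArg BottSamelsonPoint.flag h) m⟩)

end

end

end RelFlag

/-! ### The projection over the open cell locus, and its surjectivity -/

namespace RelFlag

section

variable {S : Scheme.{u}}

/-- The points with a neighborhood on which `P` holds. -/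
def nbhdLocus (T : Over S) (P : ∀ T' : Over S, (T' ⟶ T) → Prop) : T.left.Opens where
  carrier := {t | ∃ (T' : Over S) (g : T' ⟶ T), IsNbhd g t ∧ P T' g}
  is_open' := by
    rw [isOpen_iff_forall_mem_open]
    rintro t ⟨T', g, hg, h⟩
    have := hg.isOpenImmersion
    refine ⟨Set.range g.left, ?_, g.left.isOpenEmbedding.isOpen_range, hg.mem_range⟩
    exact fun t' ht' ↦ ⟨T', g, ⟨this, ht'⟩, h⟩

theorem exists_comp_openIncl {T Y : Over S} (g : T ⟶ Y) (U : Y.left.Opens)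
    (h : ∀ t, g.left t ∈ U) : ∃ g' : T ⟶ openOver Y U, g' ≫ openIncl Y U = g := by
  have hU : Set.range g.left ⊆ Set.range U.ι := by
    rintro _ ⟨t, rfl⟩
    exact ⟨⟨_, h t⟩, rfl⟩
  have hf := IsOpenImmersion.lift_fac U.ι g.left hU
  refine ⟨Over.homMk (IsOpenImmersion.lift U.ι g.left hU) ?_, ?_⟩
  · exact (Category.assoc _ _ _).symm.trans ((congrArg (· ≫ Y.hom) hf).trans (Over.w g))
  · ext1
    exact hf

theorem openIncl_mono {T Y : Over S} {U : Y.left.Opens} {a b : T ⟶ openOver Y U}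
    (h : a ≫ openIncl Y U = b ≫ openIncl Y U) : a = b := by
  ext1
  exact (cancel_mono U.ι).mp (congrArg CommaMorphism.left h)

theorem openIncl_apply_mem {Y : Over S} {U : Y.left.Opens} (t : (openOver Y U).left) :
    (openIncl Y U).left t ∈ U :=
  t.2

end

section

theorem exists_hom_of_point {X : Scheme.{u}} (t : X) : ∃ (K : Type u) (_ : Field K)
    (g : Spec (CommRingCat.of K) ⟶ X), g (IsLocalRing.closedPoint K) = t :=
  ⟨X.residueField t, inferInstance, X.fromSpecResidueField t, X.fromSpecResidueField_apply t _⟩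

open Matrix in
theorem exists_bruhat_of_ringEquiv {B K : Type*} [CommRing B] [Field K] {n : ℕ} (φ : B ≃+* K)
    (m : GL (Fin n) B) : ∃ (w : Equiv.Perm (Fin n)) (u v : GL (Fin n) B),
      IsUpper u.val ∧ IsUpper v.val ∧ m * u = v * permGL B w := by
  obtain ⟨w, u, v, hu, hv, h⟩ := exists_bruhat (GeneralLinearGroup.map (φ : B →+* K) m)
  refine ⟨w, GeneralLinearGroup.map (φ.symm : K →+* B) u,
    GeneralLinearGroup.map (φ.symm : K →+* B) v, hu.map _, hv.map _, ?_⟩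
  have := congrArg (GeneralLinearGroup.map (φ.symm : K →+* B)) h
  rw [map_mul, map_mul, permGL_map] at this
  rw [← this]
  congr 1
  ext a b
  exact (φ.symm_apply_apply _).symm

variable {S : Scheme.{u}} {n : ℕ} {V : VectorBundle S n} {p : Flag V (Over.mk (𝟙 S))}
  {ρ : List (Fin (n - 1))} {σ : Equiv.Perm (Fin n)}

/-- Bruhat decomposition makes `F` a coordinate flag for some permutation `w` in a frame adapted to
`p`. The rank conditions bound `w` by σ, and a subword of ρ that reaches `w` supplies a chain of
coordinate flags. -/
theorem exists_point_of_field (hρ : IsReducedWord ρ σ) {T : Over S} {K : Type*} [Field K]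
    (φ : Γ(T.left, ⊤) ≃+* K) {t : T.left} (ht : IsClosedCenter T t) {F : Flag V T}
    (hF : RelativePositionLE σ (p.at T) F) : ∃ x : BottSamelsonPoint p ρ T, x.last = F := by
  obtain ⟨d, hd⟩ := ht.exists_ofFrame (p.at T)
  obtain ⟨m, rfl⟩ := ht.exists_ofFrame_mul F d
  obtain ⟨w, u, v, hu, hv, h⟩ := exists_bruhat_of_ringEquiv φ m
  rw [hd, relativePositionLE_ofFrame_iff] at hF
  have hw : RankConditions σ (permGL Γ(T.left, ⊤) w).val := by
    have h₁ := (hF.mul_right hu).mul_left hv.inv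
    rw [← Units.val_mul, h, ← Units.val_mul, inv_mul_cancel_left] at h₁
    exact h₁
  have : Nontrivial Γ(T.left, ⊤) := φ.toEquiv.nontrivial
  obtain ⟨w', h₀, hw', hs⟩ := exists_subword (ρ := ρ) (w := w) fun i j hi hj ↦ by
    rw [hρ.partialProd_length]
    exact positionRank_le_of_rankConditions hw hi hj
  -- The upper triangular `v` does not change the flag of `d`, so `d.mul v` is still adapted to `p`,
  -- and by `m u = v w` the flag `F` is its coordinate flag for `w`.
  obtain ⟨x, hx⟩ := exists_point_of_perms (p := p) w' h₀ hs (d := d.mul v)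
    (hd.trans (Flag.ofFrame_eq_ofFrame_mul.mpr hv))
  refine ⟨x, (hx _).trans ?_⟩
  rw [hw', Frame.mul_mul, ← h, Flag.ofFrame_mul_mul hu]

end

section

variable {S : Scheme.{u}} {n : ℕ} {V : VectorBundle S n} {p q : Flag V (Over.mk (𝟙 S))}
  {ρ ρ' : List (Fin (n - 1))} {σ τ : Equiv.Perm (Fin n)}

theorem IsUniversalRichardson.mono {X : Over S} {F : Flag V X}
    (hF : IsUniversalRichardson p q σ τ F) {T : Over S} {a b : T ⟶ X} (h : F.res a = F.res b) :
    a = b :=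
  (hF.2 T (F.res b) ((richardson p q σ τ).map b.op hF.1)).unique h rfl

theorem IsUniversalPair.mono {Z : Over S} {x : BottSamelsonPoint p ρ Z}
    {y : BottSamelsonPoint q ρ' Z} (hZ : IsUniversalPair x y) {T : Over S} {a b : T ⟶ Z}
    (h : x.res a = x.res b) (h' : y.res a = y.res b) : a = b :=
  (hZ.2 T (x.res b) (y.res b) (congrArg (Flag.res b) hZ.1)).unique ⟨h, h'⟩ ⟨rfl, rfl⟩

/-- The locus where `F` is in relative position `σ` to `p` and `τ` to `q`. -/
def cellLocus (p q : Flag V (Over.mk (𝟙 S))) (σ τ : Equiv.Perm (Fin n)) {X : Over S}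
    (F : Flag V X) : X.left.Opens :=
  nbhdLocus X fun T' g ↦ InCell σ (p.at T') (F.res g) ∧ InCell τ (q.at T') (F.res g)

theorem exists_nbhd_of_mem_cellLocus {X T : Over S} {F : Flag V X} {g : T ⟶ X} {t : T.left}
    (h : g.left t ∈ cellLocus p q σ τ F) : ∃ (T' : Over S) (k : T' ⟶ T), IsNbhd k t ∧
      InCell σ (p.at T') ((F.res g).res k) ∧ InCell τ (q.at T') ((F.res g).res k) := by
  obtain ⟨X', j, hj, h₁, h₂⟩ := h
  obtain ⟨T', k, f', hk, hf'⟩ := hj.exists_pullback g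
  have h₁ := h₁.res f'
  have h₂ := h₂.res f'
  rw [Flag.res_at, ← Flag.res_comp, hf', Flag.res_comp] at h₁ h₂
  exact ⟨T', k, hk, h₁, h₂⟩

/-- Being in the cells after pullback along `g` is enough: the universal flag satisfies the
determinantal conditions, so both cell conditions spread to a neighbourhood in `X`. -/
theorem IsUniversalRichardson.mem_cellLocus {X : Over S} {F : Flag V X}
    (hF : IsUniversalRichardson p q σ τ F) {T : Over S} {g : T ⟶ X}
    (h₁ : InCell σ (p.at T) (F.res g)) (h₂ : InCell τ (q.at T) (F.res g)) (t : T.left) :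
    g.left t ∈ cellLocus p q σ τ F := by
  have hp : RelativePositionLE σ (p.at X) F := hF.1.1
  have hq : RelativePositionLE τ (q.at X) F := hF.1.2
  rw [← Flag.res_at (T := X) p g] at h₁
  rw [← Flag.res_at (T := X) q g] at h₂
  obtain ⟨T', k, hk, h⟩ := exists_common_nbhd (t := g.left t)
    (fun (b : Bool) {T'} k ↦ bif b then InCell σ (p.at T') (F.res k) else
      InCell τ (q.at T') (F.res k)) (by
      rintro (_ | _) T'' T' h g H
      · have := H.res h
        rwa [Flag.res_at, ← Flag.res_comp] at this
      · have := H.res h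
        rwa [Flag.res_at, ← Flag.res_comp] at this) (by
      rintro (_ | _)
      · obtain ⟨T', k, hk, h⟩ := h₂.exists_nbhd hq t
        rw [Flag.res_at] at h
        exact ⟨T', k, hk, h⟩
      · obtain ⟨T', k, hk, h⟩ := h₁.exists_nbhd hp t
        rw [Flag.res_at] at h
        exact ⟨T', k, hk, h⟩)
  exact ⟨T', k, hk, h true, h false⟩

section

variable {Z X : Over S} {x : BottSamelsonPoint p ρ Z} {y : BottSamelsonPoint q ρ' Z} {F : Flag V X}
  (hρ : IsReducedWord ρ σ) (hρ' : IsReducedWord ρ' τ) (hZ : IsUniversalPair x y)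
  (hF : IsUniversalRichardson p q σ τ F) {f : Z ⟶ X} (hf : F.res f = x.last)
include hρ hρ' hZ hf

theorem eq_of_comp_eq_of_mem_cellLocus {T : Over S} {a b : T ⟶ Z} (h : a ≫ f = b ≫ f)
    (hU : ∀ t, (a ≫ f).left t ∈ cellLocus p q σ τ F) : a = b := by
  have ha : (x.res a).last = F.res (a ≫ f) := by
    rw [Flag.res_comp, hf, BottSamelsonPoint.last_res]
  have hb : (x.res b).last = F.res (a ≫ f) := by
    rw [h, Flag.res_comp, hf, BottSamelsonPoint.last_res]
  have ha' : (y.res a).last = F.res (a ≫ f) := by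
    rw [← ha, BottSamelsonPoint.last_res, BottSamelsonPoint.last_res, hZ.1]
  have hb' : (y.res b).last = F.res (a ≫ f) := by
    rw [← hb, BottSamelsonPoint.last_res, BottSamelsonPoint.last_res, hZ.1]
  refine hZ.mono (BottSamelsonPoint.eq_of_locally fun t ↦ ?_)
    (BottSamelsonPoint.eq_of_locally fun t ↦ ?_)
  · obtain ⟨T', k, hk, h₁, h₂⟩ := exists_nbhd_of_mem_cellLocus (hU t)
    exact ⟨T', k, hk, h₁.point_eq hρ _ _ (congrArg (Flag.res k) ha) (congrArg (Flag.res k) hb)⟩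
  · obtain ⟨T', k, hk, h₁, h₂⟩ := exists_nbhd_of_mem_cellLocus (hU t)
    exact ⟨T', k, hk, h₂.point_eq hρ' _ _ (congrArg (Flag.res k) ha') (congrArg (Flag.res k) hb')⟩

include hF

theorem exists_comp_eq_of_inCell {T : Over S} {g : T ⟶ X} (h₁ : InCell σ (p.at T) (F.res g))
    (h₂ : InCell τ (q.at T) (F.res g)) : ∃ a : T ⟶ Z, a ≫ f = g := by
  obtain ⟨x', hx'⟩ := h₁.exists_point hρ
  obtain ⟨y', hy'⟩ := h₂.exists_point hρ'
  obtain ⟨a, ⟨rfl, rfl⟩, -⟩ := hZ.2 T x' y' (hx'.trans hy'.symm)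
  exact ⟨a, hF.mono (by rw [Flag.res_comp, hf, ← hx', BottSamelsonPoint.last_res])⟩

theorem isIso_restrict_cellLocus : IsIso (f.left ∣_ cellLocus p q σ τ F) := by
  let U := cellLocus p q σ τ F
  let W := f.left ⁻¹ᵁ U
  let fU : openOver Z W ⟶ openOver X U := openRes f U
  have hfU : fU ≫ openIncl X U = openIncl Z W ≫ f := openRes_comp f U
  have hmono (T : Over S) (a b : T ⟶ openOver Z W)
      (h : (F.res (openIncl Z W ≫ f)).res a = (F.res (openIncl Z W ≫ f)).res b) : a = b := by
    rw [← Flag.res_comp, ← Flag.res_comp] at h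
    have h' := hF.mono h
    rw [← Category.assoc, ← Category.assoc] at h'
    refine openIncl_mono (eq_of_comp_eq_of_mem_cellLocus hρ hρ' hZ hf h' fun t ↦ ?_)
    exact openIncl_apply_mem (U := W) (a.left t)
  -- The inverse exists locally, where frames realize both cell conditions. The local inverses glue
  -- because the chains are unique over the cell locus.
  obtain ⟨a, ha⟩ := (isZariskiSheaf_flagBundle V).exists_hom_of_nbhds (Y := openOver Z W)
    (y := F.res (openIncl Z W ≫ f)) hmono (T := openOver X U) (F.res (openIncl X U)) fun t ↦ by
      obtain ⟨T', k, hk, h₁, h₂⟩ := exists_nbhd_of_mem_cellLocus (p := p) (q := q) (σ := σ)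
        (τ := τ) (F := F) (g := openIncl X U) (t := t) (openIncl_apply_mem (U := U) t)
      rw [← Flag.res_comp] at h₁ h₂
      obtain ⟨b, hb⟩ := exists_comp_eq_of_inCell hρ hρ' hZ hF hf h₁ h₂
      obtain ⟨b', rfl⟩ := exists_comp_openIncl b W fun t' ↦ by
        have h3 := openIncl_apply_mem (U := U) (k.left t')
        have h4 := congrArg (fun h : T' ⟶ X ↦ h.left t') hb
        simp only [Over.comp_left, Scheme.Hom.comp_apply] at h4
        change f.left (b.left t') ∈ U
        rw [h4]
        exact h3
      refine ⟨T', k, hk, b', ?_⟩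
      change (F.res _).res b' = (F.res _).res k
      rw [← Flag.res_comp, ← Flag.res_comp, ← hb, Category.assoc]
  have ha' : a ≫ fU = 𝟙 _ := by
    refine openIncl_mono (hF.mono ?_)
    rw [Category.assoc, hfU, Flag.res_comp, Category.id_comp]
    exact ha
  have ha'' : fU ≫ a = 𝟙 _ := by
    refine hmono _ _ _ ?_
    rw [Flag.res_id, Flag.res_comp fU a, ← hfU, Flag.res_comp fU]
    refine congrArg (Flag.res fU) ?_
    rw [← Flag.res_comp fU (openIncl X U), hfU]
    exact ha
  exact ⟨a.left, congrArg CommaMorphism.left ha'', congrArg CommaMorphism.left ha'⟩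

theorem surjective_of_isUniversal : Function.Surjective f.left := by
  intro t
  obtain ⟨K, _, j, hj⟩ := exists_hom_of_point t
  let g : Over.mk (j ≫ X.hom) ⟶ X := Over.homMk j
  have ht := isClosedCenter_closedPoint (R := K) (j ≫ X.hom)
  let φ : Γ(Spec (CommRingCat.of K), ⊤) ≃+* K :=
    (Scheme.ΓSpecIso (.of K)).commRingCatIsoToRingEquiv
  have hg := (richardson p q σ τ).map g.op hF.1
  obtain ⟨x', hx'⟩ := exists_point_of_field (p := p) hρ φ ht (F := F.res g) hg.1
  obtain ⟨y', hy'⟩ := exists_point_of_field (p := q) hρ' φ ht (F := F.res g) hg.2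
  obtain ⟨a, ⟨rfl, rfl⟩, -⟩ := hZ.2 _ x' y' (hx'.trans hy'.symm)
  have hag : a ≫ f = g := hF.mono (by rw [Flag.res_comp, hf, ← hx', BottSamelsonPoint.last_res])
  refine ⟨a.left (IsLocalRing.closedPoint K), ?_⟩
  have := congrArg (fun h : _ ⟶ X ↦ h.left (IsLocalRing.closedPoint K)) hag
  exact this.trans hj

/-- Density of the locus in the target follows from density of its preimage, as the projection is
surjective. -/
theorem isBirational_of_dense (h : Dense ((f.left ⁻¹ᵁ cellLocus p q σ τ F : Z.left.Opens) :
    Set Z.left)) : IsBirational f.left := by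
  refine ⟨cellLocus p q σ τ F, ?_, h, isIso_restrict_cellLocus hρ hρ' hZ hF hf⟩
  have := (surjective_of_isUniversal hρ hρ' hZ hF hf).denseRange.dense_image
    f.left.continuous h
  exact this.mono (Set.image_preimage_subset _ _)

end

end

end RelFlag

/-! ### The parameter space of parabolic matrices, and products of big cells -/

namespace RelFlag

open Matrix

section

theorem smooth_affineSpace {k : CommRingCat.{u}} (ι : Type u) [Finite ι] :
    Smooth (𝔸(ι; Spec k) ↘ Spec k) := by
  have h : 𝔸(ι; Spec k) ↘ Spec k = (AffineSpace.SpecIso ι k).hom ≫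
      Spec.map (CommRingCat.ofHom MvPolynomial.C) := by
    rw [← AffineSpace.SpecIso_inv_over, Iso.hom_inv_id_assoc]
  have : Smooth (Spec.map (CommRingCat.ofHom (MvPolynomial.C : k →+* MvPolynomial ι k))) := by
    rw [HasRingHomProperty.Spec_iff (P := @Smooth)]
    have : Algebra.FinitePresentation k (MvPolynomial ι k) := inferInstance
    have : Algebra.Smooth k (MvPolynomial ι k) := {}
    exact RingHom.smooth_algebraMap.mpr this
  rw [h]
  infer_instance

variable {n : ℕ}

/-- The generic matrix of the parabolic shape given by `r`. -/
def parabolicMatrix {R : Type*} [CommRing R] (r : Fin (n - 1)) (c : Fin n × Fin n → R) :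
    Matrix (Fin n) (Fin n) R :=
  Matrix.of fun a b ↦ if a ≤ b ∨ a = hi r ∧ b = lo r then c (a, b) else 0

theorem isParabolic_parabolicMatrix {R : Type*} [CommRing R] (r : Fin (n - 1))
    (c : Fin n × Fin n → R) : IsParabolic r (parabolicMatrix r c) := by
  rw [isParabolic_iff]
  intro a b hab h
  exact if_neg fun h' ↦ h'.elim (fun h₁ ↦ absurd hab h₁.not_gt) h

theorem parabolicMatrix_map {R R' : Type*} [CommRing R] [CommRing R'] (f : R →+* R')
    (r : Fin (n - 1)) (c : Fin n × Fin n → R) :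
    (parabolicMatrix r c).map f = parabolicMatrix r fun x ↦ f (c x) := by
  ext a b
  simp only [parabolicMatrix, map_apply, of_apply, apply_ite f, map_zero]

theorem IsParabolic.eq_parabolicMatrix {R : Type*} [CommRing R] {r : Fin (n - 1)}
    {m : Matrix (Fin n) (Fin n) R} (h : IsParabolic r m) :
    m = parabolicMatrix r fun x ↦ m x.1 x.2 := by
  ext a b
  rw [parabolicMatrix, of_apply]
  split_ifs with hab
  · rfl
  · push Not at hab
    exact isParabolic_iff.mp h a b hab.1 fun h' ↦ hab.2 h'.1 h'.2

/-- A parameter space for families of invertible matrices of given parabolic shapes. -/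
theorem exists_universal_parabolic (k : Type u) [Field k] {κ : Type} [Finite κ]
    (r : κ → Fin (n - 1)) : ∃ (Y : Over (Spec (CommRingCat.of k)))
      (H : κ → GL (Fin n) Γ(Y.left, ⊤)), Smooth Y.hom ∧ IrreducibleSpace Y.left ∧
      (∀ i, IsParabolic (r i) (H i).val) ∧ ∀ (T : Over (Spec (CommRingCat.of k)))
        (h : κ → GL (Fin n) Γ(T.left, ⊤)), (∀ i, IsParabolic (r i) (h i).val) →
          ∃ b : T ⟶ Y, ∀ i, resGL b (H i) = h i := by
  cases nonempty_fintype κ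
  let B := Spec (CommRingCat.of k)
  let ι := ULift.{u} (κ × Fin n × Fin n)
  let A : Over B := Over.mk (𝔸(ι; B) ↘ B)
  let M (i : κ) : Matrix (Fin n) (Fin n) Γ(A.left, ⊤) :=
    parabolicMatrix (r i) fun x ↦ AffineSpace.coord B ⟨i, x⟩
  -- Inverting the product of the determinants makes all the generic parabolic matrices invertible
  -- at once.
  let f : Γ(A.left, ⊤) := ∏ i, (M i).det
  let Y := openOver A (A.left.basicOpen f)
  let j : Y ⟶ A := openIncl A (A.left.basicOpen f)
  have hunit : IsUnit (resHom j f) := isUnit_resHom_openIncl f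
  have hdet (i : κ) : IsUnit ((M i).map (resHom j)).det := by
    rw [← RingHom.mapMatrix_apply, ← RingHom.map_det]
    exact isUnit_of_dvd_unit (map_dvd _ (Finset.dvd_prod_of_mem (fun i ↦ (M i).det)
      (Finset.mem_univ i))) hunit
  have hlift (T : Over B) (h : κ → GL (Fin n) Γ(T.left, ⊤))
      (hh : ∀ i, IsParabolic (r i) (h i).val) :
      ∃ b : T ⟶ Y, ∀ i, resGL b (toGL _ (hdet i)) = h i := by
    let b₀ : T ⟶ A := Over.homMk (AffineSpace.homOfVector T.hom fun i : ι ↦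
      (h i.down.1).val i.down.2.1 i.down.2.2) (AffineSpace.homOfVector_over _ _)
    have hb₀ (i : κ) : (M i).map (resHom b₀) = (h i).val := by
      rw [parabolicMatrix_map, (hh i).eq_parabolicMatrix]
      congr 1
      funext x
      exact AffineSpace.homOfVector_appTop_coord _ _ _
    have hf : IsUnit (resHom b₀ f) := by
      rw [map_prod]
      refine (IsUnit.prod_univ_iff).mpr fun i ↦ ?_
      rw [RingHom.map_det, RingHom.mapMatrix_apply, hb₀]
      exact isUnit_det _
    obtain ⟨b, hb⟩ := exists_comp_openIncl b₀ (A.left.basicOpen f) (mem_basicOpen_of_isUnit b₀ hf)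
    refine ⟨b, fun i ↦ Units.ext ?_⟩
    rw [resGL_val, ← hb₀, ← hb, resHom_comp]
    rfl
  refine ⟨Y, fun i ↦ toGL _ (hdet i), ?_, ?_, fun i ↦ ?_, hlift⟩
  · have : Smooth (𝔸(ι; B) ↘ B) := smooth_affineSpace ι
    exact inferInstanceAs (Smooth ((A.left.basicOpen f).ι ≫ 𝔸(ι; B) ↘ B))
  -- The family of identity matrices gives a point, so the open subscheme of the integral affine
  -- space is nonempty and hence irreducible.
  · obtain ⟨b, -⟩ := hlift (Over.mk (𝟙 B)) (fun _ ↦ 1) fun i ↦ isUpper_one.isParabolic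
    have : Nonempty Y.left := ⟨b.left (IsLocalRing.closedPoint k)⟩
    have : IsIntegral B := inferInstance
    have : IsIntegral A.left := inferInstanceAs (IsIntegral 𝔸(ι; B))
    have : IsIntegral Y.left := isIntegral_of_isOpenImmersion (A.left.basicOpen f).ι
    infer_instance
  · change IsParabolic _ ((M i).map (resHom j))
    rw [parabolicMatrix_map]
    exact isParabolic_parabolicMatrix _ _

end

section

variable {n ℓ : ℕ} {R : Type*} [CommRing R]

theorem exists_partialProducts (A : GL (Fin n) R) (h : Fin ℓ → GL (Fin n) R) :
    ∃ E : Fin (ℓ + 1) → GL (Fin n) R, E 0 = A ∧ ∀ m, E m.succ = E m.castSucc * h m :=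
  ⟨Fin.induction A fun m x ↦ x * h m, rfl, fun _ ↦ rfl⟩

theorem exists_partialProducts_last (A : GL (Fin n) R) (h : Fin ℓ → GL (Fin n) R) :
    ∃ E : Fin (ℓ + 1) → GL (Fin n) R, E (Fin.last _) = A ∧ ∀ m, E m.castSucc = E m.succ * h m :=
  ⟨Fin.reverseInduction A fun m x ↦ x * h m, by simp, fun _ ↦ by simp⟩

/-- If each step lies in B s B, the product over a reduced word lies in B σ B: lengths add at every
letter, so `exists_isUpper_mul_permGL_mul` applies inductively. -/
theorem exists_isUpper_mul_of_partialProducts {ρ : List (Fin (n - 1))} {σ : Equiv.Perm (Fin n)}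
    (hρ : IsReducedWord ρ σ) {E : Fin (ρ.length + 1) → GL (Fin n) R} (h₀ : E 0 = 1)
    (hE : ∀ m : Fin ρ.length, ∃ u v : GL (Fin n) R, IsUpper u.val ∧ IsUpper v.val ∧
      (E m.castSucc)⁻¹ * E m.succ * u = v * permGL R (simpleTransposition (ρ.get m))) :
    ∃ u v : GL (Fin n) R, IsUpper u.val ∧ IsUpper v.val ∧
      E (Fin.last _) * u = v * permGL R σ := by
  have key (m : Fin (ρ.length + 1)) : ∃ u v : GL (Fin n) R, IsUpper u.val ∧ IsUpper v.val ∧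
      E m * u = v * permGL R (partialProd ρ m) := by
    induction m using Fin.induction with
    | zero => exact ⟨1, 1, isUpper_one, isUpper_one, by
        rw [h₀, Fin.val_zero, partialProd_zero, permGL_one]⟩
    | succ m ih =>
      obtain ⟨u, v, hu, hv, h⟩ := ih
      obtain ⟨u₁, v₁, hu₁, hv₁, h₁⟩ := hE m
      obtain ⟨v', e, hv', he, h'⟩ := exists_isUpper_mul_permGL_mul (hρ.partialProd_lt m)
        (u := u⁻¹ * v₁) (by rw [Units.val_mul]; exact hu.inv.mul hv₁)
      refine ⟨u₁ * v', v * e, hu₁.mul hv', hv.mul he, ?_⟩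
      rw [Fin.val_succ, partialProd_succ, mul_assoc v, ← h']
      have h₂ : E m.succ * u₁ = E m.castSucc * (v₁ * permGL R (simpleTransposition (ρ.get m))) := by
        rw [← h₁]
        group
      have h₃ : E m.castSucc = v * permGL R (partialProd ρ m) * u⁻¹ := eq_mul_inv_of_mul_eq h
      rw [← mul_assoc, h₂, h₃]
      group
  have := key (Fin.last _)
  rwa [Fin.val_last, hρ.partialProd_length] at this

end

end RelFlag

/-! ### Versality unwound: frames that realize prescribed pairs of flags -/

namespace RelFlag

open Matrix

/-- The fiber product of `Φ` with a representable functor is represented by an object `Q` over `Y`;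
its universal point is read off by evaluating the pullback square. -/
theorem exists_universal_of_relative {C : Type (u + 1)} [Category.{u} C]
    {F G : Cᵒᵖ ⥤ Type (u + 1)} (Φ : F ⟶ G) {P : MorphismProperty C}
    (h : P.relative uliftYoneda.{u + 1} Φ) (Y : C) (y : G.obj (op Y)) :
    ∃ (Q : C) (π : Q ⟶ Y) (x : F.obj (op Q)), P π ∧ Φ.app _ x = G.map π.op y ∧
      ∀ (T : C) (b : T ⟶ Y) (x' : F.obj (op T)), Φ.app _ x' = G.map b.op y →
        ∃ a : T ⟶ Q, a ≫ π = b ∧ F.map a.op x = x' := by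
  let y' : uliftYoneda.{u + 1}.obj Y ⟶ G := uliftYonedaEquiv.symm y
  have hy (T : C) (b : T ⟶ Y) : y'.app (op T) ⟨b⟩ = G.map b.op y := rfl
  obtain ⟨Q, π, g, hQ⟩ := h.1 y'
  have hpull (T : C) := hQ.map ((evaluation _ _).obj (op T))
  have hg (T : C) (a : T ⟶ Q) : g.app (op T) ⟨a⟩ = F.map a.op (g.app (op Q) ⟨𝟙 Q⟩) := by
    refine Eq.trans (congrArg (g.app (op T)) ?_) (NatTrans.naturality_apply g a.op ⟨𝟙 Q⟩)
    exact ULift.ext _ _ (Category.comp_id a).symm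
  refine ⟨Q, π, g.app (op Q) ⟨𝟙 Q⟩, h.2 y' g π hQ, ?_, fun T b x' hx' ↦ ?_⟩
  · refine (ConcreteCategory.congr_hom (hpull Q).w ⟨𝟙 Q⟩).trans ((hy Q _).trans ?_)
    exact congrArg (fun b : Q ⟶ Y ↦ G.map b.op y) (Category.id_comp π)
  · obtain ⟨⟨a⟩, ha₁, ha₂⟩ := Limits.Types.exists_of_isPullback (hpull T) x' ⟨b⟩
      (hx'.trans (hy T b).symm)
    exact ⟨a, congrArg ULift.down ha₂, (hg T a).symm.trans ha₁⟩

section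

variable {B : Scheme.{u}} {n : ℕ}

/-- The standard frame of the trivial bundle. -/
noncomputable def stdFrame (n : ℕ) (T : Over B) : Frame (trivialBundle B n) T where
  vec i := (trivialBundle.coord T).symm (Pi.single i 1)
  existsUnique {T'} g x := by
    have h (i : Fin n) : (trivialBundle B n).res g ((trivialBundle.coord T).symm (Pi.single i 1)) =
        (trivialBundle.coord T').symm (Pi.single i 1) := by
      apply (trivialBundle.coord T').injective
      funext j
      rw [trivialBundle.coord_res, LinearEquiv.apply_symm_apply, LinearEquiv.apply_symm_apply]
      by_cases hij : j = i
      · subst hij; simp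
      · simp [hij]
    refine ⟨trivialBundle.coord T' x, ?_, fun c hc ↦ ?_⟩
    · apply (trivialBundle.coord T').injective
      simp only [h, map_sum, map_smul, LinearEquiv.apply_symm_apply]
      exact pi_eq_sum_univ' _ |>.symm
    · rw [← hc]
      simp only [h, map_sum, map_smul, LinearEquiv.apply_symm_apply]
      exact pi_eq_sum_univ' _

theorem stdFrame_coord (T : Over B) (x : (trivialBundle B n).Sec T) :
    (stdFrame n T).coord x = trivialBundle.coord T x := by
  apply (stdFrame n T).equiv.injective
  rw [Frame.equiv_coord, Frame.equiv_apply]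
  apply (trivialBundle.coord T).injective
  simp only [stdFrame, map_sum, map_smul, LinearEquiv.apply_symm_apply]
  exact pi_eq_sum_univ' _

theorem stdFrame_res {T' T : Over B} (g : T' ⟶ T) : (stdFrame n T).res g = stdFrame n T' := by
  refine Frame.ext (funext fun i ↦ ?_)
  apply (trivialBundle.coord T').injective
  funext j
  refine (trivialBundle.coord_res g _ j).trans ?_
  change g.left.appTop.hom (trivialBundle.coord T ((trivialBundle.coord T).symm _) j) =
    trivialBundle.coord T' ((trivialBundle.coord T').symm _) j
  rw [LinearEquiv.apply_symm_apply, LinearEquiv.apply_symm_apply]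
  by_cases hij : j = i
  · subst hij; simp
  · simp [hij]

variable {S : Scheme.{u}} {V : VectorBundle S n} {T : Over B} {f : T.left ⟶ S}
  (e : Frame V (Over.mk f))

theorem Frame.mem_pullFlag {F : Flag V (Over.mk f)} {T' : Over B} {g : T' ⟶ T} {i : Fin (n + 1)}
    {x : (trivialBundle B n).Sec T'} : x ∈ (e.pullFlag F).sub i g ↔
      e.trivialize g x ∈ F.sub i (overPullHom f g) := Iff.rfl

theorem Frame.pullFlag_ofFrame_mul (m : GL (Fin n) Γ(T.left, ⊤)) :
    e.pullFlag (Flag.ofFrame (e.mul m)) = Flag.ofFrame ((stdFrame n T).mul m) := by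
  refine Flag.ext ?_
  funext i T' g
  ext x
  rw [e.mem_pullFlag, Flag.mem_ofFrame, Flag.mem_ofFrame, Frame.mul_res, Frame.mul_res,
    Frame.mul_coord, Frame.mul_coord, stdFrame_res, stdFrame_coord]
  have : (e.res (overPullHom f g)).coord (e.trivialize g x) = trivialBundle.coord T' x :=
    Frame.coord_equiv _ _
  rw [this]
  rfl

/-- Every S-scheme over `T` is also a B-scheme through `T`, so the flag in the trivial bundle sees
all the sections of `F`. The maps `k` and `l` only identify two presentations of the same S-scheme.
-/
theorem Frame.pullFlag_injective {F F' : Flag V (Over.mk f)} (h : e.pullFlag F = e.pullFlag F') :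
    F = F' := by
  suffices H : ∀ (F F' : Flag V (Over.mk f)) (_ : e.pullFlag F = e.pullFlag F') (i : Fin (n + 1))
      (X : Over S) (g : X ⟶ Over.mk f) (x : V.Sec X), x ∈ F.sub i g → x ∈ F'.sub i g by
    refine Flag.ext ?_
    funext i X g
    ext x
    exact ⟨H F F' h i X g x, H F' F h.symm i X g x⟩
  intro F F' h i X g x hx
  let X' : Over B := Over.mk (g.left ≫ T.hom)
  let g' : X' ⟶ T := Over.homMk g.left
  have hw : g.left ≫ f = X.hom := Over.w g
  let k : overPull f g' ⟶ X := Over.homMk (𝟙 X.left) (by simpa [X', g'] using hw.symm)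
  let l : X ⟶ overPull f g' := Over.homMk (𝟙 X.left) (by simpa [X', g'] using hw)
  have hk : k ≫ g = overPullHom f g' := by
    ext1
    exact Category.id_comp _
  have hl : l ≫ overPullHom f g' = g := by
    ext1
    exact Category.id_comp _
  have hlk : l ≫ k = 𝟙 X := by
    ext1
    exact Category.id_comp _
  have h₁ := F.res_mem k g hx
  rw [hk] at h₁
  obtain ⟨y, hy⟩ := (e.trivialize g').surjective (V.res k x)
  have h₂ : y ∈ (e.pullFlag F).sub i g' := by
    rw [e.mem_pullFlag, hy]
    exact h₁
  rw [h, e.mem_pullFlag, hy] at h₂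
  have h₃ := F'.res_mem l _ h₂
  rwa [hl, ← VectorBundle.res_comp, hlk, VectorBundle.res_id] at h₃

theorem Frame.pullFlag_eq_iff {F : Flag V (Over.mk f)} (m : GL (Fin n) Γ(T.left, ⊤)) :
    e.pullFlag F = Flag.ofFrame ((stdFrame n T).mul m) ↔ F = Flag.ofFrame (e.mul m) := by
  rw [← e.pullFlag_ofFrame_mul]
  exact ⟨e.pullFlag_injective, fun h ↦ by rw [h]⟩

variable {s : S ⟶ B} {p q : Flag V (Over.mk (𝟙 S))}

theorem FramePoint.frame_eq_of_res_eq {T' : Over B} {a : T' ⟶ T} {x : FramePoint s V T}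
    {x' : FramePoint s V T'} (h : x.res a = x')
    (k : Over.mk x'.toBase.left ⟶ Over.mk x.toBase.left) (hk : k.left = a.left) :
    x'.frame = x.frame.res k := by
  subst h
  have : k = overPullHom x.toBase.left a := by ext1; exact hk
  rw [this]
  rfl

theorem Versal.exists_universal (h : Versal s p q) (Y : Over B)
    (F₁ F₂ : Flag (trivialBundle B n) Y) :
    ∃ (P : Over B) (π : P ⟶ Y) (x : FramePoint s V P), Smooth π.left ∧ x.flag p = F₁.res π ∧
      x.flag q = F₂.res π ∧ ∀ (T : Over B) (b : T ⟶ Y) (x' : FramePoint s V T),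
        x'.flag p = F₁.res b → x'.flag q = F₂.res b → ∃ a : T ⟶ P, a ≫ π = b ∧ x.res a = x' := by
  obtain ⟨P, π, x, hπ, hx, H⟩ := exists_universal_of_relative _ h Y (F₁, F₂)
  refine ⟨P, π, x.down, hπ, congrArg Prod.fst hx, congrArg Prod.snd hx, fun T b x' h₁ h₂ ↦ ?_⟩
  obtain ⟨a, ha, hax⟩ := H T b ⟨x'⟩ (Prod.ext h₁ h₂)
  exact ⟨a, ha, congrArg ULift.down hax⟩

end

end RelFlag

/-! ### Local coordinates on the fiber product: one frame and a family of parabolic matrices -/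

namespace RelFlag

open Matrix

section

variable {n ℓ ℓ' : ℕ} {R : Type*} [CommRing R]

/-- `E` is the sequence of partial products of the matrices `h (inl m)`, and `D` is the sequence
which starts from the same total product and descends by the matrices `h (inr m)`. -/
structure IsPartialProducts (h : Fin ℓ ⊕ Fin ℓ' → GL (Fin n) R) (E : Fin (ℓ + 1) → GL (Fin n) R)
    (D : Fin (ℓ' + 1) → GL (Fin n) R) : Prop where
  zero : E 0 = 1
  succ : ∀ m, E m.succ = E m.castSucc * h (.inl m)
  last : D (Fin.last _) = E (Fin.last _)
  castSucc : ∀ m, D m.castSucc = D m.succ * h (.inr m)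

theorem exists_isPartialProducts (h : Fin ℓ ⊕ Fin ℓ' → GL (Fin n) R) :
    ∃ E D, IsPartialProducts h E D := by
  obtain ⟨E, h₀, hE⟩ := exists_partialProducts 1 fun m ↦ h (.inl m)
  obtain ⟨D, h₁, hD⟩ := exists_partialProducts_last (E (Fin.last _)) fun m ↦ h (.inr m)
  exact ⟨E, D, h₀, hE, h₁, hD⟩

namespace IsPartialProducts

variable {h : Fin ℓ ⊕ Fin ℓ' → GL (Fin n) R} {E E' : Fin (ℓ + 1) → GL (Fin n) R}
  {D D' : Fin (ℓ' + 1) → GL (Fin n) R} (H : IsPartialProducts h E D)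
include H

theorem unique (H' : IsPartialProducts h E' D') : E = E' ∧ D = D' := by
  have hE : E = E' := funext fun m ↦ by
    induction m using Fin.induction with
    | zero => rw [H.zero, H'.zero]
    | succ m ih => rw [H.succ, H'.succ, ih]
  refine ⟨hE, funext fun m ↦ ?_⟩
  induction m using Fin.reverseInduction with
  | last => rw [H.last, H'.last, hE]
  | cast m ih => rw [H.castSucc, H'.castSucc, ih]

theorem map {R' : Type*} [CommRing R'] (φ : GL (Fin n) R →* GL (Fin n) R') :
    IsPartialProducts (fun i ↦ φ (h i)) (fun m ↦ φ (E m)) fun m ↦ φ (D m) where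
  zero := by rw [H.zero, map_one]
  succ m := by rw [H.succ, map_mul]
  last := by rw [H.last]
  castSucc m := by rw [H.castSucc, map_mul]

end IsPartialProducts

end

section

variable {S : Scheme.{u}} {n : ℕ} {V : VectorBundle S n} {p q : Flag V (Over.mk (𝟙 S))}
  {ρ ρ' : List (Fin (n - 1))} {σ τ : Equiv.Perm (Fin n)} {T : Over S}

section

variable {h : Fin ρ.length ⊕ Fin ρ'.length → GL (Fin n) Γ(T.left, ⊤)}
  {E : Fin (ρ.length + 1) → GL (Fin n) Γ(T.left, ⊤)}
  {D : Fin (ρ'.length + 1) → GL (Fin n) Γ(T.left, ⊤)} (H : IsPartialProducts h E D)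
  (hpar : ∀ i, IsParabolic (Sum.elim ρ.get ρ'.get i) (h i).val) {e : Frame V T}
include H hpar

theorem IsPartialProducts.exists_points (hp : p.at T = Flag.ofFrame e)
    (hq : q.at T = Flag.ofFrame (e.mul (D 0))) :
    ∃ (x : BottSamelsonPoint p ρ T) (y : BottSamelsonPoint q ρ' T),
      (∀ m, x.flag m = Flag.ofFrame (e.mul (E m))) ∧ ∀ m, y.flag m = Flag.ofFrame (e.mul (D m)) := by
  refine ⟨IsChain.point (F := fun m ↦ Flag.ofFrame (e.mul (E m))) ⟨?_, fun m i ↦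
    sameMember_ofFrame_of_isParabolic ?_ i.2⟩, IsChain.point
    (F := fun m ↦ Flag.ofFrame (e.mul (D m))) ⟨hq.symm, fun m i ↦ sameMember_comm
    (sameMember_ofFrame_of_isParabolic ?_ i.2)⟩, fun _ ↦ rfl, fun _ ↦ rfl⟩
  · dsimp only
    rw [H.zero, Frame.mul_one, hp]
  · rw [H.succ, inv_mul_cancel_left]
    exact hpar (.inl m)
  · rw [H.castSucc, inv_mul_cancel_left]
    exact hpar (.inr m)

/-- A unit at `(hi r, lo r)` puts each factor in B s B; the reduced words then put the total
products in the cells of σ and τ. -/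
theorem IsPartialProducts.inCell (hρ : IsReducedWord ρ σ) (hρ' : IsReducedWord ρ' τ)
    (hu : ∀ i, IsUnit ((h i).val (hi (Sum.elim ρ.get ρ'.get i)) (lo (Sum.elim ρ.get ρ'.get i)))) :
    InCell σ (Flag.ofFrame e) (Flag.ofFrame (e.mul (E (Fin.last _)))) ∧
      InCell τ (Flag.ofFrame (e.mul (D 0))) (Flag.ofFrame (e.mul (E (Fin.last _)))) := by
  have htr (i) := (hpar i).exists_isUpper_mul_permGL (hu i)
  constructor
  · rw [inCell_ofFrame_iff]
    refine exists_isUpper_mul_of_partialProducts hρ H.zero fun m ↦ ?_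
    rw [H.succ, inv_mul_cancel_left]
    exact htr (.inl m)
  · rw [← H.last, ← mul_inv_cancel_left (D 0) (D (Fin.last _)), ← Frame.mul_mul,
      inCell_ofFrame_iff]
    refine exists_isUpper_mul_of_partialProducts hρ' (E := fun m ↦ (D 0)⁻¹ * D m)
      (inv_mul_cancel _) fun m ↦ ?_
    -- The second chain is traversed against its factors, so the inverse of `h (.inr m)` is needed:
    -- `h u = v s` becomes `h⁻¹ v = u s`, since `s` is its own inverse.
    obtain ⟨u, v, hu, hv, huv⟩ := htr (.inr m)
    refine ⟨v, u, hv, hu, ?_⟩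
    have h₁ : permGL Γ(T.left, ⊤) (simpleTransposition (ρ'.get m)) *
        permGL Γ(T.left, ⊤) (simpleTransposition (ρ'.get m)) = 1 := by
      rw [← permGL_mul, simpleTransposition_mul_self, permGL_one]
    have h₂ : v = h (.inr m) * u * permGL Γ(T.left, ⊤) (simpleTransposition (ρ'.get m)) := by
      rw [huv, mul_assoc]
      change _ = v * (permGL _ (simpleTransposition (ρ'.get m)) *
        permGL _ (simpleTransposition (ρ'.get m)))
      rw [h₁, _root_.mul_one]
    rw [H.castSucc, h₂]
    group

end

/-- All flags of both chains are spanned by frames on a common neighbourhood. The matrices between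
consecutive frames are parabolic, and walking along the first chain and back along the second
expresses every frame through the first one. -/
theorem exists_nbhd_frames (x : BottSamelsonPoint p ρ T) (y : BottSamelsonPoint q ρ' T)
    (hxy : x.last = y.last) (t : T.left) : ∃ (N : Scheme.{u}) (ν : N ⟶ S) (g : Over.mk ν ⟶ T),
      IsNbhd g t ∧ ∃ (e : Frame V (Over.mk ν)) (h : Fin ρ.length ⊕ Fin ρ'.length →
        GL (Fin n) Γ((Over.mk ν).left, ⊤)) (E : _) (D : _), IsPartialProducts h E D ∧
        (∀ i, IsParabolic (Sum.elim ρ.get ρ'.get i) (h i).val) ∧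
        (∀ m, (x.flag m).res g = Flag.ofFrame (e.mul (E m))) ∧
        ∀ m, (y.flag m).res g = Flag.ofFrame (e.mul (D m)) := by
  obtain ⟨N, g, hg, hfr⟩ := exists_common_nbhd (t := t)
    (fun (i : Fin (ρ.length + 1) ⊕ Fin (ρ'.length + 1)) {T'} g ↦ ∃ e : Frame V T',
      (Sum.elim x.flag y.flag i).res g = Flag.ofFrame e) (by
      rintro i T'' T' h g ⟨e, he⟩
      exact ⟨e.res h, by rw [Flag.res_comp, he, Flag.ofFrame_res]⟩)
    fun i ↦ Flag.exists_ofFrame _ t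
  choose c hc using hfr
  have hx (m) : (x.flag m).res g = Flag.ofFrame (c (.inl m)) := hc (.inl m)
  -- The last frame of the second chain is replaced by that of the first. The flags agree, and with
  -- equal frames the two sequences of partial products meet exactly.
  let d (m : Fin (ρ'.length + 1)) : Frame V N :=
    if m = Fin.last _ then c (.inl (Fin.last _)) else c (.inr m)
  have hd : d (Fin.last _) = c (.inl (Fin.last _)) := if_pos rfl
  have hy (m) : (y.flag m).res g = Flag.ofFrame (d m) := by
    by_cases hm : m = Fin.last _
    · rw [hm, hd, ← hx]
      exact congrArg (Flag.res g) hxy.symm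
    · simp only [d, if_neg hm]
      exact hc (.inr m)
  choose a ha using fun m : Fin ρ.length ↦ (c (.inl m.castSucc)).exists_eq_mul (c (.inl m.succ))
  choose b hb using fun m : Fin ρ'.length ↦ (d m.succ).exists_eq_mul (d m.castSucc)
  obtain ⟨E, D, H⟩ := exists_isPartialProducts (Sum.elim a b)
  have hE (m) : c (.inl m) = (c (.inl 0)).mul (E m) := by
    induction m using Fin.induction with
    | zero => rw [H.zero, Frame.mul_one]
    | succ m ih => rw [H.succ, ← Frame.mul_mul, ← ih, ha, Sum.elim_inl]
  have hD (m) : d m = (c (.inl 0)).mul (D m) := by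
    induction m using Fin.reverseInduction with
    | last => rw [hd, H.last, hE]
    | cast m ih => rw [H.castSucc, ← Frame.mul_mul, ← ih, hb, Sum.elim_inr]
  refine ⟨N.left, N.hom, g, hg, c (.inl 0), Sum.elim a b, E, D, H, ?_, fun m ↦ ?_, fun m ↦ ?_⟩
  · rintro (m | m)
    · refine isParabolic_iff_sameMember (e := c (.inl m.castSucc)).mp fun i hi ↦ ?_
      have := (x.sameMember m hi).res g
      rwa [hx, hx, ha] at this
    · refine isParabolic_iff_sameMember (e := d m.succ).mp fun i hi ↦ ?_
      have := sameMember_comm ((y.sameMember m hi).res g)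
      rwa [hy, hy, hb] at this
  · rw [← hE]
    exact hx m
  · rw [← hD]
    exact hy m

end

end RelFlag

/-! ### The smooth chart given by versality -/

namespace RelFlag

open Matrix

section

variable {B S : Scheme.{u}} {n : ℕ} {V : VectorBundle S n} {p q : Flag V (Over.mk (𝟙 S))}
  {ρ ρ' : List (Fin (n - 1))} {σ τ : Equiv.Perm (Fin n)}

/-- The base change of a matrix along a morphism of schemes. -/
noncomputable def pullGL {X Y : Scheme.{u}} (f : X ⟶ Y) :
    GL (Fin n) Γ(Y, ⊤) →* GL (Fin n) Γ(X, ⊤) :=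
  GeneralLinearGroup.map f.appTop.hom

theorem pullGL_comp {X Y Z : Scheme.{u}} (f : X ⟶ Y) (g : Y ⟶ Z) (m : GL (Fin n) Γ(Z, ⊤)) :
    pullGL (f ≫ g) m = pullGL f (pullGL g m) := by
  ext a b
  change (f ≫ g).appTop.hom _ = f.appTop.hom (g.appTop.hom _)
  rw [Scheme.Hom.comp_appTop]
  rfl

theorem pullGL_val {X Y : Scheme.{u}} (f : X ⟶ Y) (m : GL (Fin n) Γ(Y, ⊤)) :
    (pullGL f m).val = m.val.map f.appTop.hom := rfl

theorem stdFlag_res {T' T : Over B} (g : T' ⟶ T) (m : GL (Fin n) Γ(T.left, ⊤)) :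
    (Flag.ofFrame ((stdFrame n T).mul m)).res g =
      Flag.ofFrame ((stdFrame n T').mul (pullGL g.left m)) := by
  rw [Flag.ofFrame_res, Frame.mul_res, stdFrame_res]
  rfl

theorem FramePoint.flag_mk {s : S ⟶ B} {N : Scheme.{u}} (ν : N ⟶ S) (f : Frame V (Over.mk ν)) :
    FramePoint.flag (s := s) (T := Over.mk (ν ≫ s)) ⟨Over.homMk ν, f⟩ p =
      f.pullFlag (T := Over.mk (ν ≫ s)) (p.at (Over.mk ν)) := rfl

theorem FramePoint.left_comp_of_res_eq {s : S ⟶ B} {T' T : Over B} {a : T' ⟶ T}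
    {x : FramePoint s V T} {x' : FramePoint s V T'} (h : x.res a = x') :
    a.left ≫ x.toBase.left = x'.toBase.left := by
  subst h
  rfl

/-- A versal pair provides, for every family `H` of parabolic matrices on a `B`-scheme `Y`, a scheme
smooth over `Y` which parametrizes the frames in which the two flags are related by the partial
products of `H`. -/
theorem Versal.exists_frame {s : S ⟶ B} (hpq : Versal s p q) (Y : Over B)
    (m₁ m₂ : GL (Fin n) Γ(Y.left, ⊤)) :
    ∃ (P : Over S) (b : P.left ⟶ Y.left) (e : Frame V P), Smooth b ∧
      b ≫ Y.hom = P.hom ≫ s ∧ p.at P = Flag.ofFrame (e.mul (pullGL b m₁)) ∧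
      q.at P = Flag.ofFrame (e.mul (pullGL b m₂)) ∧
      ∀ (N : Scheme.{u}) (ν : N ⟶ S) (c : N ⟶ Y.left) (f : Frame V (Over.mk ν)),
        c ≫ Y.hom = ν ≫ s → p.at (Over.mk ν) = Flag.ofFrame (f.mul (pullGL c m₁)) →
        q.at (Over.mk ν) = Flag.ofFrame (f.mul (pullGL c m₂)) →
        ∃ a : Over.mk ν ⟶ P, a.left ≫ b = c ∧ e.res a = f := by
  obtain ⟨P, π, ξ, hπ, hp, hq, H⟩ := hpq.exists_universal Y
    (Flag.ofFrame ((stdFrame n Y).mul m₁)) (Flag.ofFrame ((stdFrame n Y).mul m₂))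
  rw [stdFlag_res] at hp hq
  have hw : ξ.toBase.left ≫ s = P.hom := Over.w ξ.toBase
  refine ⟨Over.mk ξ.toBase.left, π.left, ξ.frame, hπ, (Over.w π).trans hw.symm,
    (ξ.frame.pullFlag_eq_iff _).mp hp, (ξ.frame.pullFlag_eq_iff _).mp hq, ?_⟩
  intro N ν c f hc hp' hq'
  have key (F : Flag V (Over.mk (𝟙 S))) (m : GL (Fin n) Γ(Y.left, ⊤))
      (hF : F.at (Over.mk ν) = Flag.ofFrame (f.mul (pullGL c m))) :
      FramePoint.flag (s := s) (T := Over.mk (ν ≫ s)) ⟨Over.homMk ν, f⟩ F =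
        (Flag.ofFrame ((stdFrame n Y).mul m)).res (Over.homMk c hc) := by
    rw [stdFlag_res, FramePoint.flag_mk]
    exact (f.pullFlag_eq_iff (T := Over.mk (ν ≫ s)) (pullGL c m)).mpr hF
  obtain ⟨a, ha, haξ⟩ := H (Over.mk (ν ≫ s)) (Over.homMk c hc) _ (key p m₁ hp') (key q m₂ hq')
  have h₁ : a.left ≫ ξ.toBase.left = ν := FramePoint.left_comp_of_res_eq haξ
  let a' : Over.mk ν ⟶ Over.mk ξ.toBase.left := Over.homMk a.left h₁
  exact ⟨a', congrArg CommaMorphism.left ha, (FramePoint.frame_eq_of_res_eq haξ a' rfl).symm⟩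

variable {k : Type u} [Field k] {s : S ⟶ Spec (CommRingCat.of k)} {Z : Over S}
  {x : BottSamelsonPoint p ρ Z} {y : BottSamelsonPoint q ρ' Z}

/-- The heart of the proof. `P` parametrizes families of parabolic matrices with a frame in which
`p` is standard and `q` is the flag of the resulting matrix `D 0`. It is smooth over the irreducible
space `Y` of families, its map `r` to the fiber product has local sections, and where `f` is
invertible the last flag lies in both cells. -/
theorem Versal.exists_smooth_chart (hpq : Versal s p q) (hρ : IsReducedWord ρ σ)
    (hρ' : IsReducedWord ρ' τ) (hZ : IsUniversalPair x y) :
    ∃ (Y : Scheme.{u}) (f : Γ(Y, ⊤)) (P : Over S) (b : P.left ⟶ Y) (r : P ⟶ Z),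
      IrreducibleSpace Y ∧ (Y.basicOpen f : Set Y).Nonempty ∧ Smooth b ∧ Smooth (P.hom ≫ s) ∧
      (∀ z : Z.left, ∃ (N : Over S) (i : N ⟶ P), IsNbhd (i ≫ r) z) ∧
      ∀ (T : Over S) (g : T ⟶ P), IsUnit (resHom g (b.appTop.hom f)) →
        InCell σ (p.at T) (x.last.res (g ≫ r)) ∧ InCell τ (q.at T) (x.last.res (g ≫ r)) := by
  obtain ⟨Y, H, hYs, hYi, hH, hY⟩ := exists_universal_parabolic k (Sum.elim ρ.get ρ'.get)
  obtain ⟨E, D, hED⟩ := exists_isPartialProducts H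
  obtain ⟨P, b, e, hb, hbs, hp, hq, hP⟩ := hpq.exists_frame Y (E 0) (D 0)
  have hpar {X : Scheme.{u}} (g : X ⟶ Y.left) (i) :
      IsParabolic (Sum.elim ρ.get ρ'.get i) (pullGL g (H i)).val := by
    have := isParabolic_iff.mp (hH i)
    rw [isParabolic_iff]
    intro a b hab h
    rw [pullGL_val, map_apply, this a b hab h, map_zero]
  rw [hED.zero, map_one, Frame.mul_one] at hp
  obtain ⟨x', y', hx', hy'⟩ := (hED.map (pullGL b)).exists_points (T := P) (hpar b) hp hq
  have hxy' : x'.last = y'.last :=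
    (hx' _).trans ((congrArg (fun m ↦ Flag.ofFrame (e.mul (pullGL b m))) hED.last.symm).trans
      (hy' _).symm)
  obtain ⟨r, ⟨hrx, hry⟩, -⟩ := hZ.2 P x' y' hxy'
  -- Invertibility of `f` says that every matrix of the family lies in the big cell of its parabolic
  -- group; the family of simple transpositions, with entries 1 there, shows that this happens
  -- somewhere.
  let f : Γ(Y.left, ⊤) :=
    ∏ i, (H i).val (hi (Sum.elim ρ.get ρ'.get i)) (lo (Sum.elim ρ.get ρ'.get i))
  refine ⟨Y.left, f, P, b, r, hYi, ?_, hb, ?_, fun z ↦ ?_, fun T g hg ↦ ?_⟩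
  · obtain ⟨c, hc⟩ := hY (Over.mk (𝟙 _)) (fun i ↦ permGL _ (simpleTransposition
      (Sum.elim ρ.get ρ'.get i))) fun i ↦ isParabolic_permGL _
    refine ⟨_, mem_basicOpen_of_isUnit c ?_ (IsLocalRing.closedPoint k)⟩
    rw [map_prod]
    refine IsUnit.prod_univ_iff.mpr fun i ↦ ?_
    have := congrArg (fun m ↦ m.val (hi (Sum.elim ρ.get ρ'.get i))
      (lo (Sum.elim ρ.get ρ'.get i))) (hc i)
    rw [resGL_val, map_apply, permGL_apply, simpleTransposition_lo, if_pos rfl] at this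
    rw [this]
    exact isUnit_one
  · rw [← hbs]
    infer_instance
  -- Near `z` the universal pair is given by a frame and a parabolic family. These define a map `c`
  -- to `Y` and then a map `a` to `P`, which is a local section of `r` because it reproduces all
  -- flags of both chains.
  · obtain ⟨N, ν, g, hg, d, h, E', D', hED', hpar', hx, hy⟩ := exists_nbhd_frames x y hZ.1 z
    obtain ⟨c, hc⟩ := hY (Over.mk (ν ≫ s)) h hpar'
    have hmap : IsPartialProducts h (fun m ↦ pullGL c.left (E m)) fun m ↦ pullGL c.left (D m) := by
      have := hED.map (pullGL c.left)
      have hc' : (fun i ↦ pullGL c.left (H i)) = h := funext hc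
      rwa [hc'] at this
    obtain ⟨rfl, rfl⟩ := hED'.unique hmap
    obtain ⟨a, ha, had⟩ := hP N ν c.left d (Over.w c) (by
        rw [← hx 0, x.flag_zero, Flag.res_at]) (by
        rw [← hy 0, y.flag_zero, Flag.res_at])
    have hpull (m : GL (Fin n) Γ(Y.left, ⊤)) : resGL a (pullGL b m) = pullGL c.left m := by
      rw [← ha, pullGL_comp]
      rfl
    refine ⟨Over.mk ν, a, ?_⟩
    have : a ≫ r = g := by
      refine hZ.mono (BottSamelsonPoint.ext (funext fun m ↦ ?_))
        (BottSamelsonPoint.ext (funext fun m ↦ ?_))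
      · rw [BottSamelsonPoint.res_comp, hrx]
        refine Eq.trans ?_ (hx m).symm
        change (x'.flag m).res a = _
        rw [hx', Flag.ofFrame_res, Frame.mul_res, had, hpull]
      · rw [BottSamelsonPoint.res_comp, hry]
        refine Eq.trans ?_ (hy m).symm
        change (y'.flag m).res a = _
        rw [hy', Flag.ofFrame_res, Frame.mul_res, had, hpull]
    rwa [this]
  · have hpull (m : GL (Fin n) Γ(Y.left, ⊤)) : resGL g (pullGL b m) = pullGL (g.left ≫ b) m := by
      rw [pullGL_comp]
      rfl
    have hcell := (hED.map (pullGL (g.left ≫ b))).inCell (T := T) (e := e.res g)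
      (hpar (g.left ≫ b)) hρ hρ' fun i ↦ by
        rw [pullGL_val, map_apply, Scheme.Hom.comp_appTop]
        have : IsUnit (∏ i, resHom g (b.appTop.hom ((H i).val (hi (Sum.elim ρ.get ρ'.get i))
            (lo (Sum.elim ρ.get ρ'.get i))))) := by
          rwa [map_prod, map_prod] at hg
        exact IsUnit.prod_univ_iff.mp this i
    have hlast : x.last.res (g ≫ r) =
        Flag.ofFrame ((e.res g).mul (pullGL (g.left ≫ b) (E (Fin.last _)))) := by
      have hlast' : x.last.res r = x'.last := congrArg BottSamelsonPoint.last hrx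
      rw [Flag.res_comp, hlast']
      change (x'.flag _).res g = _
      rw [hx', Flag.ofFrame_res, Frame.mul_res, hpull]
    have hpT : p.at T = Flag.ofFrame (e.res g) := by
      rw [← Flag.res_at p g, hp, Flag.ofFrame_res]
    have hqT : q.at T = Flag.ofFrame ((e.res g).mul (pullGL (g.left ≫ b) (D 0))) := by
      rw [← Flag.res_at q g, hq, Flag.ofFrame_res, Frame.mul_res, hpull]
    rw [hlast, hpT, hqT]
    exact hcell

end

end RelFlag

/-! ### Smoothness, density and properness -/

namespace RelFlag

section

variable {k : Type u} [Field k] {S : Scheme.{u}} {s : S ⟶ Spec (CommRingCat.of k)} {n : ℕ}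
  {V : VectorBundle S n} {p q : Flag V (Over.mk (𝟙 S))} {ρ ρ' : List (Fin (n - 1))}
  {σ τ : Equiv.Perm (Fin n)} {Z X : Over S} {x : BottSamelsonPoint p ρ Z}
  {y : BottSamelsonPoint q ρ' Z} {F : Flag V X}

/-- Properness over S gives finite presentation over the field, and the local sections of `P` supply
the retracts. -/
theorem IsUniversalPair.smooth [IsLocallyNoetherian S] [CompactSpace S] [LocallyOfFiniteType s]
    (hpq : Versal s p q) (hρ : IsReducedWord ρ σ) (hρ' : IsReducedWord ρ' τ)
    (hZ : IsUniversalPair x y) : Smooth (Z.hom ≫ s) := by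
  have := hZ.isProper
  have : LocallyOfFinitePresentation (Z.hom ≫ s) := inferInstance
  obtain ⟨Y, f, P, b, r, -, -, -, hP, hN, -⟩ := hpq.exists_smooth_chart hρ hρ' hZ
  refine smooth_of_retracts _ fun z ↦ ?_
  obtain ⟨N, i, hi⟩ := hN z
  refine ⟨N.left, P.left, i.left, r.left, hi.isOpenImmersion, hi.mem_range, ?_⟩
  rw [Over.w_assoc]
  exact hP

/-- A nonempty open subset of the fiber product has nonempty open preimage in `P`, whose image in
the irreducible `Y` is open since `b` is smooth. That image therefore meets the locus of big cells,
whose points of `P` map into the cell locus. -/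
theorem dense_preimage_cellLocus (hpq : Versal s p q) (hρ : IsReducedWord ρ σ)
    (hρ' : IsReducedWord ρ' τ) (hZ : IsUniversalPair x y) (hF : IsUniversalRichardson p q σ τ F)
    {f : Z ⟶ X} (hf : F.res f = x.last) :
    Dense ((f.left ⁻¹ᵁ cellLocus p q σ τ F : Z.left.Opens) : Set Z.left) := by
  obtain ⟨Y, w, P, b, r, hY, hw, hb, -, hN, hcell⟩ := hpq.exists_smooth_chart hρ hρ' hZ
  rw [dense_iff_inter_open]
  rintro O hO ⟨z, hz⟩
  obtain ⟨N, i, hi⟩ := hN z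
  obtain ⟨c, rfl⟩ := hi.mem_range
  have hopen : IsOpen (b '' (r.left ⁻¹' O)) := b.isOpenMap _ (hO.preimage r.left.continuous)
  obtain ⟨-, ⟨t, ht, rfl⟩, htw⟩ := nonempty_preirreducible_inter hopen (Y.basicOpen w).isOpen
    ⟨_, i.left c, hz, rfl⟩ hw
  have htw' : t ∈ P.left.basicOpen (b.appTop.hom w) := by
    rw [← Scheme.preimage_basicOpen_top]
    exact htw
  obtain ⟨T, g, hg, hu⟩ := exists_isUnit_nbhd htw'
  obtain ⟨t, rfl⟩ := hg.mem_range
  obtain ⟨h₁, h₂⟩ := hcell T g hu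
  rw [← hf, ← Flag.res_comp] at h₁ h₂
  exact ⟨r.left (g.left t), ht, hF.mem_cellLocus h₁ h₂ t⟩

theorem isProper_of_isUniversal [IsLocallyNoetherian S] [CompactSpace S]
    (hZ : IsUniversalPair x y) (hF : IsUniversalRichardson p q σ τ F) (f : Z ⟶ X) :
    IsProper f.left := by
  have := hF.isProper
  have : IsProper (f.left ≫ X.hom) := by
    rw [Over.w]
    exact hZ.isProper
  exact IsProper.of_comp f.left X.hom

end

section

variable {S : Scheme.{u}} {n : ℕ} {V : VectorBundle S n} {p q : Flag V (Over.mk (𝟙 S))}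
  {ρ ρ' : List (Fin (n - 1))} {σ τ : Equiv.Perm (Fin n)}

theorem range_bottSamelsonProductToFlag_le (hρ : IsReducedWord ρ σ) (hρ' : IsReducedWord ρ' τ) :
    Subfunctor.range (bottSamelsonProductToFlag p q ρ ρ') ≤ richardson p q σ τ := by
  rintro T _ ⟨z, rfl⟩
  refine ⟨BottSamelsonPoint.last_relativePositionLE hρ (prodFst z), ?_⟩
  change RelativePositionLE τ _ (prodFst z).last
  rw [prodFst_last]
  exact BottSamelsonPoint.last_relativePositionLE hρ' (prodSnd z)

/-- Identifies the morphism of representing schemes as the one that pulls the universal Richardson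
flag back to the common last flag, the form used in the geometric lemmas. -/
theorem res_representedHom
    {π : bottSamelsonProduct p q ρ ρ' ⟶ (richardson p q σ τ).toFunctor}
    (hπ : π ≫ (richardson p q σ τ).ι = bottSamelsonProductToFlag p q ρ ρ') {Z X : Over S}
    (hZ : (bottSamelsonProduct p q ρ ρ').RepresentableBy Z)
    (hX : (richardson p q σ τ).toFunctor.RepresentableBy X) :
    (hX.homEquiv (𝟙 X)).1.res (representedHom π hZ hX) = (prodFst (hZ.homEquiv (𝟙 Z))).last := by
  have h₁ : hX.homEquiv (representedHom π hZ hX) = π.app (op Z) (hZ.homEquiv (𝟙 Z)) :=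
    Equiv.apply_symm_apply _ _
  rw [hX.homEquiv_eq] at h₁
  have h₂ := ConcreteCategory.congr_hom (NatTrans.congr_app hπ (op Z)) (hZ.homEquiv (𝟙 Z))
  exact (congrArg Subtype.val h₁).trans h₂

end

end RelFlag

/-! ### The resolution theorem -/

theorem mainTheorem1 {k : Type u} [Field k] {S : Scheme.{u}}
    (s : S ⟶ Spec (CommRingCat.of k)) [Smooth s] [LocallyOfFiniteType s] [QuasiCompact s]
    {n : ℕ} (H : RelFlag.VectorBundle S n)
    (p q : RelFlag.Flag H (Over.mk (𝟙 S))) (hpq : RelFlag.Versal s p q)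
    (σ τ : Equiv.Perm (Fin n)) (ρσ ρτ : List (Fin (n - 1)))
    (hσ : RelFlag.IsReducedWord ρσ σ) (hτ : RelFlag.IsReducedWord ρτ τ) :
    (RelFlag.bottSamelsonProduct p q ρσ ρτ).IsRepresentable ∧
    (RelFlag.richardson p q σ τ).toFunctor.IsRepresentable ∧
    ∃ π : RelFlag.bottSamelsonProduct p q ρσ ρτ ⟶ (RelFlag.richardson p q σ τ).toFunctor,
      π ≫ (RelFlag.richardson p q σ τ).ι = RelFlag.bottSamelsonProductToFlag p q ρσ ρτ ∧
      ∀ (Z X : Over S) (hZ : (RelFlag.bottSamelsonProduct p q ρσ ρτ).RepresentableBy Z)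
        (hX : (RelFlag.richardson p q σ τ).toFunctor.RepresentableBy X),
        Smooth (Z.hom ≫ s) ∧
        IsProper (RelFlag.representedHom π hZ hX).left ∧
        RelFlag.IsBirational (RelFlag.representedHom π hZ hX).left ∧
        RelFlag.IsResolutionOfSingularities (X.hom ≫ s) (RelFlag.representedHom π hZ hX).left := by
  -- Finite type over a field makes the base Noetherian, as representability by closed subschemes
  -- and properness require.
  have : IsLocallyNoetherian S := LocallyOfFiniteType.isLocallyNoetherian s
  have : CompactSpace S := QuasiCompact.compactSpace_of_compactSpace s
  obtain ⟨π, hπ⟩ : ∃ π, π ≫ (RelFlag.richardson p q σ τ).ι =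
      RelFlag.bottSamelsonProductToFlag p q ρσ ρτ :=
    ⟨_, Subfunctor.lift_ι _ (RelFlag.range_bottSamelsonProductToFlag_le hσ hτ)⟩
  refine ⟨RelFlag.isRepresentable_bottSamelsonProduct p q ρσ ρτ,
    RelFlag.isRepresentable_richardson p q σ τ, π, hπ, fun Z X hZ hX ↦ ?_⟩
  have hxy := RelFlag.isUniversalPair_of_representableBy hZ
  have hF := RelFlag.isUniversalRichardson_of_representableBy hX
  have hf := RelFlag.res_representedHom hπ hZ hX
  have hsmooth := hxy.smooth hpq hσ hτ
  have hproper := RelFlag.isProper_of_isUniversal hxy hF (RelFlag.representedHom π hZ hX)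
  have hbir := RelFlag.isBirational_of_dense hσ hτ hxy hF hf
    (RelFlag.dense_preimage_cellLocus hpq hσ hτ hxy hF hf)
  refine ⟨hsmooth, hproper, hbir, ?_, hproper, hbir⟩
  rwa [Over.w_assoc]
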